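/- Setting. Let $G$ be a finite-dimensional real Lie group with Lie algebra $\mathfrak g=T_eG$ (bracket of left-invariant vector fields). Let $\mathcal G=\mathrm{Map}(\mathbb R,G)$ be the group of smooth maps $x\mapsto g(x)\in G$ with periodic boundary conditions (a fixed period $P>0$) or vanishing boundary conditions ($g(x)=e$ for large $|x|$), under pointwise multiplication, and let $\mathcal L=\mathrm{Map}(\mathbb R,\mathfrak g)$ be its Lie algebra of smooth maps with the same boundary conditions ($0$ in place of $e$) and pointwise bracket. The symbol $\int dx$ means integration over one period, resp. over $\mathbb R$. Smooth families in $\mathcal G$, $\mathcal L$ are families depending smoothly on the parameters and $x$ jointly (with locally uniformly bounded support in the vanishing case); a function on $\mathcal L$ (or of several arguments in $\mathcal G$) is called smooth if it is smooth along smooth finite-dimensional families, and a set is called open if its preimage under each smooth finite-dimensional family is open. Let $l:\mathcal L\to\mathbb R$ be a smooth functional, and let $\frac{\delta l}{\delta M}$ be its variational derivative at $M$, i.e. the linear form $\langle\frac{\delta l}{\delta M},\xi\rangle=\frac{d}{d\sigma}\big|_{\sigma=0}l(M+\sigma\xi)$ on $\mathcal L$. Put $\langle\mathrm{ad}^*_M\mu,\xi\rangle=\langle\mu,[M,\xi]\rangle$.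 Fix $t_0<t_1$. Central extension. Let $B$ be a smooth group two-cocycle, $B(g,h)+B(gh,k)=B(h,k)+B(g,hk)$ and $B(e,e)=0$, on an open neighbourhood $W$ of the identity of $\mathcal G$ (the identity being required whenever $g,h,k,gh,hk,ghk\in W$, smoothness of $B(g,h)$ where $g,h,gh\in W$; $W=\mathcal G$ is the case of a global cocycle). It defines the central extension $\mathcal G^c=\mathcal G\times\mathbb R$ with $(g,a)(h,b)=(gh,a+b+B(g,h))$ and $(g,a)^{-1}=(g^{-1},-a-B(g^{-1},g))$ (a local group if $W\ne\mathcal G$). Its Lie algebra is $\mathcal L\times\mathbb R$ with bracket $[(\xi,a),(\eta,b)]=([\xi,\eta],c(\xi,\eta))$, where $c$ is the Lie algebra cocycle of $B$: $c(\xi,\eta)=\partial_\sigma\partial_\tau|_{0}\,\big(B(g_\sigma,h_\tau)-B(h_\tau,g_\sigma)\big)$ for smooth curves $g_\sigma,h_\tau$ in $\mathcal G$ through the identity with velocities $\xi,\eta$. Let $\mathscr L$ be the left-invariant Lagrangian on $T\mathcal G^c$ given by $\mathscr L(\gamma,\dot\gamma)=l(M)+\frac12a^2$ with $(M,a)=\gamma^{-1}\dot\gamma$;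 so for $\gamma=(g,s)$ one has $M=g^{-1}\partial_tg$, and $a$ is called the central velocity. Theorem (Euler–Poincaré reduction with central extension). Let $\gamma=(g,s)$ be a smooth curve in $\mathcal G^c$ with $g(t),g(t)^{-1}\in W$ for $t\in[t_0,t_1]$, and let $(M,a)=\gamma^{-1}\dot\gamma$. (a) If $\gamma$ satisfies (1) below, then its central velocity $a$ is constant on $[t_0,t_1]$. (b) If $a\equiv m$ is constant on $[t_0,t_1]$ (for instance $m=1$), the following statements are equivalent: (1) Hamilton's principle holds on $\mathcal G^c$: $\delta\int_{t_0}^{t_1}\mathscr L(\gamma,\dot\gamma)\,dt=0$ for all smooth variations of $\gamma$ with fixed endpoints; (2) $\gamma$ satisfies the Euler–Lagrange equations of $\mathscr L$ on $[t_0,t_1]$, i.e. $\frac{d}{dt}\langle\frac{\partial\mathscr L}{\partial\dot\gamma},\delta\gamma\rangle=\delta\mathscr L$ at every time for every variation; (3) the constrained variational principle $\delta\int_{t_0}^{t_1}\big(l(M)+\frac12a^2\big)dt=0$ holds at $(M,m)$ for variations of the form $\delta(M,a)=(\partial_t\eta+[M,\eta],\,c(M,\eta))$, for arbitrary smooth $\eta(t)\in\mathcal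 L$ with $\eta(t_0)=\eta(t_1)=0$; (4) the Euler–Poincaré equation with central extension $$\frac{\partial}{\partial t}\frac{\delta l}{\delta M}=\mathrm{ad}^*_M\frac{\delta l}{\delta M}+m\,c(M,\cdot)$$ holds on $[t_0,t_1]$ (as an equation between linear forms on $\mathcal L$). (c) Let $c(\xi,\eta)=\int\langle\xi,\partial_x\eta\rangle\,dx$ be the derivative cocycle, where $\langle\cdot,\cdot\rangle$ is the Killing form of $\mathfrak g$. Then (3) and (4) are equivalent for every smooth curve $M(t)\in\mathcal L$ and every $m\in\mathbb R$. If $\mathfrak g$ is semisimple and $\frac{\delta l}{\delta M}$ is represented on $[t_0,t_1]$ by a smooth $\mathfrak g$-valued function $\mu(t,x)$ (periodic in $x$ in the periodic case) through $\langle\frac{\delta l}{\delta M},\xi\rangle=\int\langle\mu,\xi\rangle\,dx$, then (4) is equivalent to $$\partial_t\mu=-[M,\mu]-m\,\partial_xM\qquad\text{on }[t_0,t_1]\times\mathbb R .$$ In particular, if the Lie algebra cocycle of $B$ in (b) is the derivative cocycle, all of (1)–(4) are equivalent to this equation, with $M=g^{-1}\partial_tg$. -/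

import Mathlib

open Set Filter Topology MeasureTheory
open scoped Manifold ContDiff

noncomputable section

namespace CentralExtEP

/-- The boundary conditions in the space variable `x`: either everything is periodic of some period
`P > 0`, or everything is trivial for large `|x|`. -/
inductive BoundaryCond where
  | periodic (P : ℝ) (hP : 0 < P)
  | vanishing

namespace BoundaryCond

/-- A map of the space variable satisfies the boundary condition; `o` is the trivial value. -/
def Holds {X : Type*} (bc : BoundaryCond) (o : X) (f : ℝ → X) : Prop :=
  match bc with
  | periodic P _ => ∀ x, f (x + P) = f x
  | vanishing => ∃ R : ℝ, ∀ x, R ≤ |x| → f x = o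

/-- A family of maps of the space variable satisfies the boundary condition. In the vanishing case
the support has to be bounded locally uniformly in the parameter, as for smooth families of
compactly supported maps. -/
def HoldsFamily {F X : Type*} [TopologicalSpace F] (bc : BoundaryCond) (o : X) (f : F → ℝ → X) :
    Prop :=
  match bc with
  | periodic P _ => ∀ σ x, f σ (x + P) = f σ x
  | vanishing => ∀ σ₀, ∃ R : ℝ, ∀ᶠ σ in 𝓝 σ₀, ∀ x, R ≤ |x| → f σ x = o

/-- The condition on a coefficient function that is paired with maps satisfying the boundary
condition: periodicity in the periodic case, nothing in the vanishing case. -/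
def HoldsDual {X : Type*} (bc : BoundaryCond) (f : ℝ → X) : Prop :=
  match bc with
  | periodic P _ => ∀ x, f (x + P) = f x
  | vanishing => True

/-- Integration over space: over one period, or over the line. -/
def integral (bc : BoundaryCond) (f : ℝ → ℝ) : ℝ :=
  match bc with
  | periodic P _ => ∫ x in (0 : ℝ)..P, f x
  | vanishing => ∫ x, f x

end BoundaryCond

variable {E : Type*} [NormedAddCommGroup E] [NormedSpace ℝ E]
  {G : Type*} [TopologicalSpace G] [ChartedSpace E G] [Group G]

instance instLieGroupMinSmoothness [LieGroup 𝓘(ℝ, E) ∞ G] :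
    LieGroup 𝓘(ℝ, E) (minSmoothness ℝ 3) G := by
  rw [minSmoothness_of_isRCLikeNormedField]
  infer_instance

variable (E G) in
/-- The group `Map(ℝ, G)` of smooth maps of the space variable into the Lie group `G` with the given
boundary condition, under pointwise multiplication. -/
def mapGroup [LieGroup 𝓘(ℝ, E) ∞ G] (bc : BoundaryCond) : Subgroup (ℝ → G) where
  carrier := {g | ContMDiff 𝓘(ℝ, ℝ) 𝓘(ℝ, E) ∞ g ∧ bc.Holds 1 g}
  mul_mem' := by
    rintro g h ⟨hg, hg'⟩ ⟨hh, hh'⟩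
    refine ⟨hg.mul hh, ?_⟩
    cases bc with
    | periodic P hP =>
      intro x
      simp only [Pi.mul_apply, hg' x, hh' x]
    | vanishing =>
      obtain ⟨R, hR⟩ := hg'
      obtain ⟨S, hS⟩ := hh'
      refine ⟨max R S, fun x hx => ?_⟩
      simp only [Pi.mul_apply, hR x ((le_max_left _ _).trans hx),
        hS x ((le_max_right _ _).trans hx), mul_one]
  one_mem' := by
    refine ⟨contMDiff_const, ?_⟩
    cases bc with
    | periodic P hP => intro x; rfl
    | vanishing => exact ⟨0, fun x _ => rfl⟩
  inv_mem' := by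
    rintro g ⟨hg, hg'⟩
    refine ⟨hg.inv, ?_⟩
    cases bc with
    | periodic P hP =>
      intro x
      simp only [Pi.inv_apply, hg' x]
    | vanishing =>
      obtain ⟨R, hR⟩ := hg'
      exact ⟨R, fun x hx => by simp only [Pi.inv_apply, hR x hx, inv_one]⟩

variable (E G) in
/-- The Lie algebra `Map(ℝ, 𝔤)` of the map group, with pointwise bracket. The tangent space `𝔤` of
`G` at the identity has the underlying normed space `E`. -/
def mapAlgebra (bc : BoundaryCond) : Set (ℝ → GroupLieAlgebra 𝓘(ℝ, E) G) :=
  {ξ | ContDiff ℝ ∞ (F := E) (fun x => ξ x) ∧ bc.Holds 0 ξ}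

/-- A smooth family of elements of the map group: the parameter and `x` enter jointly smoothly. -/
def SmoothGroupFamily [LieGroup 𝓘(ℝ, E) ∞ G] {bc : BoundaryCond} {F : Type*}
    [NormedAddCommGroup F] [NormedSpace ℝ F] (g : F → mapGroup E G bc) : Prop :=
  ContMDiff 𝓘(ℝ, F × ℝ) 𝓘(ℝ, E) ∞ (fun p : F × ℝ => (g p.1 : ℝ → G) p.2) ∧
    bc.HoldsFamily 1 (fun σ => (g σ : ℝ → G))

/-- A smooth family of elements of the Lie algebra `Map(ℝ, 𝔤)`. -/
def SmoothAlgebraFamily (bc : BoundaryCond) {F : Type*} [NormedAddCommGroup F] [NormedSpace ℝ F]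
    (ξ : F → ℝ → GroupLieAlgebra 𝓘(ℝ, E) G) : Prop :=
  ContDiff ℝ ∞ (F := E) (fun p : F × ℝ => ξ p.1 p.2) ∧ bc.HoldsFamily 0 ξ

/-- A smooth functional on the Lie algebra `Map(ℝ, 𝔤)`: it is smooth along smooth finite-dimensional
families. Only the values of `l` on `mapAlgebra` matter. -/
def SmoothFunctional (bc : BoundaryCond) (l : (ℝ → GroupLieAlgebra 𝓘(ℝ, E) G) → ℝ) : Prop :=
  ∀ (n : ℕ) (ξ : (Fin n → ℝ) → ℝ → GroupLieAlgebra 𝓘(ℝ, E) G),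
    SmoothAlgebraFamily bc ξ → ContDiff ℝ ∞ (fun σ => l (ξ σ))

/-- The variational derivative `δl/δM`, as a linear form: `⟨δl/δM, ξ⟩` is the directional
derivative of `l` at `M` in the direction `ξ`. -/
def varDeriv (l : (ℝ → GroupLieAlgebra 𝓘(ℝ, E) G) → ℝ)
    (M ξ : ℝ → GroupLieAlgebra 𝓘(ℝ, E) G) : ℝ :=
  deriv (fun σ : ℝ => l (fun x => M x + σ • ξ x)) 0

/-- The left logarithmic derivative `g⁻¹ ġ` at time `t` of a curve in `G`. The curve
`τ ↦ g(t)⁻¹ g(τ)` passes at `τ = t` through the identity, so its velocity is in the Lie algebra. -/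
def leftLogDeriv (g : ℝ → G) (t : ℝ) : GroupLieAlgebra 𝓘(ℝ, E) G :=
  (mfderiv 𝓘(ℝ, ℝ) 𝓘(ℝ, E) (fun τ => (g t)⁻¹ * g τ) t (1 : ℝ) : E)

/-- The left trivialised velocity `M(t, x) = g⁻¹ ∂ₜ g` of a curve in the map group. -/
def velocity [LieGroup 𝓘(ℝ, E) ∞ G] {bc : BoundaryCond} (g : ℝ → mapGroup E G bc) (t : ℝ) :
    ℝ → GroupLieAlgebra 𝓘(ℝ, E) G :=
  fun x => leftLogDeriv (fun τ => (g τ : ℝ → G) x) t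

section Extension

variable [LieGroup 𝓘(ℝ, E) ∞ G] {bc : BoundaryCond}

/-- `B` is a smooth normalised group two-cocycle on the neighbourhood `W` of the identity of the map
group. For `W = univ` this is an ordinary group two-cocycle. -/
structure IsCocycleOn (W : Set (mapGroup E G bc)) (B : mapGroup E G bc → mapGroup E G bc → ℝ) :
    Prop where
  one_mem : 1 ∈ W
  isOpen : ∀ (n : ℕ) (g : (Fin n → ℝ) → mapGroup E G bc), SmoothGroupFamily g →
    IsOpen {σ | g σ ∈ W}
  map_one_one : B 1 1 = 0
  cocycle : ∀ g h k, g ∈ W → h ∈ W → k ∈ W → g * h ∈ W → h * k ∈ W → g * h * k ∈ W →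
    B g h + B (g * h) k = B h k + B g (h * k)
  smooth : ∀ (n : ℕ) (g h : (Fin n → ℝ) → mapGroup E G bc), SmoothGroupFamily g →
    SmoothGroupFamily h → ∀ σ₀, g σ₀ ∈ W → h σ₀ ∈ W → g σ₀ * h σ₀ ∈ W →
      ContDiffAt ℝ ∞ (fun σ => B (g σ) (h σ)) σ₀

/-- The multiplication `(g, a) (h, b) = (g h, a + b + B(g, h))` of the central extension
`Gᶜ = Map(ℝ, G) × ℝ`. -/
def extMul (B : mapGroup E G bc → mapGroup E G bc → ℝ) (p q : mapGroup E G bc × ℝ) :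
    mapGroup E G bc × ℝ :=
  (p.1 * q.1, p.2 + q.2 + B p.1 q.1)

/-- The inverse `(g, a)⁻¹ = (g⁻¹, - a - B(g⁻¹, g))` in the central extension. -/
def extInv (B : mapGroup E G bc → mapGroup E G bc → ℝ) (p : mapGroup E G bc × ℝ) :
    mapGroup E G bc × ℝ :=
  (p.1⁻¹, -p.2 - B p.1⁻¹ p.1)

theorem extMul_assoc {W : Set (mapGroup E G bc)} {B : mapGroup E G bc → mapGroup E G bc → ℝ}
    (hB : IsCocycleOn W B) (p q r : mapGroup E G bc × ℝ) (hp : p.1 ∈ W) (hq : q.1 ∈ W)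
    (hr : r.1 ∈ W) (hpq : p.1 * q.1 ∈ W) (hqr : q.1 * r.1 ∈ W) (hpqr : p.1 * q.1 * r.1 ∈ W) :
    extMul B (extMul B p q) r = extMul B p (extMul B q r) := by
  have h := hB.cocycle p.1 q.1 r.1 hp hq hr hpq hqr hpqr
  refine Prod.ext (mul_assoc _ _ _) ?_
  simp only [extMul]
  linarith

theorem extInv_mul (B : mapGroup E G bc → mapGroup E G bc → ℝ) (p : mapGroup E G bc × ℝ) :
    extMul B (extInv B p) p = (1, 0) := by
  refine Prod.ext (inv_mul_cancel _) ?_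
  simp only [extMul, extInv]
  ring

/-- `c` is the Lie algebra cocycle of the group cocycle `B`: for curves `g`, `h` through the identity
with velocities `ξ`, `η`, `c(ξ, η)` is the mixed derivative of `B(g, h) - B(h, g)` at the identity,
so that `[(ξ, a), (η, b)] = ([ξ, η], c(ξ, η))` is the bracket of the extended Lie algebra. -/
def IsLieCocycleOf (B : mapGroup E G bc → mapGroup E G bc → ℝ)
    (c : (ℝ → GroupLieAlgebra 𝓘(ℝ, E) G) → (ℝ → GroupLieAlgebra 𝓘(ℝ, E) G) → ℝ) : Prop :=
  ∀ g h : ℝ → mapGroup E G bc, SmoothGroupFamily g → SmoothGroupFamily h → g 0 = 1 → h 0 = 1 →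
    c (velocity g 0) (velocity h 0) =
      deriv (fun σ : ℝ => deriv (fun τ : ℝ => B (g σ) (h τ) - B (h τ) (g σ)) 0) 0

/-- A smooth family of elements of the central extension. -/
def SmoothExtFamily {F : Type*} [NormedAddCommGroup F] [NormedSpace ℝ F]
    (Γ : F → mapGroup E G bc × ℝ) : Prop :=
  SmoothGroupFamily (fun σ => (Γ σ).1) ∧ ContDiff ℝ ∞ (fun σ => (Γ σ).2)

/-- The central component `a` of the left trivialised velocity `(M, a) = γ⁻¹ γ̇` in `𝔤ᶜ`. -/
def centralVelocity (B : mapGroup E G bc → mapGroup E G bc → ℝ) (γ : ℝ → mapGroup E G bc × ℝ)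
    (t : ℝ) : ℝ :=
  deriv (fun τ => (extMul B (extInv B (γ t)) (γ τ)).2) t

/-- The reduced Lagrangian on `𝔤ᶜ`, with the standard kinetic term on the centre. -/
def reducedLagrangian (l : (ℝ → GroupLieAlgebra 𝓘(ℝ, E) G) → ℝ)
    (M : ℝ → GroupLieAlgebra 𝓘(ℝ, E) G) (a : ℝ) : ℝ :=
  l M + a ^ 2 / 2

/-- The left-invariant Lagrangian on `T Gᶜ` whose restriction to `𝔤ᶜ` is `reducedLagrangian l`,
evaluated at the tangent vector `γ̇(t)`. -/
def lagrangian (l : (ℝ → GroupLieAlgebra 𝓘(ℝ, E) G) → ℝ)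
    (B : mapGroup E G bc → mapGroup E G bc → ℝ) (γ : ℝ → mapGroup E G bc × ℝ) (t : ℝ) : ℝ :=
  reducedLagrangian l (velocity (fun τ => (γ τ).1) t) (centralVelocity B γ t)

/-- Hamilton's principle on `Gᶜ` for the curve `γ` on `[t₀, t₁]`: the action is stationary for all
smooth variations of `γ` with fixed endpoints. -/
def HamiltonPrinciple (l : (ℝ → GroupLieAlgebra 𝓘(ℝ, E) G) → ℝ)
    (B : mapGroup E G bc → mapGroup E G bc → ℝ) (γ : ℝ → mapGroup E G bc × ℝ) (t₀ t₁ : ℝ) : Prop :=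
  ∀ Γ : ℝ × ℝ → mapGroup E G bc × ℝ, SmoothExtFamily Γ → (∀ t, Γ (0, t) = γ t) →
    (∀ ε, Γ (ε, t₀) = γ t₀ ∧ Γ (ε, t₁) = γ t₁) →
      HasDerivAt (fun ε => ∫ t in t₀..t₁, lagrangian l B (fun τ => Γ (ε, τ)) t) 0 0

/-- The pairing `⟨∂L/∂γ̇, δγ⟩` at time `t` of the fibre derivative of the Lagrangian with
`δγ = ∂Γ/∂ε` at `ε = 0`: the curve `τ ↦ Γ (σ (τ - t), τ)` has at `τ = t` the velocity
`γ̇(t) + σ δγ(t)`. -/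
def fibreDeriv (l : (ℝ → GroupLieAlgebra 𝓘(ℝ, E) G) → ℝ)
    (B : mapGroup E G bc → mapGroup E G bc → ℝ) (Γ : ℝ × ℝ → mapGroup E G bc × ℝ) (t : ℝ) : ℝ :=
  deriv (fun σ : ℝ => lagrangian l B (fun τ => Γ (σ * (τ - t), τ)) t) 0

/-- The Euler–Lagrange equations for `γ` on `[t₀, t₁]`, free of coordinates:
`d/dt ⟨∂L/∂γ̇, δγ⟩ = ⟨∂L/∂γ, δγ⟩ + ⟨∂L/∂γ̇, (δγ)˙⟩` at each time for each vector field `δγ` along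
`γ`. In coordinates this reads `(d/dt ∂L/∂γ̇ - ∂L/∂γ) δγ = 0`. -/
def EulerLagrange (l : (ℝ → GroupLieAlgebra 𝓘(ℝ, E) G) → ℝ)
    (B : mapGroup E G bc → mapGroup E G bc → ℝ) (γ : ℝ → mapGroup E G bc × ℝ) (t₀ t₁ : ℝ) : Prop :=
  ∀ Γ : ℝ × ℝ → mapGroup E G bc × ℝ, SmoothExtFamily Γ → (∀ t, Γ (0, t) = γ t) →
    ∀ t ∈ Icc t₀ t₁,
      HasDerivAt (fibreDeriv l B Γ) (deriv (fun ε => lagrangian l B (fun τ => Γ (ε, τ)) t) 0) t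

end Extension

/-- The constrained variational principle on `𝔤ᶜ` for the curve `(M, m)`, with `m` constant: the
reduced action is stationary for all variations `(η̇ + [M, η], c(M, η))`, where `η` is arbitrary and
vanishes at the endpoints. -/
def ReducedPrinciple (bc : BoundaryCond) (l : (ℝ → GroupLieAlgebra 𝓘(ℝ, E) G) → ℝ)
    (c : (ℝ → GroupLieAlgebra 𝓘(ℝ, E) G) → (ℝ → GroupLieAlgebra 𝓘(ℝ, E) G) → ℝ)
    (M : ℝ → ℝ → GroupLieAlgebra 𝓘(ℝ, E) G) (m t₀ t₁ : ℝ) : Prop :=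
  ∀ η : ℝ → ℝ → GroupLieAlgebra 𝓘(ℝ, E) G, SmoothAlgebraFamily bc η → η t₀ = 0 → η t₁ = 0 →
    HasDerivAt (fun ε : ℝ => ∫ t in t₀..t₁,
      reducedLagrangian l
        (fun x => M t x + ε • (deriv (fun τ => η τ x) t + ⁅M t x, η t x⁆))
        (m + ε * c (M t) (η t))) 0 0

/-- The Euler–Poincaré equation `∂ₜ δl/δM = ad*_M δl/δM + m c(M, ·)` with central extension on
`[t₀, t₁]`, as an equation of linear forms on `Map(ℝ, 𝔤)`; here `⟨ad*_M μ, ξ⟩ = ⟨μ, [M, ξ]⟩`. -/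
def EulerPoincare (bc : BoundaryCond) (l : (ℝ → GroupLieAlgebra 𝓘(ℝ, E) G) → ℝ)
    (c : (ℝ → GroupLieAlgebra 𝓘(ℝ, E) G) → (ℝ → GroupLieAlgebra 𝓘(ℝ, E) G) → ℝ)
    (M : ℝ → ℝ → GroupLieAlgebra 𝓘(ℝ, E) G) (m t₀ t₁ : ℝ) : Prop :=
  ∀ ξ ∈ mapAlgebra E G bc, ∀ t ∈ Icc t₀ t₁,
    HasDerivAt (fun τ => varDeriv l (M τ) ξ)
      (varDeriv l (M t) (fun x => ⁅M t x, ξ x⁆) + m * c (M t) ξ) t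

section Killing

variable [CompleteSpace E] [LieGroup 𝓘(ℝ, E) ∞ G]

/-- The pairing `∫ ⟨μ, ξ⟩ dx` given by the Killing form of `𝔤`. -/
def killingPairing (bc : BoundaryCond) (μ ξ : ℝ → GroupLieAlgebra 𝓘(ℝ, E) G) : ℝ :=
  bc.integral (fun x => killingForm ℝ (GroupLieAlgebra 𝓘(ℝ, E) G) (μ x) (ξ x))

/-- The derivative cocycle `c(ξ, η) = ∫ ⟨ξ, ∂ₓ η⟩ dx`. -/
def derivativeCocycle (bc : BoundaryCond) (ξ η : ℝ → GroupLieAlgebra 𝓘(ℝ, E) G) : ℝ :=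
  killingPairing bc ξ (fun x => deriv η x)

/-- `μ` represents the variational derivative `δl/δM` on `[t₀, t₁]` through the Killing form. -/
def RepresentsVarDeriv (bc : BoundaryCond) (l : (ℝ → GroupLieAlgebra 𝓘(ℝ, E) G) → ℝ)
    (M μ : ℝ → ℝ → GroupLieAlgebra 𝓘(ℝ, E) G) (t₀ t₁ : ℝ) : Prop :=
  ContDiff ℝ ∞ (F := E) (fun p : ℝ × ℝ => μ p.1 p.2) ∧ (∀ t, bc.HoldsDual (μ t)) ∧
    ∀ t ∈ Icc t₀ t₁, ∀ ξ ∈ mapAlgebra E G bc, varDeriv l (M t) ξ = killingPairing bc (μ t) ξ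

end Killing

/-- The partial differential equation `∂ₜ μ = -[M, μ] - m ∂ₓ M` on `[t₀, t₁]`. -/
def SatisfiesPDE (M μ : ℝ → ℝ → GroupLieAlgebra 𝓘(ℝ, E) G) (m t₀ t₁ : ℝ) : Prop :=
  ∀ t ∈ Icc t₀ t₁, ∀ x, HasDerivAt (fun τ => μ τ x) (-⁅M t x, μ t x⁆ - m • deriv (M t) x) t

end CentralExtEP

end

/-!
Left trivialisation turns Hamilton's principle on the central extension into a statement about
curves in `𝔤ᶜ`, and everything rests on how the trivialised velocity changes in a two-parameter
family `Γ(ε, t)`. Write `(M, a)` for the trivialised derivative of `Γ` in `t` and `(η, α)` for the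
one in `ε`. The Maurer–Cartan equation in `G`, applied pointwise in `x`, gives
`∂_ε M = ∂ₜ η + [M, η]` (`fderiv_mcForm_sub`, `SmoothGroupFamily.fderiv_groupForm_sub`). For the central component the
cocycle identity reduces the mixed second derivatives of `B` along `Γ(p)⁻¹ Γ(q)` to those at the
identity, which is `∂_ε a = ∂ₜ α + c(M, η)` (`SmoothExtFamily.fderiv_centralForm_sub`). Since `B` is
only given near the identity, these computations use only products that stay in `W` near the
diagonal `p = q`.

Functionals are smooth only along smooth finite-dimensional families, so there is no ambient Fréchet
derivative. The chain rule `d/ds l(N_s) = ⟨δl/δM, ∂_s N⟩` and the additivity of `δl/δM` are derived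
from two-parameter families, the former with Hadamard's lemma `N_s = N_0 + s D_s`
(`IsSmoothFunctional.hasDerivAt`, `IsSmoothFunctional.dirDeriv_add`). For this the maps into
`𝔤 = T_e G` are regarded as maps into the model space `E`.

The first variation of the Lagrangian is then `⟨δl/δM, ∂ₜ η + [M, η]⟩ + a (∂ₜ α + c(M, η))`
(`SmoothExtFamily.hasDerivAt_lagrangian`), and the fibre derivative is `⟨δl/δM, η⟩ + a α`
(`SmoothExtFamily.fibreDeriv_eq`). Variations of the central component alone show that `a` is
conserved. If `a = m` is constant, the product rule turns the Euler–Poincaré equation into the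
Euler–Lagrange equations, integration in time turns these into Hamilton's principle, and the
variations `η = f ξ` with test functions `f` of time lead back to the Euler–Poincaré equation. Such
variations exist because every smooth family in the Lie algebra is the family of velocities of a
smooth family of curves in the map group (`IsSmoothFamily.exists_smoothGroupFamily`); a cut-off
chart takes the place of the exponential map. The constrained principle is treated by the same two
arguments on `𝔤ᶜ` and needs of `c` only homogeneity and smoothness along smooth families
(`reducedPrinciple_iff_eulerPoincare_of_homogeneous`), so it applies also to the derivative cocycle.

For the derivative cocycle the invariance of the Killing form and integration by parts in `x`
rewrite the Euler–Poincaré equation as `∫ ⟨∂ₜ μ + [M, μ] + m ∂ₓ M, ξ⟩ dx = 0` for all `ξ`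
(`eulerPoincare_iff_of_invariant`). By Cartan's criterion the Killing form of a semisimple `𝔤` is
nondegenerate, and the fundamental lemma of the calculus of variations yields the partial
differential equation.
-/

noncomputable section

namespace CentralExtEP

/-! ### Integrals depending on a parameter -/

theorem exists_closedBall_prod_Icc_subset {X : Type*} [PseudoMetricSpace X]
    {U : Set (X × ℝ)} (hU : IsOpen U) {x₀ : X} {a b : ℝ} (h : ∀ t ∈ Icc a b, (x₀, t) ∈ U) :
    ∃ r > 0, ∀ x ∈ Metric.closedBall x₀ r, ∀ t ∈ Icc a b, (x, t) ∈ U := by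
  obtain ⟨u, v, hu, -, hxu, htv, huv⟩ := generalized_tube_lemma (isCompact_singleton (x := x₀))
    (isCompact_Icc (a := a) (b := b)) hU (by rintro ⟨x, t⟩ ⟨rfl, ht⟩; exact h t ht)
  obtain ⟨r, hr, hru⟩ := Metric.nhds_basis_closedBall.mem_iff.1 (hu.mem_nhds (hxu rfl))
  exact ⟨r, hr, fun x hx t ht => huv ⟨hru hx, htv ht⟩⟩

theorem hasFDerivAt_intervalIntegral_of_contDiffAt {X E : Type*} [NormedAddCommGroup X]
    [NormedSpace ℝ X] [NormedAddCommGroup E] [NormedSpace ℝ E] {f : X × ℝ → E} {x₀ : X} {a b : ℝ}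
    (hab : a ≤ b) (hf : ∀ t ∈ Icc a b, ContDiffAt ℝ 1 f (x₀, t)) :
    HasFDerivAt (fun x => ∫ t in a..b, f (x, t))
      (∫ t in a..b, (fderiv ℝ f (x₀, t)).comp (ContinuousLinearMap.inl ℝ X ℝ)) x₀ := by
  have hUo : IsOpen {z | ContDiffAt ℝ 1 f z} := isOpen_iff_mem_nhds.2 fun z hz =>
    ContDiffAt.eventually hz (by simp)
  have hfd : ∀ z, ContDiffAt ℝ 1 f z → ContinuousAt (fderiv ℝ f) z := fun z hz =>
    (hz.fderiv_right (m := 0) (by simp)).continuousAt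
  -- the derivative is bounded near each point of the compact segment over `x₀`
  obtain ⟨C, hC⟩ : ∃ C : ℝ, ∀ t ∈ Icc a b, ‖fderiv ℝ f (x₀, t)‖ < C := by
    have hc : ContinuousOn (fun t => ‖fderiv ℝ f (x₀, t)‖) (Icc a b) := fun t ht =>
      ((hfd _ (hf t ht)).comp
        (by fun_prop : ContinuousAt (fun t : ℝ => (x₀, t)) t)).norm.continuousWithinAt
    obtain ⟨C, hC⟩ := isCompact_Icc.bddAbove_image hc
    exact ⟨C + 1, fun t ht => lt_of_le_of_lt (hC (mem_image_of_mem _ ht)) (by linarith)⟩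
  have hVo : IsOpen {z | ContDiffAt ℝ 1 f z ∧ ‖fderiv ℝ f z‖ < C} := by
    refine isOpen_iff_mem_nhds.2 fun z hz => ?_
    exact inter_mem (hUo.mem_nhds hz.1) ((hfd z hz.1).norm.eventually_lt_const hz.2)
  obtain ⟨r, hr, hrV⟩ := exists_closedBall_prod_Icc_subset hVo (x₀ := x₀) (a := a) (b := b)
    (fun t ht => ⟨hf t ht, hC t ht⟩)
  have hsub : uIoc a b ⊆ Icc a b := by rw [uIoc_of_le hab]; exact Ioc_subset_Icc_self
  have hcont : ∀ x ∈ Metric.closedBall x₀ r, ContinuousOn (fun t => f (x, t)) (Icc a b) :=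
    fun x hx t ht => ((hrV x hx t ht).1.continuousAt.comp
      (by fun_prop : ContinuousAt (fun t : ℝ => (x, t)) t)).continuousWithinAt
  have hcont' : ContinuousOn
      (fun t => (fderiv ℝ f (x₀, t)).comp (ContinuousLinearMap.inl ℝ X ℝ)) (Icc a b) := by
    intro t ht
    have := (hfd _ (hf t ht)).comp (by fun_prop : ContinuousAt (fun t : ℝ => (x₀, t)) t)
    exact (ContinuousAt.clm_comp this continuousAt_const).continuousWithinAt
  refine intervalIntegral.hasFDerivAt_integral_of_dominated_of_fderiv_le
    (F := fun x t => f (x, t)) (bound := fun _ => C * ‖ContinuousLinearMap.inl ℝ X ℝ‖)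
    (F' := fun x t => (fderiv ℝ f (x, t)).comp (ContinuousLinearMap.inl ℝ X ℝ))
    (Metric.closedBall_mem_nhds x₀ hr) ?_ ?_ ?_ ?_ ?_ ?_
  · filter_upwards [Metric.closedBall_mem_nhds x₀ hr] with x hx
    exact ((hcont x hx).aestronglyMeasurable measurableSet_Icc).mono_measure
      (Measure.restrict_mono hsub le_rfl)
  · exact ((hcont x₀ (Metric.mem_closedBall_self hr.le)).mono
      (by rw [uIcc_of_le hab])).intervalIntegrable
  · exact (hcont'.aestronglyMeasurable measurableSet_Icc).mono_measure
      (Measure.restrict_mono hsub le_rfl)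
  · refine Eventually.of_forall fun t ht x hx => ?_
    exact (ContinuousLinearMap.opNorm_comp_le _ _).trans
      (mul_le_mul_of_nonneg_right (hrV x hx t (hsub ht)).2.le (norm_nonneg _))
  · exact intervalIntegrable_const
  · refine Eventually.of_forall fun t ht x hx => ?_
    have h1 := ((hrV x hx t (hsub ht)).1.differentiableAt (by simp)).hasFDerivAt
    exact h1.comp x (hasFDerivAt_prodMk_left x t)

theorem hasDerivAt_intervalIntegral_of_contDiffAt {E : Type*} [NormedAddCommGroup E]
    [NormedSpace ℝ E] [CompleteSpace E] {f : ℝ × ℝ → E} {x₀ : ℝ} {a b : ℝ}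
    (hab : a ≤ b) (hf : ∀ t ∈ Icc a b, ContDiffAt ℝ 1 f (x₀, t)) :
    HasDerivAt (fun x => ∫ t in a..b, f (x, t))
      (∫ t in a..b, deriv (fun x => f (x, t)) x₀) x₀ := by
  have h := (hasFDerivAt_intervalIntegral_of_contDiffAt hab hf).hasDerivAt
  convert h using 1
  rw [ContinuousLinearMap.intervalIntegral_apply]
  · refine intervalIntegral.integral_congr fun t ht => ?_
    rw [uIcc_of_le hab] at ht
    have h1 := ((hf t ht).differentiableAt (by simp)).hasFDerivAt
    exact (h1.comp x₀ (hasFDerivAt_prodMk_left x₀ t)).hasDerivAt.deriv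
  · refine ContinuousOn.intervalIntegrable fun t ht => ?_
    rw [uIcc_of_le hab] at ht
    have h1 : ContinuousAt (fderiv ℝ f) (x₀, t) :=
      ((hf t ht).fderiv_right (m := 0) (by simp)).continuousAt
    have := h1.comp (by fun_prop : ContinuousAt (fun t : ℝ => (x₀, t)) t)
    exact (ContinuousAt.clm_comp this continuousAt_const).continuousWithinAt

/-- Finite differentiability of parameter integrals. With `X : Type` the derivative, a map into
`X →L[ℝ] E`, stays in the universe of `E`, as the induction on the order requires. -/
theorem contDiff_nat_intervalIntegral {X : Type} [NormedAddCommGroup X] [NormedSpace ℝ X]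
    {a b : ℝ} (hab : a ≤ b) (n : ℕ) :
    ∀ {E : Type*} [NormedAddCommGroup E] [NormedSpace ℝ E] {f : X × ℝ → E},
      ContDiff ℝ n f → ContDiff ℝ n (fun x => ∫ t in a..b, f (x, t)) := by
  induction n with
  | zero =>
    intro E _ _ f hf
    rw [Nat.cast_zero, contDiff_zero] at hf ⊢
    exact intervalIntegral.continuous_parametric_intervalIntegral_of_continuous
      (f := fun x t => f (x, t)) (by simpa [Function.uncurry_def] using hf) continuous_const
  | succ n ih =>
    intro E _ _ f hf
    have h1 : ∀ x, HasFDerivAt (fun x => ∫ t in a..b, f (x, t))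
        (∫ t in a..b, (fderiv ℝ f (x, t)).comp (ContinuousLinearMap.inl ℝ X ℝ)) x := fun x =>
      hasFDerivAt_intervalIntegral_of_contDiffAt hab fun t _ =>
        hf.contDiffAt.of_le (by exact_mod_cast Nat.le_add_left 1 n)
    rw [Nat.cast_add, Nat.cast_one, contDiff_succ_iff_fderiv]
    refine ⟨fun x => (h1 x).differentiableAt, fun h => by simp at h, ?_⟩
    have h2 : fderiv ℝ (fun x => ∫ t in a..b, f (x, t)) = fun x =>
        ∫ t in a..b, (fderiv ℝ f (x, t)).comp (ContinuousLinearMap.inl ℝ X ℝ) :=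
      funext fun x => (h1 x).fderiv
    rw [h2]
    refine ih (f := fun z => (fderiv ℝ f z).comp (ContinuousLinearMap.inl ℝ X ℝ)) ?_
    exact (hf.fderiv_right (m := n) (by norm_cast)).clm_comp contDiff_const

theorem contDiff_intervalIntegral {X : Type} [NormedAddCommGroup X] [NormedSpace ℝ X]
    {E : Type*} [NormedAddCommGroup E] [NormedSpace ℝ E] {f : X × ℝ → E} {a b : ℝ} (hab : a ≤ b)
    (hf : ContDiff ℝ ∞ f) : ContDiff ℝ ∞ (fun x => ∫ t in a..b, f (x, t)) :=
  contDiff_infty.2 fun n => contDiff_nat_intervalIntegral hab n (contDiff_infty.1 hf n)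

/-- Hadamard's lemma with a parameter: the difference quotient in the first variable of a smooth
map extends smoothly over the diagonal. -/
theorem exists_contDiff_eq_add_smul {E : Type*} [NormedAddCommGroup E] [NormedSpace ℝ E]
    [CompleteSpace E] {N : ℝ × ℝ → E} (hN : ContDiff ℝ ∞ N) :
    ∃ D : ℝ × ℝ → E, ContDiff ℝ ∞ D ∧ (∀ r x, N (r, x) = N (0, x) + r • D (r, x)) ∧
      ∀ r x, D (r, x) = ∫ u in (0 : ℝ)..1, deriv (fun s => N (s, x)) (u * r) := by
  have hd : ∀ s x, HasDerivAt (fun s => N (s, x)) (fderiv ℝ N (s, x) (1, 0)) s := fun s x =>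
    ((hN.differentiable (by simp)).differentiableAt.hasFDerivAt.comp s
      (hasFDerivAt_prodMk_left s x)).hasDerivAt
  have hfd : ContDiff ℝ ∞ (fderiv ℝ N) := hN.fderiv_right (by simp)
  refine ⟨fun z => ∫ u in (0 : ℝ)..1, fderiv ℝ N (u * z.1, z.2) (1, 0),
    contDiff_intervalIntegral (f := fun y : (ℝ × ℝ) × ℝ => fderiv ℝ N (y.2 * y.1.1, y.1.2) (1, 0))
      zero_le_one ?_, fun r x => ?_, fun r x => ?_⟩
  · exact (hfd.comp (by fun_prop : ContDiff ℝ ∞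
      fun y : (ℝ × ℝ) × ℝ => (y.2 * y.1.1, y.1.2))).clm_apply contDiff_const
  · have h1 : ∀ u ∈ uIcc (0 : ℝ) 1, HasDerivAt (fun u => N (u * r, x))
        (r • fderiv ℝ N (u * r, x) (1, 0)) u := fun u _ => by
      have := (hd (u * r) x).scomp u ((hasDerivAt_id u).mul_const r)
      simpa [Function.comp_def] using this
    have hc : Continuous fun u : ℝ => fderiv ℝ N (u * r, x) (1, 0) :=
      (hfd.continuous.comp (by fun_prop : Continuous fun u : ℝ => (u * r, x))).clm_apply
        continuous_const
    have h2 := intervalIntegral.integral_eq_sub_of_hasDerivAt h1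
      ((hc.const_smul r).intervalIntegrable _ _)
    rw [intervalIntegral.integral_smul] at h2
    simp only [one_mul, zero_mul] at h2
    rw [h2]; abel
  · exact intervalIntegral.integral_congr fun u _ => ((hd (u * r) x).deriv).symm

/-! ### The fundamental lemma of the calculus of variations -/

theorem eqOn_Icc_zero_of_integral_mul_eq_zero {h : ℝ → ℝ} {a b : ℝ} (hab : a < b)
    (hc : ContinuousOn h (Icc a b))
    (H : ∀ f : ℝ → ℝ, ContDiff ℝ ∞ f → tsupport f ⊆ Ioo a b → ∫ t in a..b, f t * h t = 0) :
    ∀ t ∈ Icc a b, h t = 0 := by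
  have h1 : ∀ᵐ t, t ∈ Ioo a b → h t = 0 := by
    refine isOpen_Ioo.ae_eq_zero_of_integral_contDiff_smul_eq_zero
      ((hc.mono Ioo_subset_Icc_self).locallyIntegrableOn measurableSet_Ioo) ?_
    intro g hg _ hgs
    have h2 := H g hg hgs
    rw [intervalIntegral.integral_of_le hab.le] at h2
    rw [← h2]
    symm
    refine setIntegral_eq_integral_of_forall_compl_eq_zero fun t ht => ?_
    have : t ∉ tsupport g := fun h => ht (Ioo_subset_Ioc_self (hgs h))
    simp [image_eq_zero_of_notMem_tsupport this]
  have h2 : EqOn h 0 (Ioo a b) := by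
    refine Measure.eqOn_open_of_ae_eq (μ := volume) (f := h) (g := fun _ => (0 : ℝ)) ?_ isOpen_Ioo
      (hc.mono Ioo_subset_Icc_self) continuousOn_const
    exact (ae_restrict_iff' measurableSet_Ioo).2 h1
  have h3 : EqOn h (fun _ => 0) (closure (Ioo a b) ∩ Icc a b) := by
    have := h2.of_subset_closure hc continuousOn_const Ioo_subset_Icc_self
      (by rw [closure_Ioo hab.ne])
    exact fun t ht => this ht.2
  exact fun t ht => h3 ⟨by rwa [closure_Ioo hab.ne], ht⟩

/-- The du Bois-Reymond form: if `f' p + f q` integrates to zero for all test functions `f`, then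
`p' = q`. -/
theorem deriv_eq_of_integral_eq_zero {p q : ℝ → ℝ} {a b : ℝ} (hab : a < b)
    (hp : ∀ t ∈ Icc a b, ContDiffAt ℝ 1 p t) (hq : ContinuousOn q (Icc a b))
    (H : ∀ f : ℝ → ℝ, ContDiff ℝ ∞ f → tsupport f ⊆ Ioo a b →
      ∫ t in a..b, (deriv f t * p t + f t * q t) = 0) :
    ∀ t ∈ Icc a b, HasDerivAt p (q t) t := by
  have hd : ∀ t ∈ Icc a b, HasDerivAt p (deriv p t) t := fun t ht =>
    ((hp t ht).differentiableAt (by simp)).hasDerivAt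
  have hdc : ContinuousOn (deriv p) (Icc a b) := fun t ht => by
    have := ((hp t ht).fderiv_right (m := 0) (by simp)).continuousAt
    exact (this.clm_apply continuousAt_const).continuousWithinAt
  have hpc : ContinuousOn p (Icc a b) := fun t ht => (hp t ht).continuousAt.continuousWithinAt
  have key := eqOn_Icc_zero_of_integral_mul_eq_zero (h := fun t => q t - deriv p t) hab
    (hq.sub hdc) ?_
  · intro t ht
    have := key t ht
    rw [show q t = deriv p t by linarith]
    exact hd t ht
  · intro f hf hfs
    have hfe : ∀ t, t ∉ Ioo a b → f t = 0 := fun t ht =>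
      image_eq_zero_of_notMem_tsupport fun h => ht (hfs h)
    have hIcc : uIcc a b = Icc a b := uIcc_of_le hab.le
    have hfc : Continuous f := hf.continuous
    have hfdc : Continuous (deriv f) := hf.continuous_deriv (by simp)
    have h1 : ∫ t in a..b, (deriv f t * p t + f t * deriv p t) = 0 := by
      rw [intervalIntegral.integral_deriv_mul_eq_sub (u := f) (v := p)]
      · rw [hfe a (by simp), hfe b (by simp)]; simp
      · exact fun t _ => (hf.differentiable (by simp)).differentiableAt.hasDerivAt
      · exact fun t ht => hd t (hIcc ▸ ht)
      · exact hfdc.intervalIntegrable _ _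
      · exact (hdc.mono hIcc.subset).intervalIntegrable
    have i1 : IntervalIntegrable (fun t => deriv f t * p t + f t * q t) volume a b :=
      ContinuousOn.intervalIntegrable (by rw [hIcc]; fun_prop)
    have i2 : IntervalIntegrable (fun t => deriv f t * p t + f t * deriv p t) volume a b :=
      ContinuousOn.intervalIntegrable (by rw [hIcc]; fun_prop)
    have h2 := intervalIntegral.integral_sub i1 i2
    rw [H f hf hfs, h1, sub_zero] at h2
    rw [← h2]
    exact intervalIntegral.integral_congr fun t _ => by ring

/-! ### Smooth families and smooth functionals on spaces of vector-valued maps -/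

namespace BoundaryCond

variable {F F' X Y Z : Type*} [TopologicalSpace F] [TopologicalSpace F'] {bc : BoundaryCond}

theorem HoldsFamily.holds {o : X} {f : F → ℝ → X} (hf : bc.HoldsFamily o f) (p : F) :
    bc.Holds o (f p) := by
  cases bc with
  | periodic P hP => exact hf p
  | vanishing =>
    obtain ⟨R, hR⟩ := hf p
    exact ⟨R, hR.self_of_nhds⟩

theorem Holds.holdsFamily {o : X} {f : ℝ → X} (hf : bc.Holds o f) :
    bc.HoldsFamily o (fun _ : F => f) := by
  cases bc with
  | periodic P hP => exact fun _ => hf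
  | vanishing =>
    obtain ⟨R, hR⟩ := hf
    exact fun _ => ⟨R, Eventually.of_forall fun _ => hR⟩

theorem HoldsFamily.comp {o : X} {f : F → ℝ → X} (hf : bc.HoldsFamily o f) {c : F' → F}
    (hc : Continuous c) : bc.HoldsFamily o (fun s => f (c s)) := by
  cases bc with
  | periodic P hP => exact fun s => hf (c s)
  | vanishing =>
    intro s
    obtain ⟨R, hR⟩ := hf (c s)
    exact ⟨R, hc.continuousAt.eventually hR⟩

theorem HoldsFamily.map₂ {o : X} {o' : Y} {o'' : Z} {f : F → ℝ → X} {g : F → ℝ → Y}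
    (hf : bc.HoldsFamily o f) (hg : bc.HoldsFamily o' g) (φ : F → X → Y → Z)
    (hφ : ∀ s, φ s o o' = o'') : bc.HoldsFamily o'' (fun s x => φ s (f s x) (g s x)) := by
  cases bc with
  | periodic P hP =>
    intro s x
    simp only [hf s x, hg s x]
  | vanishing =>
    intro s
    obtain ⟨R, hR⟩ := hf s
    obtain ⟨S, hS⟩ := hg s
    refine ⟨max R S, ?_⟩
    filter_upwards [hR, hS] with σ h1 h2 x hx
    simp only [h1 x ((le_max_left _ _).trans hx), h2 x ((le_max_right _ _).trans hx), hφ]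

theorem HoldsFamily.fderiv {F E : Type*} [NormedAddCommGroup F] [NormedSpace ℝ F]
    [NormedAddCommGroup E] [NormedSpace ℝ E] {f : F → ℝ → E} (hf : bc.HoldsFamily 0 f)
    (v : F) : bc.HoldsFamily 0 (fun p x => fderiv ℝ (fun q => f q x) p v) := by
  cases bc with
  | periodic P hP =>
    intro p x
    have : (fun q => f q (x + P)) = fun q => f q x := funext fun q => hf q x
    simp only [this]
  | vanishing =>
    intro s
    obtain ⟨R, hR⟩ := hf s
    -- the family vanishes at `x` for all parameters near `σ`, not only at `σ`
    refine ⟨R, hR.eventually_nhds.mono fun σ hσ x hx => ?_⟩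
    have : (fun q => f q x) =ᶠ[𝓝 σ] fun _ => 0 := hσ.mono fun q hq => hq x hx
    simp [this.fderiv_eq]

/-- Locally uniformly bounded supports are uniformly bounded over a compact set of parameters. -/
theorem HoldsFamily.exists_forall_mem {o : X} {f : F → ℝ → X}
    (hf : BoundaryCond.vanishing.HoldsFamily o f) {K : Set F} (hK : IsCompact K) :
    ∃ R : ℝ, ∀ σ ∈ K, ∀ x, R ≤ |x| → f σ x = o := by
  refine hK.induction_on (p := fun K => ∃ R : ℝ, ∀ σ ∈ K, ∀ x, R ≤ |x| → f σ x = o)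
    ⟨0, by simp⟩ ?_ ?_ ?_
  · rintro s t hst ⟨R, hR⟩
    exact ⟨R, fun σ hσ => hR σ (hst hσ)⟩
  · rintro s t ⟨R, hR⟩ ⟨S, hS⟩
    refine ⟨max R S, fun σ hσ x hx => ?_⟩
    rcases hσ with hσ | hσ
    · exact hR σ hσ x ((le_max_left _ _).trans hx)
    · exact hS σ hσ x ((le_max_right _ _).trans hx)
  · intro σ _
    obtain ⟨R, hR⟩ := hf σ
    exact ⟨_, mem_nhdsWithin_of_mem_nhds hR, R, fun σ hσ => hσ⟩

end BoundaryCond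

section Functional

variable {E E' E'' F F' : Type*} [NormedAddCommGroup E] [NormedSpace ℝ E]
  [NormedAddCommGroup E'] [NormedSpace ℝ E'] [NormedAddCommGroup E''] [NormedSpace ℝ E'']
  [NormedAddCommGroup F] [NormedSpace ℝ F] [NormedAddCommGroup F'] [NormedSpace ℝ F']
  {bc : BoundaryCond}

variable (E) in
/-- The smooth maps of the space variable into the normed space `E` with the given boundary
condition. For the Lie algebra of `G`, whose underlying normed space is `E`, this is
`mapAlgebra`. -/
def mapSpace (bc : BoundaryCond) : Set (ℝ → E) :=
  {ξ | ContDiff ℝ ∞ ξ ∧ bc.Holds 0 ξ}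

/-- A smooth family in `mapSpace`; the counterpart of `SmoothAlgebraFamily` for a normed space. -/
def IsSmoothFamily (bc : BoundaryCond) (ξ : F → ℝ → E) : Prop :=
  ContDiff ℝ ∞ (fun p : F × ℝ => ξ p.1 p.2) ∧ bc.HoldsFamily 0 ξ

/-- A functional on `mapSpace` that is smooth along smooth finite-dimensional families; the
counterpart of `SmoothFunctional` for a normed space. -/
def IsSmoothFunctional (bc : BoundaryCond) (l : (ℝ → E) → ℝ) : Prop :=
  ∀ (n : ℕ) (ξ : (Fin n → ℝ) → ℝ → E), IsSmoothFamily bc ξ → ContDiff ℝ ∞ (fun σ => l (ξ σ))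

/-- The directional derivative of a functional; the counterpart of `varDeriv` for a normed
space. -/
def dirDeriv (l : (ℝ → E) → ℝ) (M ξ : ℝ → E) : ℝ :=
  deriv (fun σ : ℝ => l (fun x => M x + σ • ξ x)) 0

theorem IsSmoothFamily.mem {ξ : F → ℝ → E} (hξ : IsSmoothFamily bc ξ) (p : F) :
    ξ p ∈ mapSpace E bc :=
  ⟨hξ.1.comp (by fun_prop : ContDiff ℝ ∞ fun x : ℝ => (p, x)), hξ.2.holds p⟩

theorem isSmoothFamily_const {ξ : ℝ → E} (hξ : ξ ∈ mapSpace E bc) :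
    IsSmoothFamily bc (fun _ : F => ξ) :=
  ⟨hξ.1.comp contDiff_snd, hξ.2.holdsFamily⟩

theorem IsSmoothFamily.comp {ξ : F → ℝ → E} (hξ : IsSmoothFamily bc ξ) {c : F' → F}
    (hc : ContDiff ℝ ∞ c) : IsSmoothFamily bc (fun s => ξ (c s)) :=
  ⟨hξ.1.comp (by fun_prop : ContDiff ℝ ∞ fun z : F' × ℝ => (c z.1, z.2)),
    hξ.2.comp hc.continuous⟩

theorem IsSmoothFamily.map₂ {ξ : F → ℝ → E} {η : F → ℝ → E'} (hξ : IsSmoothFamily bc ξ)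
    (hη : IsSmoothFamily bc η) (φ : F → E → E' → E'')
    (hφ : ContDiff ℝ ∞ fun z : F × E × E' => φ z.1 z.2.1 z.2.2) (h0 : ∀ s, φ s 0 0 = 0) :
    IsSmoothFamily bc (fun s x => φ s (ξ s x) (η s x)) :=
  ⟨hφ.comp (contDiff_fst.prodMk (hξ.1.prodMk hη.1)), hξ.2.map₂ hη.2 φ h0⟩

theorem IsSmoothFamily.add {ξ η : F → ℝ → E} (hξ : IsSmoothFamily bc ξ)
    (hη : IsSmoothFamily bc η) : IsSmoothFamily bc (fun s x => ξ s x + η s x) :=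
  hξ.map₂ hη (fun _ v w => v + w) (by fun_prop) (by simp)

theorem IsSmoothFamily.smul {ξ : F → ℝ → E} (hξ : IsSmoothFamily bc ξ) {f : F → ℝ}
    (hf : ContDiff ℝ ∞ f) : IsSmoothFamily bc (fun s x => f s • ξ s x) :=
  hξ.map₂ hξ (fun s v _ => f s • v) (by fun_prop) (by simp)

theorem IsSmoothFamily.bilin {ξ : F → ℝ → E} {η : F → ℝ → E'} (hξ : IsSmoothFamily bc ξ)
    (hη : IsSmoothFamily bc η) (b : E →L[ℝ] E' →L[ℝ] E'') :
    IsSmoothFamily bc (fun s x => b (ξ s x) (η s x)) :=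
  hξ.map₂ hη (fun _ v w => b v w) (by fun_prop) (by simp)

theorem fderiv_param_apply {ξ : F → ℝ → E} (hξ : ContDiff ℝ ∞ fun z : F × ℝ => ξ z.1 z.2)
    (p : F) (x : ℝ) (v : F) :
    fderiv ℝ (fun q => ξ q x) p v = fderiv ℝ (fun z : F × ℝ => ξ z.1 z.2) (p, x) (v, 0) := by
  have h1 := (hξ.differentiable (by simp)).differentiableAt (x := (p, x)) |>.hasFDerivAt
  have h2 : HasFDerivAt (fun q => ξ q x) _ p :=
    h1.comp (f := fun q : F => (q, x)) p (hasFDerivAt_prodMk_left p x)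
  rw [h2.fderiv]; simp

theorem IsSmoothFamily.fderiv {ξ : F → ℝ → E} (hξ : IsSmoothFamily bc ξ) (v : F) :
    IsSmoothFamily bc (fun p x => fderiv ℝ (fun q => ξ q x) p v) := by
  refine ⟨?_, hξ.2.fderiv v⟩
  simp only [fderiv_param_apply hξ.1]
  exact (hξ.1.fderiv_right (by simp)).clm_apply contDiff_const

theorem IsSmoothFamily.deriv {ξ : ℝ → ℝ → E} (hξ : IsSmoothFamily bc ξ) :
    IsSmoothFamily bc (fun t x => deriv (fun s => ξ s x) t) :=
  hξ.fderiv (1 : ℝ)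

theorem IsSmoothFamily.differentiable {ξ : F → ℝ → E} (hξ : IsSmoothFamily bc ξ) (x : ℝ) :
    Differentiable ℝ (fun p => ξ p x) :=
  (hξ.1.comp (by fun_prop : ContDiff ℝ ∞ fun p : F => (p, x))).differentiable (by simp)

theorem add_mem_mapSpace {ξ η : ℝ → E} (hξ : ξ ∈ mapSpace E bc) (hη : η ∈ mapSpace E bc) :
    (fun x => ξ x + η x) ∈ mapSpace E bc :=
  ((isSmoothFamily_const (F := ℝ) hξ).add (isSmoothFamily_const hη)).mem 0

theorem smul_mem_mapSpace {ξ : ℝ → E} (r : ℝ) (hξ : ξ ∈ mapSpace E bc) :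
    (fun x => r • ξ x) ∈ mapSpace E bc :=
  ((isSmoothFamily_const (F := ℝ) hξ).smul (contDiff_const (c := r))).mem 0

theorem bilin_mem_mapSpace {ξ : ℝ → E} {η : ℝ → E'} (hξ : ξ ∈ mapSpace E bc)
    (hη : η ∈ mapSpace E' bc) (b : E →L[ℝ] E' →L[ℝ] E'') :
    (fun x => b (ξ x) (η x)) ∈ mapSpace E'' bc :=
  ((isSmoothFamily_const (F := ℝ) hξ).bilin (isSmoothFamily_const hη) b).mem 0

variable {l : (ℝ → E) → ℝ}

theorem IsSmoothFunctional.contDiff [FiniteDimensional ℝ F] (hl : IsSmoothFunctional bc l)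
    {ξ : F → ℝ → E} (hξ : IsSmoothFamily bc ξ) : ContDiff ℝ ∞ (fun p => l (ξ p)) := by
  let e := (Module.finBasis ℝ F).equivFunL
  have h1 := hl _ _ (hξ.comp (c := e.symm) e.symm.contDiff)
  have h2 := h1.comp e.contDiff
  simpa [Function.comp_def] using h2

theorem IsSmoothFamily.exists_hadamard [CompleteSpace E] {N : ℝ → ℝ → E}
    (hN : IsSmoothFamily bc N) :
    ∃ D : ℝ → ℝ → E, IsSmoothFamily bc D ∧ (∀ r x, N r x = N 0 x + r • D r x) ∧
      D 0 = fun x => _root_.deriv (fun s => N s x) 0 := by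
  obtain ⟨D, hD, hND, hDi⟩ := exists_contDiff_eq_add_smul hN.1
  refine ⟨fun r x => D (r, x), ⟨hD, ?_⟩, hND, funext fun x => by simp [hDi]⟩
  have hd := hN.deriv.2
  cases bc with
  | periodic P hP =>
    intro r x
    simp only [hDi]
    exact intervalIntegral.integral_congr fun u _ => hd (u * r) x
  | vanishing =>
    intro r₀
    obtain ⟨R, hR⟩ := hd.exists_forall_mem (isCompact_Icc (a := -(|r₀| + 1)) (b := |r₀| + 1))
    refine ⟨R, ?_⟩
    filter_upwards [Metric.ball_mem_nhds r₀ one_pos] with r hr x hx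
    have hr' : |r| ≤ |r₀| + 1 := by
      rw [Metric.mem_ball, Real.dist_eq] at hr
      linarith [abs_sub_abs_le_abs_sub r r₀]
    rw [hDi, intervalIntegral.integral_congr (g := fun _ => (0 : E)) fun u hu => ?_]
    · simp
    · rw [uIcc_of_le zero_le_one] at hu
      refine hR (u * r) (abs_le.1 ?_) x hx
      rw [abs_mul, abs_of_nonneg hu.1]
      exact (mul_le_of_le_one_left (abs_nonneg _) hu.2).trans hr'

/-- Chain rule at the parameter `0`. A functional that is smooth along families only depends to
first order on the velocity of a family: by Hadamard's lemma the family `N s = N 0 + s • D s` is the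
diagonal of the two-parameter family `N 0 + s • D r`. -/
theorem IsSmoothFunctional.hasDerivAt_zero [CompleteSpace E] (hl : IsSmoothFunctional bc l)
    {N : ℝ → ℝ → E} (hN : IsSmoothFamily bc N) :
    HasDerivAt (fun s => l (N s)) (dirDeriv l (N 0) (fun x => deriv (fun s => N s x) 0)) 0 := by
  obtain ⟨D, hD, hND, hD0⟩ := hN.exists_hadamard
  have hQ : IsSmoothFamily bc (fun (z : ℝ × ℝ) x => N 0 x + z.1 • D z.2 x) :=
    (isSmoothFamily_const (hN.mem 0)).add ((hD.comp contDiff_snd).smul contDiff_fst)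
  have hΛ := ((hl.contDiff hQ).differentiable (by simp)).differentiableAt (x := (0, 0))
    |>.hasFDerivAt
  set Λ' := fderiv ℝ (fun z : ℝ × ℝ => l (fun x => N 0 x + z.1 • D z.2 x)) (0, 0)
  have h1 : HasDerivAt (fun s => l (N s)) (Λ' (1, 1)) 0 := by
    have := hΛ.comp_hasDerivAt (f := fun s : ℝ => (s, s)) 0
      ((hasDerivAt_id 0).prodMk (hasDerivAt_id 0))
    refine this.congr_of_eventuallyEq (Eventually.of_forall fun s => ?_)
    show l (N s) = l (fun x => N 0 x + s • D s x)
    congr 1; funext x; exact hND s x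
  have h2 : Λ' (1, 0) = dirDeriv l (N 0) (D 0) := by
    have := hΛ.comp_hasDerivAt (f := fun s : ℝ => (s, 0)) 0
      ((hasDerivAt_id 0).prodMk (hasDerivAt_const 0 0))
    exact this.deriv.symm
  have h3 : Λ' (0, 1) = 0 := by
    have := hΛ.comp_hasDerivAt (f := fun r : ℝ => ((0 : ℝ), r)) 0
      ((hasDerivAt_const 0 0).prodMk (hasDerivAt_id 0))
    rw [← this.deriv]
    simp [Function.comp_def]
  rw [← hD0, ← h2]
  have h4 : Λ' (1, 1) = Λ' (1, 0) + Λ' (0, 1) := by rw [← map_add]; simp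
  rwa [h4, h3, add_zero] at h1

theorem IsSmoothFunctional.fderiv_apply [CompleteSpace E] [FiniteDimensional ℝ F]
    (hl : IsSmoothFunctional bc l) {N : F → ℝ → E} (hN : IsSmoothFamily bc N) (p v : F) :
    fderiv ℝ (fun q => l (N q)) p v =
      dirDeriv l (N p) (fun x => fderiv ℝ (fun q => N q x) p v) := by
  have hline : HasDerivAt (fun s : ℝ => p + s • v) v 0 := by
    simpa using ((hasDerivAt_id (0 : ℝ)).smul_const v).const_add p
  have h0 : p + (0 : ℝ) • v = p := by simp
  have h1 := hl.hasDerivAt_zero (hN.comp (by fun_prop : ContDiff ℝ ∞ fun s : ℝ => p + s • v))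
  have h2 : HasFDerivAt (fun q => l (N q)) (fderiv ℝ (fun q => l (N q)) p) (p + (0 : ℝ) • v) := by
    rw [h0]; exact ((hl.contDiff hN).differentiable (by simp)).differentiableAt.hasFDerivAt
  have h3 : HasDerivAt (fun s : ℝ => l (N (p + s • v))) _ 0 :=
    HasFDerivAt.comp_hasDerivAt (l := fun q => l (N q)) (0 : ℝ) h2 hline
  rw [h3.unique h1, h0]
  congr 1
  funext x
  have h4 : HasFDerivAt (fun q => N q x) (fderiv ℝ (fun q => N q x) p) (p + (0 : ℝ) • v) := by
    rw [h0]; exact (hN.differentiable x).differentiableAt.hasFDerivAt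
  exact (h4.comp_hasDerivAt (0 : ℝ) hline).deriv

theorem IsSmoothFunctional.hasDerivAt [CompleteSpace E] (hl : IsSmoothFunctional bc l)
    {N : ℝ → ℝ → E} (hN : IsSmoothFamily bc N) (t : ℝ) :
    HasDerivAt (fun s => l (N s)) (dirDeriv l (N t) (fun x => deriv (fun s => N s x) t)) t := by
  have h := ((hl.contDiff hN).differentiable (by simp)).differentiableAt (x := t)
  have h1 : dirDeriv l (N t) (fun x => deriv (fun s => N s x) t) = deriv (fun s => l (N s)) t :=
    (hl.fderiv_apply hN t 1).symm
  rw [h1]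
  exact h.hasDerivAt

theorem dirDeriv_smul (M ξ : ℝ → E) (r : ℝ) :
    dirDeriv l M (fun x => r • ξ x) = r * dirDeriv l M ξ := by
  have h := deriv_comp_mul_left r (fun σ : ℝ => l (fun x => M x + σ • ξ x)) 0
  simp only [mul_zero, smul_eq_mul] at h
  rw [dirDeriv, dirDeriv, ← h]
  congr 1
  funext σ
  simp only [smul_smul, mul_comm]

theorem dirDeriv_zero (M : ℝ → E) : dirDeriv l M 0 = 0 := by
  simp [dirDeriv]

theorem IsSmoothFunctional.dirDeriv_add (hl : IsSmoothFunctional bc l) {M ξ η : ℝ → E}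
    (hM : M ∈ mapSpace E bc) (hξ : ξ ∈ mapSpace E bc) (hη : η ∈ mapSpace E bc) :
    dirDeriv l M (fun x => ξ x + η x) = dirDeriv l M ξ + dirDeriv l M η := by
  have hQ : IsSmoothFamily bc (fun (z : ℝ × ℝ) x => (M x + z.1 • ξ x) + z.2 • η x) :=
    ((isSmoothFamily_const hM).add ((isSmoothFamily_const hξ).smul contDiff_fst)).add
      ((isSmoothFamily_const hη).smul contDiff_snd)
  have hΛ := ((hl.contDiff hQ).differentiable (by simp)).differentiableAt (x := (0, 0))
    |>.hasFDerivAt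
  have h := fun v w : ℝ => (hΛ.comp_hasDerivAt_of_eq (f := fun s : ℝ => (s * v, s * w)) (0 : ℝ)
    (((hasDerivAt_id 0).mul_const v).prodMk ((hasDerivAt_id 0).mul_const w)) (by simp)).deriv
  have h1 := h 1 1
  have h2 := h 1 0
  have h3 := h 0 1
  simp only [Function.comp_def, mul_one, mul_zero, zero_smul, add_zero] at h1 h2 h3
  rw [dirDeriv, dirDeriv, dirDeriv, h2, h3, ← map_add]
  simp only [Prod.mk_add_mk, add_zero, zero_add]
  rw [← h1]
  simp only [smul_add, add_assoc]

theorem IsSmoothFunctional.contDiff_dirDeriv [FiniteDimensional ℝ F]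
    (hl : IsSmoothFunctional bc l) {M η : F → ℝ → E} (hM : IsSmoothFamily bc M)
    (hη : IsSmoothFamily bc η) : ContDiff ℝ ∞ (fun p => dirDeriv l (M p) (η p)) := by
  have hQ : IsSmoothFamily bc (fun (z : F × ℝ) x => M z.1 x + z.2 • η z.1 x) :=
    (hM.comp contDiff_fst).add ((hη.comp contDiff_fst).smul contDiff_snd)
  have hc := hl.contDiff hQ
  have h1 : (fun p => dirDeriv l (M p) (η p)) = fun p =>
      fderiv ℝ (fun z : F × ℝ => l (fun x => M z.1 x + z.2 • η z.1 x)) (p, 0) (0, 1) := by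
    funext p
    have hΛ := (hc.differentiable (by simp)).differentiableAt (x := (p, 0)) |>.hasFDerivAt
    exact (hΛ.comp_hasDerivAt (0 : ℝ)
      ((hasDerivAt_const (0 : ℝ) p).prodMk (hasDerivAt_id (0 : ℝ)))).deriv
  rw [h1]
  exact ((hc.fderiv_right (m := ∞) (by simp)).comp
    (by fun_prop : ContDiff ℝ ∞ fun p : F => (p, (0 : ℝ)))).clm_apply contDiff_const

/-- The variational derivative at a point is itself a smooth functional. -/
theorem IsSmoothFunctional.isSmoothFunctional_dirDeriv (hl : IsSmoothFunctional bc l) {M : ℝ → E}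
    (hM : M ∈ mapSpace E bc) : IsSmoothFunctional bc (dirDeriv l M) :=
  fun _ _ hξ => hl.contDiff_dirDeriv (isSmoothFamily_const hM) hξ

theorem IsSmoothFunctional.dirDeriv_dirDeriv (hl : IsSmoothFunctional bc l) {M ξ η : ℝ → E}
    (hM : M ∈ mapSpace E bc) (hξ : ξ ∈ mapSpace E bc) (hη : η ∈ mapSpace E bc) :
    dirDeriv (dirDeriv l M) ξ η = dirDeriv l M η := by
  have h1 : (fun σ : ℝ => dirDeriv l M (fun x => ξ x + σ • η x)) =
      fun σ => dirDeriv l M ξ + σ * dirDeriv l M η := by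
    funext σ
    rw [hl.dirDeriv_add hM hξ (smul_mem_mapSpace σ hη), dirDeriv_smul]
  have h2 : HasDerivAt (fun σ => dirDeriv l M ξ + σ * dirDeriv l M η) (dirDeriv l M η) 0 := by
    simpa using ((hasDerivAt_id (0 : ℝ)).mul_const (dirDeriv l M η)).const_add (dirDeriv l M ξ)
  rw [dirDeriv, h1, h2.deriv]

/-- The product rule for `d/dt ⟨δl/δM, η⟩`. -/
theorem IsSmoothFunctional.hasDerivAt_dirDeriv [CompleteSpace E] (hl : IsSmoothFunctional bc l)
    {M η : ℝ → ℝ → E} (hM : IsSmoothFamily bc M) (hη : IsSmoothFamily bc η) (t : ℝ) :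
    HasDerivAt (fun τ => dirDeriv l (M τ) (η τ))
      (deriv (fun τ => dirDeriv l (M τ) (η t)) t +
        dirDeriv l (M t) (fun x => deriv (fun τ => η τ x) t)) t := by
  have hK := hl.contDiff_dirDeriv (hM.comp (contDiff_fst (E := ℝ) (F := ℝ)))
    (hη.comp (contDiff_snd (E := ℝ) (F := ℝ)))
  have hK' := (hK.differentiable (by simp)).differentiableAt (x := (t, t)) |>.hasFDerivAt
  set K' := fderiv ℝ (fun z : ℝ × ℝ => dirDeriv l (M z.1) (η z.2)) (t, t)
  have h1 : HasDerivAt (fun τ => dirDeriv l (M τ) (η τ)) (K' (1, 1)) t :=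
    hK'.comp_hasDerivAt (f := fun τ : ℝ => (τ, τ)) t ((hasDerivAt_id t).prodMk (hasDerivAt_id t))
  have h2 : HasDerivAt (fun τ => dirDeriv l (M τ) (η t)) (K' (1, 0)) t :=
    hK'.comp_hasDerivAt (f := fun τ : ℝ => (τ, t)) t
      ((hasDerivAt_id t).prodMk (hasDerivAt_const t t))
  have h3 : HasDerivAt (fun τ => dirDeriv l (M t) (η τ)) (K' (0, 1)) t :=
    hK'.comp_hasDerivAt (f := fun τ : ℝ => (t, τ)) t
      ((hasDerivAt_const t t).prodMk (hasDerivAt_id t))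
  have h4 := (hl.isSmoothFunctional_dirDeriv (hM.mem t)).hasDerivAt hη t
  rw [hl.dirDeriv_dirDeriv (hM.mem t) (hη.mem t) (hη.deriv.mem t)] at h4
  rw [h2.deriv, ← h3.unique h4, ← map_add]
  simpa using h1

end Functional

/-! ### The constrained variational principle -/

section Reduced

variable {E : Type*} [NormedAddCommGroup E] [NormedSpace ℝ E] [CompleteSpace E]
  {bc : BoundaryCond} {l : (ℝ → E) → ℝ}

omit [CompleteSpace E] in
theorem hasDerivAt_reducedAction (hl : IsSmoothFunctional bc l) {M δM : ℝ → ℝ → E}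
    (hM : IsSmoothFamily bc M) (hδM : IsSmoothFamily bc δM) {c : ℝ → ℝ} (hc : ContDiff ℝ 1 c)
    (m : ℝ) {t₀ t₁ : ℝ} (ht : t₀ ≤ t₁) :
    HasDerivAt
      (fun ε : ℝ => ∫ t in t₀..t₁, (l (fun x => M t x + ε • δM t x) + (m + ε * c t) ^ 2 / 2))
      (∫ t in t₀..t₁, (dirDeriv l (M t) (δM t) + m * c t)) 0 := by
  have hQ : IsSmoothFamily bc (fun (z : ℝ × ℝ) x => M z.2 x + z.1 • δM z.2 x) :=
    (hM.comp contDiff_snd).add ((hδM.comp contDiff_snd).smul contDiff_fst)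
  have hlQ := hl.contDiff hQ
  have h := hasDerivAt_intervalIntegral_of_contDiffAt (x₀ := (0 : ℝ)) ht
    (f := fun z : ℝ × ℝ => l (fun x => M z.2 x + z.1 • δM z.2 x) + (m + z.1 * c z.2) ^ 2 / 2)
    fun t _ => by
      have h1 : ContDiff ℝ 1 fun z : ℝ × ℝ => (m + z.1 * c z.2) ^ 2 / 2 := by fun_prop
      exact ((hlQ.of_le (by simp)).add h1).contDiffAt
  refine h.congr_deriv (intervalIntegral.integral_congr fun t _ => ?_)
  have h1 : HasDerivAt (fun ε : ℝ => l (fun x => M t x + ε • δM t x))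
      (dirDeriv l (M t) (δM t)) 0 := by
    have : DifferentiableAt ℝ (fun ε : ℝ => l (fun x => M t x + ε • δM t x)) 0 :=
      ((hlQ.comp (by fun_prop : ContDiff ℝ ∞ fun ε : ℝ => (ε, t))).differentiable
        (by simp)).differentiableAt
    exact this.hasDerivAt
  have h2 : HasDerivAt (fun ε : ℝ => (m + ε * c t) ^ 2 / 2) (m * c t) 0 := by
    have := ((((hasDerivAt_id (0 : ℝ)).mul_const (c t)).const_add m).pow 2).div_const 2
    exact this.congr_deriv (by norm_num; ring)
  exact (h1.add h2).deriv

/-- The constrained variational principle and the Euler–Poincaré equation are equivalent as soon as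
`c (M t)` is homogeneous and continuously differentiable along smooth curves. In one direction the
integrand of the first variation is the total derivative of `⟨δl/δM, η⟩`, in the other the
variations `η = f ξ` with a test function `f` of time are enough. -/
theorem reducedPrinciple_iff_eulerPoincare_of_homogeneous (hl : IsSmoothFunctional bc l)
    (br : E →L[ℝ] E →L[ℝ] E) (c : (ℝ → E) → (ℝ → E) → ℝ) {M : ℝ → ℝ → E}
    (hM : IsSmoothFamily bc M) (m : ℝ) {t₀ t₁ : ℝ} (ht : t₀ < t₁)
    (hcs : ∀ t, ∀ ξ ∈ mapSpace E bc, ∀ r : ℝ, c (M t) (fun x => r • ξ x) = r * c (M t) ξ)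
    (hcc : ∀ η : ℝ → ℝ → E, IsSmoothFamily bc η → ContDiff ℝ 1 (fun t => c (M t) (η t))) :
    (∀ η : ℝ → ℝ → E, IsSmoothFamily bc η → η t₀ = 0 → η t₁ = 0 →
      HasDerivAt (fun ε : ℝ => ∫ t in t₀..t₁,
        (l (fun x => M t x + ε • (deriv (fun τ => η τ x) t + br (M t x) (η t x))) +
          (m + ε * c (M t) (η t)) ^ 2 / 2)) 0 0) ↔
    ∀ ξ ∈ mapSpace E bc, ∀ t ∈ Icc t₀ t₁,
      HasDerivAt (fun τ => dirDeriv l (M τ) ξ)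
        (dirDeriv l (M t) (fun x => br (M t x) (ξ x)) + m * c (M t) ξ) t := by
  have key : ∀ η : ℝ → ℝ → E, IsSmoothFamily bc η → HasDerivAt (fun ε : ℝ => ∫ t in t₀..t₁,
        (l (fun x => M t x + ε • (deriv (fun τ => η τ x) t + br (M t x) (η t x))) +
          (m + ε * c (M t) (η t)) ^ 2 / 2))
      (∫ t in t₀..t₁, (dirDeriv l (M t) (fun x => deriv (fun τ => η τ x) t) +
        (dirDeriv l (M t) (fun x => br (M t x) (η t x)) + m * c (M t) (η t)))) 0 := by
    intro η hη
    have h := hasDerivAt_reducedAction hl hM (hη.deriv.add (hM.bilin hη br)) (hcc η hη) m ht.le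
    refine h.congr_deriv (intervalIntegral.integral_congr fun t _ => ?_)
    rw [hl.dirDeriv_add (hM.mem t) (hη.deriv.mem t) ((hM.bilin hη br).mem t), add_assoc]
  constructor
  · intro H ξ hξ
    have hξ' := isSmoothFamily_const (F := ℝ) hξ
    have hp := hl.contDiff_dirDeriv hM hξ'
    have hq : Continuous fun t =>
        dirDeriv l (M t) (fun x => br (M t x) (ξ x)) + m * c (M t) ξ :=
      (hl.contDiff_dirDeriv hM (hM.bilin hξ' br)).continuous.add
        ((hcc _ hξ').continuous.const_mul m)
    refine deriv_eq_of_integral_eq_zero ht (fun t _ => hp.contDiffAt.of_le (by simp))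
      hq.continuousOn fun f hf hfs => ?_
    have hfe : ∀ t, t ∉ Ioo t₀ t₁ → f t = 0 := fun t ht =>
      image_eq_zero_of_notMem_tsupport fun h => ht (hfs h)
    have hη : IsSmoothFamily bc (fun t x => f t • ξ x) := hξ'.smul hf
    have h0 : (fun x => f t₀ • ξ x) = 0 := by
      funext x; rw [hfe t₀ (by simp), zero_smul]; rfl
    have h1 : (fun x => f t₁ • ξ x) = 0 := by
      funext x; rw [hfe t₁ (by simp), zero_smul]; rfl
    rw [← (key _ hη).unique (H _ hη h0 h1)]
    refine intervalIntegral.integral_congr fun t _ => ?_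
    have hd : (fun x => deriv (fun τ => f τ • ξ x) t) = fun x => deriv f t • ξ x :=
      funext fun x => deriv_smul_const
        ((hf.differentiable (by simp)).differentiableAt) (ξ x)
    simp only [hd, dirDeriv_smul, map_smul, hcs t ξ hξ]
    ring
  · intro H η hη h0 h1
    refine (key η hη).congr_deriv ?_
    have hd : ∀ t ∈ uIcc t₀ t₁, HasDerivAt (fun τ => dirDeriv l (M τ) (η τ))
        (dirDeriv l (M t) (fun x => deriv (fun τ => η τ x) t) +
        (dirDeriv l (M t) (fun x => br (M t x) (η t x)) + m * c (M t) (η t))) t := by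
      intro t ht'
      rw [uIcc_of_le ht.le] at ht'
      have := hl.hasDerivAt_dirDeriv hM hη t
      rwa [(H _ (hη.mem t) t ht').deriv, add_comm] at this
    have hq : Continuous fun t => dirDeriv l (M t) (fun x => deriv (fun τ => η τ x) t) +
        (dirDeriv l (M t) (fun x => br (M t x) (η t x)) + m * c (M t) (η t)) :=
      (hl.contDiff_dirDeriv hM hη.deriv).continuous.add
        ((hl.contDiff_dirDeriv hM (hM.bilin hη br)).continuous.add
          ((hcc _ hη).continuous.const_mul m))
    rw [intervalIntegral.integral_eq_sub_of_hasDerivAt hd (hq.intervalIntegrable _ _), h0, h1,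
      dirDeriv_zero, dirDeriv_zero, sub_zero]

end Reduced

/-! ### The Maurer–Cartan form of a map into a Lie group -/

section MaurerCartan

variable {E : Type*} [NormedAddCommGroup E] [NormedSpace ℝ E]
  {G : Type*} [TopologicalSpace G] [ChartedSpace E G] [Group G] [LieGroup 𝓘(ℝ, E) ∞ G]
  {P : Type*} [NormedAddCommGroup P] [NormedSpace ℝ P]

theorem contDiffAt_extChartAt_one_comp {f : P → G} {p : P} (hf : ContMDiffAt 𝓘(ℝ, P) 𝓘(ℝ, E) ∞ f p)
    (h : f p ∈ (chartAt E (1 : G)).source) :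
    ContDiffAt ℝ ∞ (fun q => extChartAt 𝓘(ℝ, E) (1 : G) (f q)) p := by
  have : IsManifold 𝓘(ℝ, E) ∞ G := inferInstance
  rw [← contMDiffAt_iff_contDiffAt]
  exact (contMDiffAt_extChartAt' h).comp p hf

/-- The pull-back `f⁻¹ df` along `f` of the left Maurer–Cartan form of `G`, with values in the model
space `E` of the Lie algebra: the derivative at `p` of `q ↦ f(p)⁻¹ f(q)`, read in the chart at the
identity. -/
def mcForm (f : P → G) (p : P) : P →L[ℝ] E :=
  fderiv ℝ (fun q => extChartAt 𝓘(ℝ, E) (1 : G) ((f p)⁻¹ * f q)) p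

theorem contDiffAt_chart_div {f : P → G} (hf : ContMDiff 𝓘(ℝ, P) 𝓘(ℝ, E) ∞ f) (p : P) :
    ContDiffAt ℝ ∞
      (fun z : P × P => extChartAt 𝓘(ℝ, E) (1 : G) ((f z.1)⁻¹ * f z.2)) (p, p) := by
  refine contDiffAt_extChartAt_one_comp (P := P × P) ?_ (by simp)
  have h1 : ContMDiff 𝓘(ℝ, P × P) 𝓘(ℝ, E) ∞ (fun z : P × P => f z.1) :=
    hf.comp contDiff_fst.contMDiff
  have h2 : ContMDiff 𝓘(ℝ, P × P) 𝓘(ℝ, E) ∞ (fun z : P × P => f z.2) :=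
    hf.comp contDiff_snd.contMDiff
  exact (h1.inv.mul h2).contMDiffAt

theorem hasFDerivAt_mcForm {f : P → G} (hf : ContMDiff 𝓘(ℝ, P) 𝓘(ℝ, E) ∞ f) (p : P) :
    HasFDerivAt (fun q => extChartAt 𝓘(ℝ, E) (1 : G) ((f p)⁻¹ * f q)) (mcForm f p) p := by
  have h := (contDiffAt_chart_div hf p).comp (f := fun q : P => (p, q)) p (by fun_prop)
  exact (h.differentiableAt (by simp)).hasFDerivAt

theorem contDiff_mcForm {f : P → G} (hf : ContMDiff 𝓘(ℝ, P) 𝓘(ℝ, E) ∞ f) :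
    ContDiff ℝ ∞ (mcForm (E := E) f) := by
  refine contDiff_iff_contDiffAt.2 fun p => ?_
  have h := contDiffAt_chart_div hf p
  have h1 : (mcForm (E := E) f) =ᶠ[𝓝 p] fun q => (fderiv ℝ
      (fun z : P × P => extChartAt 𝓘(ℝ, E) (1 : G) ((f z.1)⁻¹ * f z.2)) (q, q)).comp
        (ContinuousLinearMap.inr ℝ P P) := by
    refine Eventually.of_forall fun q => ?_
    have h2 := ((contDiffAt_chart_div hf q).differentiableAt (by simp)).hasFDerivAt
    exact (h2.comp (f := fun q' : P => (q, q')) q (hasFDerivAt_prodMk_right q q)).fderiv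
  refine ContDiffAt.congr_of_eventuallyEq ?_ h1
  exact (ContDiffAt.comp (f := fun q : P => (q, q)) p (h.fderiv_right (m := ∞) (by simp))
    (by fun_prop)).clm_comp contDiffAt_const

omit [LieGroup 𝓘(ℝ, E) ∞ G] in
theorem mcForm_mul_left (g : G) (f : P → G) : mcForm (E := E) (fun q => g * f q) = mcForm f := by
  funext p
  simp [mcForm, mul_assoc]

omit [LieGroup 𝓘(ℝ, E) ∞ G] in
/-- The velocity of a curve through the identity, read in the chart at the identity. -/
theorem mfderiv_apply_one_of_eq_one {k : ℝ → G} {t : ℝ} (hk : MDifferentiableAt 𝓘(ℝ, ℝ) 𝓘(ℝ, E) k t)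
    (h1 : k t = 1) :
    (mfderiv 𝓘(ℝ, ℝ) 𝓘(ℝ, E) k t (1 : ℝ) : E) =
      deriv (fun τ => extChartAt 𝓘(ℝ, E) (1 : G) (k τ)) t := by
  -- the fibres of the tangent bundle are copies of `E`, so the derivative is a map `ℝ →L[ℝ] E`
  have key : ∀ L : ℝ →L[ℝ] E, HasMFDerivAt 𝓘(ℝ, ℝ) 𝓘(ℝ, E) k t L →
      L 1 = deriv (fun τ => extChartAt 𝓘(ℝ, E) (1 : G) (k τ)) t := by
    intro L hL
    have h2 : writtenInExtChartAt 𝓘(ℝ, ℝ) 𝓘(ℝ, E) t k =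
        fun τ => extChartAt 𝓘(ℝ, E) (1 : G) (k τ) := by
      funext τ
      show extChartAt 𝓘(ℝ, E) (k t) (k ((extChartAt 𝓘(ℝ, ℝ) t).symm τ)) = _
      rw [h1]; rfl
    have h3 : HasFDerivWithinAt (writtenInExtChartAt 𝓘(ℝ, ℝ) 𝓘(ℝ, E) t k) L univ t := by
      have := hL.2
      rw [ModelWithCorners.range_eq_univ] at this
      exact this
    rw [h2, hasFDerivWithinAt_univ] at h3
    exact h3.hasDerivAt.deriv.symm
  exact key _ hk.hasMFDerivAt

/-- The left logarithmic derivative of a curve of values of `f`. -/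
theorem leftLogDeriv_comp {f : P → G} (hf : ContMDiff 𝓘(ℝ, P) 𝓘(ℝ, E) ∞ f) {c : ℝ → P} {c' : P}
    {t : ℝ} (hc : HasDerivAt c c' t) :
    (leftLogDeriv (E := E) (fun τ => f (c τ)) t : E) = mcForm (E := E) f (c t) c' := by
  have hd : MDifferentiableAt 𝓘(ℝ, ℝ) 𝓘(ℝ, E) (fun τ => (f (c t))⁻¹ * f (c τ)) t := by
    have h1 : ContMDiff 𝓘(ℝ, P) 𝓘(ℝ, E) ∞ (fun q => (f (c t))⁻¹ * f q) := contMDiff_const.mul hf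
    exact (h1.mdifferentiable (by simp)).mdifferentiableAt.comp t
      hc.differentiableAt.mdifferentiableAt
  refine (mfderiv_apply_one_of_eq_one hd (by simp)).trans ?_
  exact ((hasFDerivAt_mcForm hf (c t)).comp_hasDerivAt t hc).deriv

variable (E G) in
/-- The multiplication of `G` in the chart at the identity. -/
def chartMul (z : E × E) : E :=
  extChartAt 𝓘(ℝ, E) (1 : G)
    ((extChartAt 𝓘(ℝ, E) (1 : G)).symm z.1 * (extChartAt 𝓘(ℝ, E) (1 : G)).symm z.2)

variable (E G) in
/-- The left-invariant vector field with value `v` at the identity takes at the point with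
coordinates `y` the value `chartLeftInv y v` in the chart at the identity. -/
def chartLeftInv (y : E) : E →L[ℝ] E :=
  (fderiv ℝ (chartMul E G) (y, extChartAt 𝓘(ℝ, E) (1 : G) 1)).comp (ContinuousLinearMap.inr ℝ E E)

theorem contMDiffAt_extChartAt_one_symm {y : E} (hy : y ∈ (extChartAt 𝓘(ℝ, E) (1 : G)).target) :
    ContMDiffAt 𝓘(ℝ, E) 𝓘(ℝ, E) ∞ (extChartAt 𝓘(ℝ, E) (1 : G)).symm y := by
  have : IsManifold 𝓘(ℝ, E) ∞ G := inferInstance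
  exact (contMDiffOn_extChartAt_symm (1 : G)).contMDiffAt
    ((isOpen_extChartAt_target (I := 𝓘(ℝ, E)) (1 : G)).mem_nhds hy)

theorem contDiffAt_chartMul {y : E} (hy : y ∈ (extChartAt 𝓘(ℝ, E) (1 : G)).target) :
    ContDiffAt ℝ ∞ (chartMul E G) (y, extChartAt 𝓘(ℝ, E) (1 : G) 1) := by
  have h1 : ContMDiffAt 𝓘(ℝ, E × E) 𝓘(ℝ, E) ∞
      (fun z : E × E => (extChartAt 𝓘(ℝ, E) (1 : G)).symm z.1) (y, extChartAt 𝓘(ℝ, E) (1 : G) 1) :=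
    ContMDiffAt.comp (g := (extChartAt 𝓘(ℝ, E) (1 : G)).symm) (f := Prod.fst) _
      (contMDiffAt_extChartAt_one_symm hy) contDiff_fst.contMDiff.contMDiffAt
  have h2 : ContMDiffAt 𝓘(ℝ, E × E) 𝓘(ℝ, E) ∞
      (fun z : E × E => (extChartAt 𝓘(ℝ, E) (1 : G)).symm z.2) (y, extChartAt 𝓘(ℝ, E) (1 : G) 1) :=
    ContMDiffAt.comp (g := (extChartAt 𝓘(ℝ, E) (1 : G)).symm) (f := Prod.snd) _
      (contMDiffAt_extChartAt_one_symm (mem_extChartAt_target _)) contDiff_snd.contMDiff.contMDiffAt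
  refine contDiffAt_extChartAt_one_comp (h1.mul h2) ?_
  have := (extChartAt 𝓘(ℝ, E) (1 : G)).map_target hy
  simpa using this

theorem contDiffAt_chartLeftInv :
    ContDiffAt ℝ ∞ (chartLeftInv E G) (extChartAt 𝓘(ℝ, E) (1 : G) 1) :=
  (ContDiffAt.comp (f := fun y : E => (y, extChartAt 𝓘(ℝ, E) (1 : G) 1)) _
    ((contDiffAt_chartMul (mem_extChartAt_target _)).fderiv_right (m := ∞) (by simp))
    (by fun_prop)).clm_comp contDiffAt_const

theorem hasFDerivAt_chartLeftInv {y : E} (hy : y ∈ (extChartAt 𝓘(ℝ, E) (1 : G)).target) :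
    HasFDerivAt (fun w => chartMul E G (y, w)) (chartLeftInv E G y)
      (extChartAt 𝓘(ℝ, E) (1 : G) 1) :=
  ((contDiffAt_chartMul hy).differentiableAt (by simp)).hasFDerivAt.comp _
    (hasFDerivAt_prodMk_right y _)

theorem chartLeftInv_one :
    chartLeftInv E G (extChartAt 𝓘(ℝ, E) (1 : G) 1) = ContinuousLinearMap.id ℝ E := by
  have h1 := hasFDerivAt_chartLeftInv (E := E) (G := G) (mem_extChartAt_target (1 : G))
  have h2 : (fun w => chartMul E G (extChartAt 𝓘(ℝ, E) (1 : G) 1, w))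
      =ᶠ[𝓝 (extChartAt 𝓘(ℝ, E) (1 : G) 1)] fun w => w := by
    filter_upwards [extChartAt_target_mem_nhds (I := 𝓘(ℝ, E)) (1 : G)] with w hw
    rw [chartMul, extChartAt_to_inv, one_mul, (extChartAt 𝓘(ℝ, E) (1 : G)).right_inv hw]
  exact h1.unique ((hasFDerivAt_id _).congr_of_eventuallyEq h2)

end MaurerCartan

/-! ### The Maurer–Cartan equation -/

section Bracket

variable {E : Type*} [NormedAddCommGroup E] [NormedSpace ℝ E]
  {G : Type*} [TopologicalSpace G] [ChartedSpace E G] [Group G] [LieGroup 𝓘(ℝ, E) ∞ G]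
  {P : Type*} [NormedAddCommGroup P] [NormedSpace ℝ P]

/-- Left-invariant vector fields in the chart at the identity. -/
theorem mpullbackWithin_mulInvariantVectorField {y : E}
    (hy : y ∈ (extChartAt 𝓘(ℝ, E) (1 : G)).target) (V : GroupLieAlgebra 𝓘(ℝ, E) G) :
    (VectorField.mpullbackWithin 𝓘(ℝ, E) 𝓘(ℝ, E) (extChartAt 𝓘(ℝ, E) (1 : G)).symm
      (mulInvariantVectorField V) (range 𝓘(ℝ, E)) y : E) = chartLeftInv E G y (V : E) := by
  have : IsManifold 𝓘(ℝ, E) ∞ G := inferInstance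
  have : IsManifold 𝓘(ℝ, E) 1 G := .of_le (n := ∞) (by simp)
  rw [VectorField.mpullbackWithin_apply, ContinuousLinearMap.inverse_eq
    (mfderivWithin_extChartAt_symm_comp_mfderiv_extChartAt hy)
    (mfderiv_extChartAt_comp_mfderivWithin_extChartAt_symm hy)]
  set g := (extChartAt 𝓘(ℝ, E) (1 : G)).symm y with hg
  have hgs : g * 1 ∈ (chartAt E (1 : G)).source := by
    have := (extChartAt 𝓘(ℝ, E) (1 : G)).map_target hy
    rw [mul_one, ← extChartAt_source 𝓘(ℝ, E)]
    exact this
  have h1 : MDifferentiableAt 𝓘(ℝ, E) 𝓘(ℝ, E) (fun b : G => g * b) 1 :=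
    (contMDiff_mul_left (I := 𝓘(ℝ, E)) (n := ∞)).mdifferentiableAt (by simp)
  have h2 : MDifferentiableAt 𝓘(ℝ, E) 𝓘(ℝ, E) (extChartAt 𝓘(ℝ, E) (1 : G)) (g * 1) :=
    mdifferentiableAt_extChartAt hgs
  have key : ∀ L : E →L[ℝ] E, HasMFDerivAt 𝓘(ℝ, E) 𝓘(ℝ, E)
      (fun b : G => extChartAt 𝓘(ℝ, E) (1 : G) (g * b)) 1 L → L = chartLeftInv E G y := by
    intro L hL
    have h3 : HasFDerivWithinAt (fun w => chartMul E G (y, w)) L univ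
        (extChartAt 𝓘(ℝ, E) (1 : G) 1) := by
      have := hL.2
      rw [ModelWithCorners.range_eq_univ] at this
      exact this
    rw [hasFDerivWithinAt_univ] at h3
    exact h3.unique (hasFDerivAt_chartLeftInv hy)
  have h4 := key _ (h2.hasMFDerivAt.comp 1 h1.hasMFDerivAt)
  rw [← h4]
  show _ = (mfderiv 𝓘(ℝ, E) 𝓘(ℝ, E) (extChartAt 𝓘(ℝ, E) (1 : G)) (g * 1))
    (mfderiv 𝓘(ℝ, E) 𝓘(ℝ, E) (fun b : G => g * b) 1 V)
  rw [mul_one]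
  rfl

variable (E G) in
/-- The Lie bracket of `𝔤` as an operation on its underlying normed space `E`. -/
def modelBracket (v w : E) : E :=
  Bracket.bracket (L := GroupLieAlgebra 𝓘(ℝ, E) G) (M := GroupLieAlgebra 𝓘(ℝ, E) G) v w

/-- The Lie bracket of `𝔤`, computed from the left-invariant vector fields in the chart at the
identity. -/
theorem modelBracket_eq_fderiv_chartLeftInv (V W : E) :
    modelBracket E G V W = fderiv ℝ (chartLeftInv E G) (extChartAt 𝓘(ℝ, E) (1 : G) 1) V W -
      fderiv ℝ (chartLeftInv E G) (extChartAt 𝓘(ℝ, E) (1 : G) 1) W V := by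
  have : IsManifold 𝓘(ℝ, E) ∞ G := inferInstance
  have : IsManifold 𝓘(ℝ, E) 1 G := .of_le (n := ∞) (by simp)
  set a := extChartAt 𝓘(ℝ, E) (1 : G) 1 with ha
  have hX : ∀ V : E, (fun y => (VectorField.mpullbackWithin 𝓘(ℝ, E) 𝓘(ℝ, E)
      (extChartAt 𝓘(ℝ, E) (1 : G)).symm (mulInvariantVectorField (G := G) (I := 𝓘(ℝ, E)) V)
        (range 𝓘(ℝ, E)) y : E)) =ᶠ[𝓝 a] fun y => chartLeftInv E G y V := fun V => by
    filter_upwards [extChartAt_target_mem_nhds (I := 𝓘(ℝ, E)) (1 : G)] with y hy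
    exact mpullbackWithin_mulInvariantVectorField hy V
  have hd : ∀ V : E, HasFDerivAt (fun y => chartLeftInv E G y V)
      ((ContinuousLinearMap.apply ℝ E V).comp (fderiv ℝ (chartLeftInv E G) a)) a := fun V =>
    ((ContinuousLinearMap.apply ℝ E V).hasFDerivAt).comp a
      ((contDiffAt_chartLeftInv.differentiableAt (by simp)).hasFDerivAt)
  have h0 : ∀ V W : GroupLieAlgebra 𝓘(ℝ, E) G, ⁅V, W⁆ = VectorField.lieBracketWithin ℝ
      (VectorField.mpullbackWithin 𝓘(ℝ, E) 𝓘(ℝ, E)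
        (extChartAt 𝓘(ℝ, E) (1 : G)).symm (mulInvariantVectorField V) (range 𝓘(ℝ, E)))
      (VectorField.mpullbackWithin 𝓘(ℝ, E) 𝓘(ℝ, E)
        (extChartAt 𝓘(ℝ, E) (1 : G)).symm (mulInvariantVectorField W) (range 𝓘(ℝ, E)))
      ((extChartAt 𝓘(ℝ, E) (1 : G)).symm ⁻¹' univ ∩ range 𝓘(ℝ, E)) a := fun V W => by
    rw [GroupLieAlgebra.bracket_def, VectorField.mlieBracket, VectorField.mlieBracketWithin_apply,
      mfderiv_extChartAt_self]
    exact DFunLike.congr_fun (ContinuousLinearMap.inverse_id (R := ℝ) (M := E)) _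
  have h1 : ∀ A B A' B' : E → E, A =ᶠ[𝓝 a] A' → B =ᶠ[𝓝 a] B' → VectorField.lieBracketWithin ℝ A B
      ((extChartAt 𝓘(ℝ, E) (1 : G)).symm ⁻¹' univ ∩ range 𝓘(ℝ, E)) a =
        VectorField.lieBracket ℝ A' B' a := by
    intro A B A' B' hA hB
    rw [ModelWithCorners.range_eq_univ, preimage_univ, univ_inter,
      VectorField.lieBracketWithin_univ]
    exact hA.lieBracket_vectorField_eq hB
  refine (h0 V W).trans ((h1 _ _ _ _ (hX V) (hX W)).trans ?_)
  have hid : chartLeftInv E G a = ContinuousLinearMap.id ℝ E := chartLeftInv_one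
  rw [VectorField.lieBracket, (hd V).fderiv, (hd W).fderiv, hid]
  rfl

/-- The Maurer–Cartan equation. In the chart at the identity the derivative of `q ↦ f(p)⁻¹ f(q)` is
the value of the left-invariant vector field given by the form, so that the symmetry of second
derivatives expresses the exterior derivative of the form by the bracket. -/
theorem fderiv_mcForm_sub {f : P → G} (hf : ContMDiff 𝓘(ℝ, P) 𝓘(ℝ, E) ∞ f) (p v w : P) :
    fderiv ℝ (fun q => mcForm (E := E) f q w) p v - fderiv ℝ (fun q => mcForm (E := E) f q v) p w =
      modelBracket E G (mcForm f p w) (mcForm f p v) := by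
  set a := extChartAt 𝓘(ℝ, E) (1 : G) 1 with ha
  set u : P → E := fun q => extChartAt 𝓘(ℝ, E) (1 : G) ((f p)⁻¹ * f q) with hu
  have hup : u p = a := by simp [hu, ha]
  have hus : ContDiffAt ℝ ∞ u p :=
    (contDiffAt_chart_div hf p).comp (f := fun q : P => (p, q)) p (by fun_prop)
  have hdu : fderiv ℝ u p = mcForm f p := rfl
  have hcont : ContinuousAt (fun q => (f p)⁻¹ * f q) p :=
    (contMDiff_const.mul hf).continuous.continuousAt
  have hsrc : ∀ᶠ q in 𝓝 p, (f p)⁻¹ * f q ∈ (extChartAt 𝓘(ℝ, E) (1 : G)).source :=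
    hcont.eventually (by simpa using extChartAt_source_mem_nhds (I := 𝓘(ℝ, E)) (1 : G))
  -- the derivative of `u` is the left-invariant field given by the form
  have hd : fderiv ℝ u =ᶠ[𝓝 p] fun q => (chartLeftInv E G (u q)).comp (mcForm f q) := by
    filter_upwards [hsrc] with q hq
    have hqt : u q ∈ (extChartAt 𝓘(ℝ, E) (1 : G)).target :=
      (extChartAt 𝓘(ℝ, E) (1 : G)).map_source hq
    have h1 : HasFDerivAt (fun q' => chartMul E G
        (u q, extChartAt 𝓘(ℝ, E) (1 : G) ((f q)⁻¹ * f q')))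
        ((chartLeftInv E G (u q)).comp (mcForm f q)) q := by
      refine HasFDerivAt.comp (g := fun w => chartMul E G (u q, w)) q ?_ (hasFDerivAt_mcForm hf q)
      simpa using hasFDerivAt_chartLeftInv hqt
    have hsrc' : ∀ᶠ q' in 𝓝 q, (f q)⁻¹ * f q' ∈ (extChartAt 𝓘(ℝ, E) (1 : G)).source := by
      have : ContinuousAt (fun q' => (f q)⁻¹ * f q') q :=
        (contMDiff_const.mul hf).continuous.continuousAt
      exact this.eventually (by simpa using extChartAt_source_mem_nhds (I := 𝓘(ℝ, E)) (1 : G))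
    refine (h1.congr_of_eventuallyEq ?_).fderiv
    filter_upwards [hsrc'] with q' hq'
    simp only [chartMul, hu]
    rw [(extChartAt 𝓘(ℝ, E) (1 : G)).left_inv hq, (extChartAt 𝓘(ℝ, E) (1 : G)).left_inv hq']
    congr 1
    group
  have hmc : DifferentiableAt ℝ (mcForm (E := E) f) p :=
    ((contDiff_mcForm hf).differentiable (by simp)).differentiableAt
  have hX : HasFDerivAt (fun q => chartLeftInv E G (u q))
      ((fderiv ℝ (chartLeftInv E G) a).comp (mcForm f p)) p := by
    refine HasFDerivAt.comp p (g := chartLeftInv E G) ?_ (hasFDerivAt_mcForm hf p)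
    simpa only [hup] using
      ((contDiffAt_chartLeftInv (E := E) (G := G)).differentiableAt (by simp)).hasFDerivAt
  have hdd : ∀ v w : P, fderiv ℝ (fderiv ℝ u) p v w =
      fderiv ℝ (chartLeftInv E G) a (mcForm f p v) (mcForm f p w) +
        fderiv ℝ (fun q => mcForm (E := E) f q w) p v := by
    intro v w
    rw [hd.fderiv_eq, (hX.clm_comp hmc.hasFDerivAt).fderiv,
      fderiv_clm_apply hmc (differentiableAt_const w), hup]
    have hid : chartLeftInv E G a = ContinuousLinearMap.id ℝ E := chartLeftInv_one
    simp [hid, add_comm]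
  have hsymm : fderiv ℝ (fderiv ℝ u) p v w = fderiv ℝ (fderiv ℝ u) p w v :=
    (contDiffAt_infty.1 hus 2).isSymmSndFDerivAt (by simp) v w
  refine Eq.trans ?_ (modelBracket_eq_fderiv_chartLeftInv (G := G) (mcForm (E := E) f p w)
    (mcForm (E := E) f p v)).symm
  rw [hdd v w, hdd w v] at hsymm
  have h3 : ∀ x y z t : E, x + y = z + t → y - t = z - x := fun x y z t h => by
    rw [sub_eq_sub_iff_add_eq_add, add_comm y x, h, add_comm]
  exact h3 _ _ _ _ hsymm

/-- A smooth map from the Lie algebra to the group with the value and the derivative of the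
exponential map at `0`; the inverse of the chart at the identity, cut off to be globally smooth. -/
theorem exists_contMDiff_chart_exp [FiniteDimensional ℝ E] :
    ∃ e : E → G, ContMDiff 𝓘(ℝ, E) 𝓘(ℝ, E) ∞ e ∧ e 0 = 1 ∧
      HasFDerivAt (fun v => extChartAt 𝓘(ℝ, E) (1 : G) (e v)) (ContinuousLinearMap.id ℝ E) 0 := by
  set a := extChartAt 𝓘(ℝ, E) (1 : G) 1 with ha
  obtain ⟨r, hr, hrt⟩ := Metric.mem_nhds_iff.1 (extChartAt_target_mem_nhds (I := 𝓘(ℝ, E)) (1 : G))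
  let b : ContDiffBump (0 : E) := ⟨r / 2, r, half_pos hr, half_lt_self hr⟩
  have hbt : ∀ v, a + b v • v ∈ (extChartAt 𝓘(ℝ, E) (1 : G)).target := by
    refine fun v => hrt ?_
    rw [Metric.mem_ball, dist_self_add_left, norm_smul, Real.norm_of_nonneg b.nonneg]
    rcases lt_or_ge ‖v‖ r with hv | hv
    · exact (mul_le_of_le_one_left (norm_nonneg _) b.le_one).trans_lt hv
    · rw [b.zero_of_le_dist (by simpa using hv), zero_mul]; exact hr
  have hs : ContDiff ℝ ∞ fun v => a + b v • v :=
    contDiff_const.add (b.contDiff.smul contDiff_id)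
  refine ⟨fun v => (extChartAt 𝓘(ℝ, E) (1 : G)).symm (a + b v • v), fun v => ?_, ?_, ?_⟩
  · exact (contMDiffAt_extChartAt_one_symm (hbt v)).comp v hs.contMDiff.contMDiffAt
  · simp [ha]
  · have h1 : (fun v => extChartAt 𝓘(ℝ, E) (1 : G)
        ((extChartAt 𝓘(ℝ, E) (1 : G)).symm (a + b v • v))) =ᶠ[𝓝 0] fun v => a + v := by
      filter_upwards [b.eventuallyEq_one] with v hv
      rw [(extChartAt 𝓘(ℝ, E) (1 : G)).right_inv (hbt v), hv]
      simp
    exact ((hasFDerivAt_id (0 : E)).const_add a).congr_of_eventuallyEq h1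

end Bracket

/-! ### Smooth families in the map group -/

section Families

variable {E : Type*} [NormedAddCommGroup E] [NormedSpace ℝ E]
  {G : Type*} [TopologicalSpace G] [ChartedSpace E G] [Group G] [LieGroup 𝓘(ℝ, E) ∞ G]
  {bc : BoundaryCond} {F F' : Type*} [NormedAddCommGroup F] [NormedSpace ℝ F]
  [NormedAddCommGroup F'] [NormedSpace ℝ F']

namespace SmoothGroupFamily

variable {g h : F → mapGroup E G bc}

theorem comp (hg : SmoothGroupFamily g) {c : F' → F} (hc : ContDiff ℝ ∞ c) :
    SmoothGroupFamily (fun s => g (c s)) :=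
  ⟨hg.1.comp (f := fun z : F' × ℝ => (c z.1, z.2))
    (by fun_prop : ContDiff ℝ ∞ fun z : F' × ℝ => (c z.1, z.2)).contMDiff,
    hg.2.comp hc.continuous⟩

theorem mul (hg : SmoothGroupFamily g) (hh : SmoothGroupFamily h) :
    SmoothGroupFamily (fun s => g s * h s) :=
  ⟨hg.1.mul hh.1, hg.2.map₂ hh.2 (fun _ a b => a * b) (fun _ => mul_one 1)⟩

theorem inv (hg : SmoothGroupFamily g) : SmoothGroupFamily (fun s => (g s)⁻¹) :=
  ⟨hg.1.inv, hg.2.map₂ hg.2 (fun _ a _ => a⁻¹) (fun _ => inv_one)⟩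

theorem const (a : mapGroup E G bc) : SmoothGroupFamily (fun _ : F => a) :=
  ⟨a.2.1.comp contDiff_snd.contMDiff, a.2.2.holdsFamily⟩

theorem contMDiff_eval (hg : SmoothGroupFamily g) (x : ℝ) :
    ContMDiff 𝓘(ℝ, F) 𝓘(ℝ, E) ∞ (fun q => (g q : ℝ → G) x) :=
  hg.1.comp (f := fun q : F => (q, x)) (by fun_prop : ContDiff ℝ ∞ fun q : F => (q, x)).contMDiff

end SmoothGroupFamily

/-- The left trivialised derivative `g⁻¹ ∂g` at the parameter `p` and in the direction `v` of a
family in the map group, as an `E`-valued map of the space variable. -/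
def groupForm (g : F → mapGroup E G bc) (p v : F) : ℝ → E :=
  fun x => mcForm (fun q => (g q : ℝ → G) x) p v

theorem groupForm_add (g : F → mapGroup E G bc) (p v w : F) :
    groupForm g p (v + w) = fun x => groupForm g p v x + groupForm g p w x := by
  funext x; simp [groupForm]

theorem groupForm_smul (g : F → mapGroup E G bc) (p v : F) (r : ℝ) :
    groupForm g p (r • v) = fun x => r • groupForm g p v x := by
  funext x; simp [groupForm]

theorem groupForm_mul_left (a : mapGroup E G bc) (g : F → mapGroup E G bc) :
    groupForm (fun q => a * g q) = groupForm g := by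
  funext p v x
  exact congrFun (congrArg DFunLike.coe (congrFun
    (mcForm_mul_left ((a : ℝ → G) x) (fun q => (g q : ℝ → G) x)) p)) v

theorem SmoothGroupFamily.isSmoothFamily_groupForm {g : F → mapGroup E G bc}
    (hg : SmoothGroupFamily g) (v : F) : IsSmoothFamily bc (fun p => groupForm g p v) := by
  constructor
  · have h1 : (fun z : F × ℝ => groupForm g z.1 v z.2) = fun z : F × ℝ =>
        mcForm (E := E) (fun z : F × ℝ => (g z.1 : ℝ → G) z.2) z (v, 0) := by
      funext z
      have h := (hasFDerivAt_mcForm hg.1 z).comp (f := fun q : F => (q, z.2)) z.1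
        (hasFDerivAt_prodMk_left z.1 z.2)
      have h2 : groupForm g z.1 v z.2 = _ := congrArg (fun L : F →L[ℝ] E => L v) h.fderiv
      simpa using h2
    rw [h1]
    exact (contDiff_mcForm hg.1).clm_apply contDiff_const
  · have hb := hg.2
    cases bc with
    | periodic P hP =>
      intro p x
      have : (fun q => (g q : ℝ → G) (x + P)) = fun q => (g q : ℝ → G) x :=
        funext fun q => hb q x
      simp only [groupForm, this]
    | vanishing =>
      intro p
      obtain ⟨R, hR⟩ := hb p
      refine ⟨R, hR.eventually_nhds.mono fun q hq x hx => ?_⟩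
      have h1 : (fun q' => extChartAt 𝓘(ℝ, E) (1 : G) (((g q : ℝ → G) x)⁻¹ * (g q' : ℝ → G) x))
          =ᶠ[𝓝 q] fun _ => extChartAt 𝓘(ℝ, E) (1 : G) 1 := by
        filter_upwards [hq] with q' hq'
        have hqx : (g q : ℝ → G) x = 1 := hq.self_of_nhds x hx
        rw [hqx, hq' x hx, inv_one, one_mul]
      show fderiv ℝ _ q v = 0
      rw [h1.fderiv_eq]
      simp

/-- The velocity of a curve of members of a smooth family. -/
theorem SmoothGroupFamily.velocity_comp {g : F → mapGroup E G bc} (hg : SmoothGroupFamily g)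
    {c : ℝ → F} {c' : F} {t : ℝ} (hc : HasDerivAt c c' t) :
    velocity (fun τ => g (c τ)) t = groupForm g (c t) c' :=
  funext fun x => leftLogDeriv_comp (hg.contMDiff_eval x) hc

/-- The Maurer–Cartan equation in the map group. -/
theorem SmoothGroupFamily.fderiv_groupForm_sub {g : F → mapGroup E G bc}
    (hg : SmoothGroupFamily g) (p v w : F) (x : ℝ) :
    fderiv ℝ (fun q => groupForm g q w x) p v - fderiv ℝ (fun q => groupForm g q v x) p w =
      modelBracket E G (groupForm g p w x) (groupForm g p v x) :=
  fderiv_mcForm_sub (hg.contMDiff_eval x) p v w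

/-- Composition with a map `e` as in `exists_contMDiff_chart_exp` turns smooth families in the Lie
algebra into smooth families in the group. -/
theorem exists_smoothGroupFamily_of_contMDiff {e : E → G} (he : ContMDiff 𝓘(ℝ, E) 𝓘(ℝ, E) ∞ e)
    (he0 : e 0 = 1) {ξ : F → ℝ → E} (hξ : IsSmoothFamily bc ξ) :
    ∃ g : F → mapGroup E G bc, SmoothGroupFamily g ∧
      ∀ p x, (g p : ℝ → G) x = e (ξ p x) := by
  have hb : bc.HoldsFamily (1 : G) (fun p x => e (ξ p x)) :=
    hξ.2.map₂ hξ.2 (fun _ v _ => e v) (fun _ => he0)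
  refine ⟨fun p => ⟨fun x => e (ξ p x), he.comp (hξ.mem p).1.contMDiff, hb.holds p⟩,
    ⟨he.comp hξ.1.contMDiff, hb⟩, fun p x => rfl⟩

/-- Since `e` has the derivative of the exponential map at `0`, the velocities of the family `e ∘ ξ`
at a parameter where it passes through the identity are those of `ξ`. -/
theorem groupForm_of_eq_comp {e : E → G} (he0 : e 0 = 1)
    (he' : HasFDerivAt (fun v => extChartAt 𝓘(ℝ, E) (1 : G) (e v)) (ContinuousLinearMap.id ℝ E) 0)
    {ξ : F → ℝ → E} (hξ : IsSmoothFamily bc ξ) {g : F → mapGroup E G bc}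
    (hg : ∀ p x, (g p : ℝ → G) x = e (ξ p x)) {p : F} (hp : ξ p = 0) (v : F) :
    groupForm g p v = fun x => fderiv ℝ (fun q => ξ q x) p v := by
  funext x
  have hpx : ξ p x = 0 := congrFun hp x
  have h1 : (fun q => extChartAt 𝓘(ℝ, E) (1 : G) (((g p : ℝ → G) x)⁻¹ * (g q : ℝ → G) x)) =
      fun q => extChartAt 𝓘(ℝ, E) (1 : G) (e (ξ q x)) := by
    funext q
    rw [hg, hg, hpx, he0, inv_one, one_mul]
  rw [← hpx] at he'
  have h2 := he'.comp p ((hξ.differentiable x).differentiableAt (x := p)).hasFDerivAt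
  show fderiv ℝ _ p v = _
  rw [h1]
  have h3 := h2.fderiv
  simp only [Function.comp_def, ContinuousLinearMap.id_comp] at h3
  rw [h3]

end Families

/-! ### Mixed second derivatives -/

section Mixed

variable {X : Type*} [NormedAddCommGroup X] [NormedSpace ℝ X]

/-- The mixed second derivative at the origin. -/
def mixedDeriv (k : ℝ × ℝ → ℝ) : ℝ :=
  deriv (fun σ : ℝ => deriv (fun τ : ℝ => k (σ, τ)) 0) 0

/-- Mixed second derivatives along a plane are values of the second derivative. -/
theorem mixedDeriv_comp_line {K : X → ℝ} {z : X} (hK : ContDiffAt ℝ 2 K z) (a b : X) :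
    mixedDeriv (fun s => K (z + s.1 • a + s.2 • b)) = fderiv ℝ (fderiv ℝ K) z a b := by
  have hev : ∀ᶠ y in 𝓝 z, DifferentiableAt ℝ K y :=
    (hK.eventually (by simp)).mono fun y hy => hy.differentiableAt (by simp)
  have hline : HasDerivAt (fun σ : ℝ => z + σ • a) a 0 := by
    simpa using ((hasDerivAt_id (0 : ℝ)).smul_const a).const_add z
  have h1 : (fun σ : ℝ => deriv (fun τ : ℝ => K (z + σ • a + τ • b)) 0) =ᶠ[𝓝 0]
      fun σ => fderiv ℝ K (z + σ • a) b := by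
    have : ∀ᶠ σ in 𝓝 (0 : ℝ), DifferentiableAt ℝ K (z + σ • a) := by
      refine hline.continuousAt.eventually ?_
      simpa using hev
    filter_upwards [this] with σ hσ
    have h2 : HasDerivAt (fun τ : ℝ => z + σ • a + τ • b) b 0 := by
      simpa using ((hasDerivAt_id (0 : ℝ)).smul_const b).const_add (z + σ • a)
    exact (hσ.hasFDerivAt.comp_hasDerivAt_of_eq (0 : ℝ) h2 (by simp)).deriv
  have h3 : DifferentiableAt ℝ (fderiv ℝ K) z :=
    (hK.fderiv_right (m := 1) (by norm_num)).differentiableAt (by simp)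
  have h4 := h3.hasFDerivAt.comp_hasDerivAt_of_eq (0 : ℝ) hline (by simp)
  have h5 := h4.clm_apply (hasDerivAt_const (0 : ℝ) b)
  rw [mixedDeriv, h1.deriv_eq]
  simpa using h5.deriv

theorem mixedDeriv_eq_fderiv {k : ℝ × ℝ → ℝ} (hk : ContDiffAt ℝ 2 k 0) :
    mixedDeriv k = fderiv ℝ (fderiv ℝ k) 0 (1, 0) (0, 1) := by
  rw [← mixedDeriv_comp_line hk]
  simp

theorem mixedDeriv_congr {k k' : ℝ × ℝ → ℝ} (h : k =ᶠ[𝓝 0] k') : mixedDeriv k = mixedDeriv k' := by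
  have h1 : ∀ᶠ σ : ℝ in 𝓝 0, ∀ᶠ τ : ℝ in 𝓝 0, k (σ, τ) = k' (σ, τ) := by
    have : ∀ᶠ z in 𝓝 (0 : ℝ) ×ˢ 𝓝 (0 : ℝ), k z = k' z := by
      rw [← nhds_prod_eq]; exact h
    exact this.curry
  refine EventuallyEq.deriv_eq ?_
  filter_upwards [h1] with σ hσ
  exact EventuallyEq.deriv_eq hσ

theorem mixedDeriv_add {k k' : ℝ × ℝ → ℝ} (hk : ContDiffAt ℝ 2 k 0) (hk' : ContDiffAt ℝ 2 k' 0) :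
    mixedDeriv (fun z => k z + k' z) = mixedDeriv k + mixedDeriv k' := by
  have hd : ∀ {k : ℝ × ℝ → ℝ}, ContDiffAt ℝ 2 k 0 → ∀ᶠ z in 𝓝 0, DifferentiableAt ℝ k z :=
    fun hk => (hk.eventually (by simp)).mono fun y hy => hy.differentiableAt (by simp)
  have hdd : ∀ {k : ℝ × ℝ → ℝ}, ContDiffAt ℝ 2 k 0 → DifferentiableAt ℝ (fderiv ℝ k) 0 :=
    fun hk => (hk.fderiv_right (m := 1) (by norm_num)).differentiableAt (by simp)
  rw [mixedDeriv_eq_fderiv (hk.add hk'), mixedDeriv_eq_fderiv hk, mixedDeriv_eq_fderiv hk']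
  have h1 : fderiv ℝ (fun z => k z + k' z) =ᶠ[𝓝 0] fun z => fderiv ℝ k z + fderiv ℝ k' z := by
    filter_upwards [hd hk, hd hk'] with z h1 h2
    exact fderiv_add h1 h2
  rw [h1.fderiv_eq, fderiv_fun_add (hdd hk) (hdd hk')]
  simp

theorem mixedDeriv_neg (k : ℝ × ℝ → ℝ) : mixedDeriv (fun z => -k z) = -mixedDeriv k := by
  simp only [mixedDeriv, deriv.fun_neg]

theorem mixedDeriv_sub {k k' : ℝ × ℝ → ℝ} (hk : ContDiffAt ℝ 2 k 0) (hk' : ContDiffAt ℝ 2 k' 0) :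
    mixedDeriv (fun z => k z - k' z) = mixedDeriv k - mixedDeriv k' := by
  simp only [sub_eq_add_neg]
  rw [mixedDeriv_add hk hk'.neg, mixedDeriv_neg]

theorem mixedDeriv_fst (f : ℝ → ℝ) : mixedDeriv (fun z => f z.1) = 0 := by
  simp [mixedDeriv]

theorem mixedDeriv_snd (f : ℝ → ℝ) : mixedDeriv (fun z => f z.2) = 0 := by
  simp [mixedDeriv]

theorem mixedDeriv_swap {k : ℝ × ℝ → ℝ} (hk : ContDiffAt ℝ 2 k 0) :
    mixedDeriv (fun z => k (z.2, z.1)) = mixedDeriv k := by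
  have h1 := mixedDeriv_comp_line hk (0, 1) (1, 0)
  have h2 := mixedDeriv_eq_fderiv hk
  rw [h2, hk.isSymmSndFDerivAt (by simp), ← h1]
  simp

end Mixed

/-! ### The group cocycle and its Lie algebra cocycle -/

section Cocycle

variable {E : Type*} [NormedAddCommGroup E] [NormedSpace ℝ E]
  {G : Type*} [TopologicalSpace G] [ChartedSpace E G] [Group G] [LieGroup 𝓘(ℝ, E) ∞ G]
  {bc : BoundaryCond} {F F' : Type*} [NormedAddCommGroup F] [NormedSpace ℝ F]
  [FiniteDimensional ℝ F]
  {W : Set (mapGroup E G bc)} {B : mapGroup E G bc → mapGroup E G bc → ℝ}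

namespace IsCocycleOn

theorem eventually_mem (hB : IsCocycleOn W B) {g : F → mapGroup E G bc} (hg : SmoothGroupFamily g)
    {p : F} (hp : g p ∈ W) : ∀ᶠ q in 𝓝 p, g q ∈ W := by
  let e := (Module.finBasis ℝ F).equivFunL
  have h := (hB.isOpen _ _ (hg.comp (c := e.symm) e.symm.contDiff)).preimage e.continuous
  have h2 : IsOpen {q | g q ∈ W} := by simpa using h
  exact h2.mem_nhds hp

theorem contDiffAt (hB : IsCocycleOn W B) {g h : F → mapGroup E G bc} (hg : SmoothGroupFamily g)
    (hh : SmoothGroupFamily h) {p : F} (hgp : g p ∈ W) (hhp : h p ∈ W) (hghp : g p * h p ∈ W) :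
    ContDiffAt ℝ ∞ (fun q => B (g q) (h q)) p := by
  let e := (Module.finBasis ℝ F).equivFunL
  have h1 := hB.smooth _ _ _ (hg.comp (c := e.symm) e.symm.contDiff)
    (hh.comp (c := e.symm) e.symm.contDiff) (e p) (by simpa using hgp) (by simpa using hhp)
    (by simpa using hghp)
  have h2 := h1.comp p e.contDiff.contDiffAt
  simpa [Function.comp_def] using h2

theorem contDiffAt_two (hB : IsCocycleOn W B) {g h : F → mapGroup E G bc}
    (hg : SmoothGroupFamily g) (hh : SmoothGroupFamily h) {p : F} (hgp : g p ∈ W) (hhp : h p ∈ W)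
    (hghp : g p * h p ∈ W) : ContDiffAt ℝ 2 (fun q => B (g q) (h q)) p :=
  contDiffAt_infty.1 (hB.contDiffAt hg hh hgp hhp hghp) 2

theorem one_left (hB : IsCocycleOn W B) {k : mapGroup E G bc} (hk : k ∈ W) : B 1 k = 0 := by
  have h := hB.cocycle 1 1 k hB.one_mem hB.one_mem hk (by simpa using hB.one_mem)
    (by simpa using hk) (by simpa using hk)
  simp only [one_mul, hB.map_one_one] at h
  linarith

/-- To second order at the identity, inverting the first argument of the cocycle changes its
sign. -/
theorem mixedDeriv_inv (hB : IsCocycleOn W B) {u k : ℝ → mapGroup E G bc}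
    (hu : SmoothGroupFamily u) (hk : SmoothGroupFamily k) (hu0 : u 0 = 1) (hk0 : k 0 = 1) :
    mixedDeriv (fun z => B (u z.1)⁻¹ (k z.2)) = -mixedDeriv (fun z => B (u z.1) (k z.2)) := by
  have hu1 : SmoothGroupFamily fun z : ℝ × ℝ => u z.1 := hu.comp contDiff_fst
  have hk2 : SmoothGroupFamily fun z : ℝ × ℝ => k z.2 := hk.comp contDiff_snd
  have h1 : (1 : mapGroup E G bc) ∈ W := hB.one_mem
  -- the three-parameter family whose diagonal appears in the cocycle identity for `(u, u⁻¹, k)`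
  have hK : ContDiffAt ℝ 2 (fun y : ℝ × ℝ × ℝ => B (u y.1) ((u y.2.1)⁻¹ * k y.2.2)) 0 := by
    refine hB.contDiffAt_two (hu.comp contDiff_fst)
      ((hu.comp (c := fun y : ℝ × ℝ × ℝ => y.2.1) (by fun_prop)).inv.mul
        (hk.comp (c := fun y : ℝ × ℝ × ℝ => y.2.2) (by fun_prop))) ?_ ?_ ?_ <;>
    simpa [hu0, hk0] using h1
  have hdiag := mixedDeriv_comp_line hK (1, 1, 0) (0, 0, 1)
  have hA := mixedDeriv_comp_line hK (1, 0, 0) (0, 0, 1)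
  have hC := mixedDeriv_comp_line hK (0, 1, 0) (0, 0, 1)
  have hsplit : ((1, 1, 0) : ℝ × ℝ × ℝ) = (1, 0, 0) + (0, 1, 0) := by simp
  rw [hsplit, map_add, add_apply, ← hA, ← hC] at hdiag
  simp only [Prod.smul_mk, smul_eq_mul, mul_one, mul_zero, zero_add, Prod.mk_add_mk, add_zero,
    hu0, inv_one, one_mul] at hdiag
  have hmem1 : ∀ᶠ z : ℝ × ℝ in 𝓝 0, u z.1 ∈ W :=
    hB.eventually_mem hu1 (p := (0 : ℝ × ℝ)) (by simpa [hu0] using h1)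
  have hmem2 : ∀ᶠ z : ℝ × ℝ in 𝓝 0, k z.2 ∈ W :=
    hB.eventually_mem hk2 (p := (0 : ℝ × ℝ)) (by simpa [hk0] using h1)
  have hmem3 : ∀ᶠ z : ℝ × ℝ in 𝓝 0, (u z.1)⁻¹ ∈ W :=
    hB.eventually_mem hu1.inv (p := (0 : ℝ × ℝ)) (by simpa [hu0] using h1)
  have hmem4 : ∀ᶠ z : ℝ × ℝ in 𝓝 0, (u z.1)⁻¹ * k z.2 ∈ W :=
    hB.eventually_mem (hu1.inv.mul hk2) (p := (0 : ℝ × ℝ)) (by simpa [hu0, hk0] using h1)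
  have hC0 : mixedDeriv (fun z => B 1 ((u z.1)⁻¹ * k z.2)) = 0 := by
    rw [mixedDeriv_congr (k' := fun _ => 0), mixedDeriv_fst (fun _ => 0)]
    filter_upwards [hmem4] with z hz
    exact hB.one_left hz
  rw [hC0, add_zero] at hdiag
  have hdec : (fun z : ℝ × ℝ => B (u z.1)⁻¹ (k z.2)) =ᶠ[𝓝 0]
      fun z => B (u z.1) (u z.1)⁻¹ - B (u z.1) ((u z.1)⁻¹ * k z.2) := by
    filter_upwards [hmem1, hmem2, hmem3, hmem4] with z z1 z2 z3 z4
    have := hB.cocycle (u z.1) (u z.1)⁻¹ (k z.2) z1 z3 z2 (by simpa using h1) z4 (by simpa using z2)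
    rw [mul_inv_cancel, hB.one_left z2] at this
    linarith
  rw [mixedDeriv_congr hdec, mixedDeriv_sub, mixedDeriv_fst (fun σ => B (u σ) (u σ)⁻¹), zero_sub,
    hdiag]
  · exact hB.contDiffAt_two hu1 hu1.inv (by simpa [hu0] using h1) (by simpa [hu0] using h1)
      (by simpa [hu0] using h1)
  · exact hB.contDiffAt_two hu1 (hu1.inv.mul hk2) (by simpa [hu0] using h1)
      (by simpa [hu0, hk0] using h1) (by simpa [hu0, hk0] using h1)

/-- The cocycle identity moves the second order terms of `B (g(p)⁻¹, g(q))` near the diagonal to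
the identity of the group. -/
theorem mixedDeriv_translate (hB : IsCocycleOn W B) (a : mapGroup E G bc) (ha : a ∈ W)
    (ha' : a⁻¹ ∈ W) {u k : ℝ → mapGroup E G bc} (hu : SmoothGroupFamily u)
    (hk : SmoothGroupFamily k) (hu0 : u 0 = 1) (hk0 : k 0 = 1) :
    mixedDeriv (fun z => B (a * u z.1)⁻¹ (a * k z.2)) =
      mixedDeriv (fun z => B (u z.1)⁻¹ (k z.2)) := by
  have hu1 : SmoothGroupFamily fun z : ℝ × ℝ => u z.1 := hu.comp contDiff_fst
  have hk2 : SmoothGroupFamily fun z : ℝ × ℝ => k z.2 := hk.comp contDiff_snd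
  have hac : SmoothGroupFamily fun _ : ℝ × ℝ => a := .const a
  have h1 : (1 : mapGroup E G bc) ∈ W := hB.one_mem
  have hmem1 : ∀ᶠ z : ℝ × ℝ in 𝓝 0, (u z.1)⁻¹ ∈ W :=
    hB.eventually_mem hu1.inv (p := (0 : ℝ × ℝ)) (by simpa [hu0] using h1)
  have hmem2 : ∀ᶠ z : ℝ × ℝ in 𝓝 0, a * k z.2 ∈ W :=
    hB.eventually_mem (hac.mul hk2) (p := (0 : ℝ × ℝ)) (by simpa [hk0] using ha)
  have hmem3 : ∀ᶠ z : ℝ × ℝ in 𝓝 0, (u z.1)⁻¹ * a⁻¹ ∈ W :=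
    hB.eventually_mem (hu1.inv.mul hac.inv) (p := (0 : ℝ × ℝ)) (by simpa [hu0] using ha')
  have hmem4 : ∀ᶠ z : ℝ × ℝ in 𝓝 0, k z.2 ∈ W :=
    hB.eventually_mem hk2 (p := (0 : ℝ × ℝ)) (by simpa [hk0] using h1)
  have hmem5 : ∀ᶠ z : ℝ × ℝ in 𝓝 0, (u z.1)⁻¹ * k z.2 ∈ W :=
    hB.eventually_mem (hu1.inv.mul hk2) (p := (0 : ℝ × ℝ)) (by simpa [hu0, hk0] using h1)
  have hdec : (fun z : ℝ × ℝ => B (a * u z.1)⁻¹ (a * k z.2)) =ᶠ[𝓝 0]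
      fun z => (B a⁻¹ (a * k z.2) - B (u z.1)⁻¹ a⁻¹) + B (u z.1)⁻¹ (k z.2) := by
    filter_upwards [hmem1, hmem2, hmem3, hmem4, hmem5] with z z1 z2 z3 z4 z5
    have := hB.cocycle (u z.1)⁻¹ a⁻¹ (a * k z.2) z1 ha' z2 z3 (by simpa using z4)
      (by simpa [mul_assoc] using z5)
    rw [inv_mul_cancel_left, ← mul_inv_rev] at this
    linarith
  have c1 : ContDiffAt ℝ 2 (fun z : ℝ × ℝ => B a⁻¹ (a * k z.2)) 0 :=
    hB.contDiffAt_two hac.inv (hac.mul hk2) ha' (by simpa [hk0] using ha) (by simpa [hk0] using h1)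
  have c2 : ContDiffAt ℝ 2 (fun z : ℝ × ℝ => B (u z.1)⁻¹ a⁻¹) 0 :=
    hB.contDiffAt_two hu1.inv hac.inv (by simpa [hu0] using h1) ha' (by simpa [hu0] using ha')
  have c3 : ContDiffAt ℝ 2 (fun z : ℝ × ℝ => B (u z.1)⁻¹ (k z.2)) 0 :=
    hB.contDiffAt_two hu1.inv hk2 (by simpa [hu0] using h1) (by simpa [hk0] using h1)
      (by simpa [hu0, hk0] using h1)
  rw [mixedDeriv_congr hdec, mixedDeriv_add (c1.sub c2) c3, mixedDeriv_sub c1 c2,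
    mixedDeriv_snd (fun τ => B a⁻¹ (a * k τ)), mixedDeriv_fst (fun σ => B (u σ)⁻¹ a⁻¹)]
  ring

end IsCocycleOn

/-- The Lie algebra cocycle is the antisymmetrised mixed derivative of the group cocycle. -/
theorem IsLieCocycleOf.eq_mixedDeriv {c : (ℝ → GroupLieAlgebra 𝓘(ℝ, E) G) →
    (ℝ → GroupLieAlgebra 𝓘(ℝ, E) G) → ℝ} (hc : IsLieCocycleOf B c) {g h : ℝ → mapGroup E G bc}
    (hg : SmoothGroupFamily g) (hh : SmoothGroupFamily h) (hg0 : g 0 = 1) (hh0 : h 0 = 1) :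
    c (velocity g 0) (velocity h 0) =
      mixedDeriv (fun z => B (g z.1) (h z.2) - B (h z.2) (g z.1)) :=
  hc g h hg hh hg0 hh0

theorem IsLieCocycleOf.eq_sub_mixedDeriv (hB : IsCocycleOn W B)
    {c : (ℝ → GroupLieAlgebra 𝓘(ℝ, E) G) → (ℝ → GroupLieAlgebra 𝓘(ℝ, E) G) → ℝ}
    (hc : IsLieCocycleOf B c) {g h : ℝ → mapGroup E G bc} (hg : SmoothGroupFamily g)
    (hh : SmoothGroupFamily h) (hg0 : g 0 = 1) (hh0 : h 0 = 1) :
    c (velocity g 0) (velocity h 0) =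
      mixedDeriv (fun z => B (g z.1) (h z.2)) - mixedDeriv (fun z => B (h z.1) (g z.2)) := by
  have hg1 : SmoothGroupFamily fun z : ℝ × ℝ => g z.1 := hg.comp contDiff_fst
  have hg2 : SmoothGroupFamily fun z : ℝ × ℝ => g z.2 := hg.comp contDiff_snd
  have hh1 : SmoothGroupFamily fun z : ℝ × ℝ => h z.1 := hh.comp contDiff_fst
  have hh2 : SmoothGroupFamily fun z : ℝ × ℝ => h z.2 := hh.comp contDiff_snd
  have h1 : (1 : mapGroup E G bc) ∈ W := hB.one_mem
  rw [hc.eq_mixedDeriv hg hh hg0 hh0, mixedDeriv_sub]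
  · congr 1
    refine mixedDeriv_swap (k := fun z => B (h z.1) (g z.2)) ?_
    exact hB.contDiffAt_two hh1 hg2 (by simpa [hh0] using h1) (by simpa [hg0] using h1)
      (by simpa [hg0, hh0] using h1)
  · exact hB.contDiffAt_two hg1 hh2 (by simpa [hg0] using h1) (by simpa [hh0] using h1)
      (by simpa [hg0, hh0] using h1)
  · exact hB.contDiffAt_two hh2 hg1 (by simpa [hh0] using h1) (by simpa [hg0] using h1)
      (by simpa [hg0, hh0] using h1)

/-! ### The central component of the left trivialised derivative -/

/-- The central component of the left trivialised derivative `γ⁻¹ ∂γ` of a family in the central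
extension. -/
def centralForm (B : mapGroup E G bc → mapGroup E G bc → ℝ) (γ : F → mapGroup E G bc × ℝ) (p : F) :
    F →L[ℝ] ℝ :=
  fderiv ℝ (fun q => (extMul B (extInv B (γ p)) (γ q)).2) p

variable {γ : F → mapGroup E G bc × ℝ}

theorem SmoothExtFamily.contDiffAt_extMul_extInv (hB : IsCocycleOn W B) (hγ : SmoothExtFamily γ)
    {p : F} (hp : (γ p).1 ∈ W) (hp' : (γ p).1⁻¹ ∈ W) :
    ContDiffAt ℝ ∞ (fun z : F × F => (extMul B (extInv B (γ z.1)) (γ z.2)).2) (p, p) := by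
  have h1 : SmoothGroupFamily fun z : F × F => (γ z.1).1 := hγ.1.comp contDiff_fst
  have h2 : SmoothGroupFamily fun z : F × F => (γ z.2).1 := hγ.1.comp contDiff_snd
  have b1 : ContDiffAt ℝ ∞ (fun z : F × F => B (γ z.1).1⁻¹ (γ z.1).1) (p, p) :=
    hB.contDiffAt h1.inv h1 hp' hp (by simpa using hB.one_mem)
  have b2 : ContDiffAt ℝ ∞ (fun z : F × F => B (γ z.1).1⁻¹ (γ z.2).1) (p, p) :=
    hB.contDiffAt h1.inv h2 hp' hp (by simpa using hB.one_mem)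
  have s1 : ContDiffAt ℝ ∞ (fun z : F × F => (γ z.1).2) (p, p) :=
    (hγ.2.comp contDiff_fst).contDiffAt
  have s2 : ContDiffAt ℝ ∞ (fun z : F × F => (γ z.2).2) (p, p) :=
    (hγ.2.comp contDiff_snd).contDiffAt
  exact ((s1.neg.sub b1).add s2).add b2

theorem SmoothExtFamily.eventually_mem (hB : IsCocycleOn W B) (hγ : SmoothExtFamily γ)
    {p : F} (hp : (γ p).1 ∈ W) (hp' : (γ p).1⁻¹ ∈ W) :
    ∀ᶠ q in 𝓝 p, (γ q).1 ∈ W ∧ (γ q).1⁻¹ ∈ W :=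
  (hB.eventually_mem hγ.1 hp).and (hB.eventually_mem hγ.1.inv hp')

theorem SmoothExtFamily.contDiffAt_centralForm (hB : IsCocycleOn W B) (hγ : SmoothExtFamily γ)
    {p : F} (hp : (γ p).1 ∈ W) (hp' : (γ p).1⁻¹ ∈ W) :
    ContDiffAt ℝ ∞ (centralForm B γ) p :=
  ContDiffAt.fderiv (f := fun p q => (extMul B (extInv B (γ p)) (γ q)).2) (g := fun p => p)
    (hγ.contDiffAt_extMul_extInv hB hp hp') contDiffAt_id (by simp)

theorem SmoothExtFamily.centralVelocity_comp (hB : IsCocycleOn W B) (hγ : SmoothExtFamily γ)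
    {c : ℝ → F} {c' : F} {t : ℝ} (hc : HasDerivAt c c' t) (hp : (γ (c t)).1 ∈ W)
    (hp' : (γ (c t)).1⁻¹ ∈ W) :
    centralVelocity B (fun τ => γ (c τ)) t = centralForm B γ (c t) c' := by
  have h := (hγ.contDiffAt_extMul_extInv hB hp hp').comp (f := fun q : F => (c t, q)) (c t)
    (by fun_prop)
  exact ((h.differentiableAt (by simp)).hasFDerivAt.comp_hasDerivAt t hc).deriv

/-- The structure equation of the central component: its exterior derivative is given by the Lie
algebra cocycle. -/
theorem SmoothExtFamily.fderiv_centralForm_sub (hB : IsCocycleOn W B)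
    {c : (ℝ → GroupLieAlgebra 𝓘(ℝ, E) G) → (ℝ → GroupLieAlgebra 𝓘(ℝ, E) G) → ℝ}
    (hc : IsLieCocycleOf B c) (hγ : SmoothExtFamily γ) {p : F} (hp : (γ p).1 ∈ W)
    (hp' : (γ p).1⁻¹ ∈ W) (v w : F) :
    fderiv ℝ (fun q => centralForm B γ q w) p v - fderiv ℝ (fun q => centralForm B γ q v) p w =
      c (groupForm (E := E) (fun q => (γ q).1) p w)
        (groupForm (E := E) (fun q => (γ q).1) p v) := by
  set K : F × F → ℝ := fun z => (extMul B (extInv B (γ z.1)) (γ z.2)).2 with hKdef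
  have hK : ContDiffAt ℝ 2 K (p, p) :=
    contDiffAt_infty.1 (hγ.contDiffAt_extMul_extInv hB hp hp') 2
  have hKd : DifferentiableAt ℝ (fderiv ℝ K) (p, p) :=
    (hK.fderiv_right (m := 1) (by norm_num)).differentiableAt (by simp)
  have hdiag : HasFDerivAt (fun q : F => (q, q))
      ((ContinuousLinearMap.id ℝ F).prod (ContinuousLinearMap.id ℝ F)) p :=
    (hasFDerivAt_id p).prodMk (hasFDerivAt_id p)
  have h1 : ∀ v w : F, fderiv ℝ (fun q => centralForm B γ q w) p v =
      fderiv ℝ (fderiv ℝ K) (p, p) (v, v) (0, w) := by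
    intro v w
    have hev : (fun q => centralForm B γ q w) =ᶠ[𝓝 p] fun q => fderiv ℝ K (q, q) (0, w) := by
      have : ∀ᶠ q in 𝓝 p, ContDiffAt ℝ 2 K (q, q) :=
        (by fun_prop : ContinuousAt (fun q : F => (q, q)) p).eventually (hK.eventually (by simp))
      filter_upwards [this] with q hq
      have h2 := (hq.differentiableAt (by simp)).hasFDerivAt.comp (f := fun q' : F => (q, q')) q
        (hasFDerivAt_prodMk_right q q)
      have h3 : centralForm B γ q w = _ := congrArg (fun L : F →L[ℝ] ℝ => L w) h2.fderiv
      simpa using h3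
    have h4 := (hKd.hasFDerivAt.comp (f := fun q : F => (q, q)) p hdiag).clm_apply
      (hasFDerivAt_const ((0 : F), w) p)
    rw [hev.fderiv_eq]
    have h5 := congrArg (fun L : F →L[ℝ] ℝ => L v) h4.fderiv
    simpa using h5
  have hsymm : ∀ a b : F × F,
      fderiv ℝ (fderiv ℝ K) (p, p) a b = fderiv ℝ (fderiv ℝ K) (p, p) b a :=
    hK.isSymmSndFDerivAt (by simp)
  -- the terms with both directions in the second variable are symmetric and drop out at the end
  have hadd : ∀ v w : F, fderiv ℝ (fderiv ℝ K) (p, p) (v, v) (0, w) =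
      fderiv ℝ (fderiv ℝ K) (p, p) (v, 0) (0, w) + fderiv ℝ (fderiv ℝ K) (p, p) (0, v) (0, w) := by
    intro v w
    rw [← add_apply, ← map_add]
    simp
  -- the curves `g(p)⁻¹ g(p + σ v)` through the identity
  set a := (γ p).1 with ha
  let u : F → ℝ → mapGroup E G bc := fun v σ => a⁻¹ * (γ (p + σ • v)).1
  have hline : ∀ v : F, HasDerivAt (fun σ : ℝ => p + σ • v) v 0 := fun v => by
    simpa using ((hasDerivAt_id (0 : ℝ)).smul_const v).const_add p
  have hu : ∀ v, SmoothGroupFamily (u v) := fun v =>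
    (SmoothGroupFamily.const a⁻¹).mul (hγ.1.comp (c := fun σ : ℝ => p + σ • v) (by fun_prop))
  have hu0 : ∀ v, u v 0 = 1 := fun v => by simp [u, ha]
  have hvel : ∀ v, velocity (u v) 0 = groupForm (fun q => (γ q).1) p v := by
    intro v
    have h2 := ((SmoothGroupFamily.const a⁻¹).mul hγ.1).velocity_comp (hline v)
    rw [groupForm_mul_left] at h2
    simpa using h2
  have hau : ∀ v σ, a * u v σ = (γ (p + σ • v)).1 := fun v σ => by simp [u]
  -- up to functions of one variable, `K` along `(v, w)` is `B (g(p + σ v)⁻¹, g(p + τ w))`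
  have hmix : ∀ v w : F, fderiv ℝ (fderiv ℝ K) (p, p) (v, 0) (0, w) =
      -mixedDeriv (fun z => B (u v z.1) (u w z.2)) := by
    intro v w
    rw [← hB.mixedDeriv_inv (hu v) (hu w) (hu0 v) (hu0 w),
      ← hB.mixedDeriv_translate a hp hp' (hu v) (hu w) (hu0 v) (hu0 w),
      ← mixedDeriv_comp_line hK]
    simp only [hau]
    have hB2 : ContDiffAt ℝ 2
        (fun z : ℝ × ℝ => B (γ (p + z.1 • v)).1⁻¹ (γ (p + z.2 • w)).1) 0 := by
      refine hB.contDiffAt_two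
        (hγ.1.comp (c := fun z : ℝ × ℝ => p + z.1 • v) (by fun_prop)).inv
        (hγ.1.comp (c := fun z : ℝ × ℝ => p + z.2 • w) (by fun_prop)) ?_ ?_ ?_
      · simpa using hp'
      · simpa using hp
      · simpa using hB.one_mem
    have hs1 : ContDiffAt ℝ 2
        (fun z : ℝ × ℝ => (extInv B (γ (p + z.1 • v))).2) 0 := by
      have h2 : SmoothGroupFamily fun z : ℝ × ℝ => (γ (p + z.1 • v)).1 :=
        hγ.1.comp (c := fun z : ℝ × ℝ => p + z.1 • v) (by fun_prop)
      have h3 : ContDiff ℝ ∞ fun z : ℝ × ℝ => (γ (p + z.1 • v)).2 :=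
        hγ.2.comp (by fun_prop : ContDiff ℝ ∞ fun z : ℝ × ℝ => p + z.1 • v)
      refine (contDiffAt_infty.1 h3.contDiffAt 2).neg.sub (hB.contDiffAt_two h2.inv h2 ?_ ?_ ?_)
      · simpa using hp'
      · simpa using hp
      · simpa using hB.one_mem
    have hs2 : ContDiffAt ℝ 2 (fun z : ℝ × ℝ => (γ (p + z.2 • w)).2) 0 :=
      contDiffAt_infty.1 (hγ.2.comp (by fun_prop : ContDiff ℝ ∞
        fun z : ℝ × ℝ => p + z.2 • w)).contDiffAt 2
    have hKe : (fun s : ℝ × ℝ => K ((p, p) + s.1 • (v, (0 : F)) + s.2 • ((0 : F), w))) =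
        fun s => ((extInv B (γ (p + s.1 • v))).2 + (γ (p + s.2 • w)).2) +
          B (γ (p + s.1 • v)).1⁻¹ (γ (p + s.2 • w)).1 := by
      funext s
      simp [hKdef, extMul, extInv]
    rw [hKe, mixedDeriv_add (hs1.add hs2) hB2, mixedDeriv_add hs1 hs2,
      mixedDeriv_fst (fun σ => (extInv B (γ (p + σ • v))).2),
      mixedDeriv_snd (fun τ => (γ (p + τ • w)).2)]
    ring
  rw [h1, h1, hadd v w, hadd w v, hsymm (0, w) (0, v), hmix, hmix]
  have h6 := hc.eq_sub_mixedDeriv hB (hu w) (hu v) (hu0 w) (hu0 v)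
  rw [hvel, hvel] at h6
  rw [h6]
  ring

end Cocycle

/-! ### Velocities of curves and variations -/

section LieCocycle

variable {E : Type*} [NormedAddCommGroup E] [NormedSpace ℝ E] [FiniteDimensional ℝ E]
  {G : Type*} [TopologicalSpace G] [ChartedSpace E G] [Group G] [LieGroup 𝓘(ℝ, E) ∞ G]
  {bc : BoundaryCond} {F : Type*} [NormedAddCommGroup F] [NormedSpace ℝ F]
  {W : Set (mapGroup E G bc)} {B : mapGroup E G bc → mapGroup E G bc → ℝ}
  {c : (ℝ → GroupLieAlgebra 𝓘(ℝ, E) G) → (ℝ → GroupLieAlgebra 𝓘(ℝ, E) G) → ℝ}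

variable (G) in
/-- A smooth family in the Lie algebra is the family of initial velocities of a smooth family of
curves through the identity of the map group. -/
theorem IsSmoothFamily.exists_smoothGroupFamily {ξ : F → ℝ → E} (hξ : IsSmoothFamily bc ξ) :
    ∃ g : F × ℝ → mapGroup E G bc, SmoothGroupFamily g ∧ (∀ p, g (p, 0) = 1) ∧
      ∀ p, velocity (fun σ => g (p, σ)) 0 = ξ p := by
  obtain ⟨e, he, he0, he'⟩ := exists_contMDiff_chart_exp (E := E) (G := G)
  have hζ : IsSmoothFamily bc (fun (z : F × ℝ) x => z.2 • ξ z.1 x) :=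
    (hξ.comp contDiff_fst).smul contDiff_snd
  obtain ⟨g, hg, hge⟩ := exists_smoothGroupFamily_of_contMDiff he he0 hζ
  refine ⟨g, hg, fun p => ?_, fun p => ?_⟩
  · refine Subtype.ext (funext fun x => ?_)
    rw [hge]
    simp [he0]
  · have hline : HasDerivAt (fun σ : ℝ => (p, σ)) ((0 : F), (1 : ℝ)) 0 :=
      (hasDerivAt_const _ _).prodMk (hasDerivAt_id _)
    have hzero : (fun x => ((p, (0 : ℝ)) : F × ℝ).2 • ξ (p, (0 : ℝ)).1 x) = 0 := by
      funext x; simp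
    rw [hg.velocity_comp hline, groupForm_of_eq_comp he0 he' hζ hge hzero]
    funext x
    have h1 : HasDerivAt (fun σ : ℝ => σ • ξ p x) (ξ p x) 0 := by
      simpa using (hasDerivAt_id (0 : ℝ)).smul_const (ξ p x)
    have h2 := ((hζ.differentiable x).differentiableAt (x := (p, (0 : ℝ)))).hasFDerivAt
    exact (h2.comp_hasDerivAt (0 : ℝ) hline).unique h1

/-- Homogeneity of the Lie algebra cocycle, by rescaling the parameter of a curve with velocity
`η`. -/
theorem IsLieCocycleOf.smul_right (hc : IsLieCocycleOf B c) {ξ η : ℝ → E}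
    (hξ : ξ ∈ mapSpace E bc) (hη : η ∈ mapSpace E bc) (r : ℝ) :
    c ξ (fun x => (r • η x : E)) = r * c ξ η := by
  obtain ⟨g, hg, hg0, hgv⟩ := (isSmoothFamily_const (F := ℝ) hξ).exists_smoothGroupFamily G
  obtain ⟨h, hh, hh0, hhv⟩ := (isSmoothFamily_const (F := ℝ) hη).exists_smoothGroupFamily G
  have hline : HasDerivAt (fun τ : ℝ => ((0 : ℝ), r * τ)) ((0 : ℝ), r) 0 := by
    simpa using (hasDerivAt_const (0 : ℝ) (0 : ℝ)).prodMk ((hasDerivAt_id (0 : ℝ)).const_mul r)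
  have hline1 : HasDerivAt (fun τ : ℝ => ((0 : ℝ), τ)) ((0 : ℝ), (1 : ℝ)) 0 :=
    (hasDerivAt_const _ _).prodMk (hasDerivAt_id _)
  have hv : velocity (fun τ => h (0, r * τ)) 0 = fun x => (r • η x : E) := by
    rw [hh.velocity_comp hline, mul_zero, show ((0 : ℝ), r) = r • ((0 : ℝ), (1 : ℝ)) by simp,
      groupForm_smul, ← hh.velocity_comp hline1, hhv]
  have h1 := hc.eq_mixedDeriv (hg.comp (c := fun σ : ℝ => ((0 : ℝ), σ)) (by fun_prop))
    (hh.comp (c := fun τ : ℝ => ((0 : ℝ), r * τ)) (by fun_prop)) (hg0 0) (by simpa using hh0 0)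
  have h2 := hc.eq_mixedDeriv (hg.comp (c := fun σ : ℝ => ((0 : ℝ), σ)) (by fun_prop))
    (hh.comp (c := fun τ : ℝ => ((0 : ℝ), τ)) (by fun_prop)) (hg0 0) (hh0 0)
  rw [hv, hgv] at h1
  rw [hhv, hgv] at h2
  rw [h1, h2, mixedDeriv, mixedDeriv, ← deriv_const_mul_field]
  congr 1
  funext σ
  have h3 := deriv_comp_mul_left r
    (fun τ : ℝ => B (g (0, σ)) (h (0, τ)) - B (h (0, τ)) (g (0, σ))) 0
  simpa using h3

/-- The Lie algebra cocycle is smooth along smooth families, because these are families of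
velocities of smooth families of curves. -/
theorem IsLieCocycleOf.contDiff (hB : IsCocycleOn W B) (hc : IsLieCocycleOf B c)
    [FiniteDimensional ℝ F] {ξ η : F → ℝ → E} (hξ : IsSmoothFamily bc ξ)
    (hη : IsSmoothFamily bc η) : ContDiff ℝ ∞ (fun p => c (ξ p) (η p)) := by
  obtain ⟨g, hg, hg0, hgv⟩ := hξ.exists_smoothGroupFamily G
  obtain ⟨h, hh, hh0, hhv⟩ := hη.exists_smoothGroupFamily G
  have hgK : SmoothGroupFamily fun y : F × ℝ × ℝ => g (y.1, y.2.1) :=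
    hg.comp (c := fun y : F × ℝ × ℝ => (y.1, y.2.1)) (by fun_prop)
  have hhK : SmoothGroupFamily fun y : F × ℝ × ℝ => h (y.1, y.2.2) :=
    hh.comp (c := fun y : F × ℝ × ℝ => (y.1, y.2.2)) (by fun_prop)
  set K : F × ℝ × ℝ → ℝ := fun y =>
    B (g (y.1, y.2.1)) (h (y.1, y.2.2)) - B (h (y.1, y.2.2)) (g (y.1, y.2.1)) with hKdef
  have hK : ∀ p, ContDiffAt ℝ ∞ K (p, 0) := fun p => by
    have h1 : (1 : mapGroup E G bc) ∈ W := hB.one_mem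
    have hgp : g (p, 0) = 1 := hg0 p
    have hhp : h (p, 0) = 1 := hh0 p
    exact (hB.contDiffAt hgK hhK (by simpa [hgp] using h1) (by simpa [hhp] using h1)
      (by simpa [hgp, hhp] using h1)).sub (hB.contDiffAt hhK hgK (by simpa [hhp] using h1)
        (by simpa [hgp] using h1) (by simpa [hgp, hhp] using h1))
  have h2 : (fun p => c (ξ p) (η p)) = fun p =>
      fderiv ℝ (fderiv ℝ K) (p, 0) (0, 1, 0) (0, 0, 1) := by
    funext p
    rw [← mixedDeriv_comp_line (contDiffAt_infty.1 (hK p) 2), ← hgv, ← hhv,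
      hc.eq_mixedDeriv (hg.comp (c := fun σ : ℝ => (p, σ)) (by fun_prop))
        (hh.comp (c := fun τ : ℝ => (p, τ)) (by fun_prop)) (hg0 p) (hh0 p)]
    congr 1
    funext z
    simp [hKdef]
  rw [h2]
  refine contDiff_iff_contDiffAt.2 fun p => ?_
  have h3 := ((hK p).fderiv_right (m := ∞) (by simp)).fderiv_right (m := ∞) (by simp)
  exact ((h3.comp (f := fun p : F => (p, (0 : ℝ × ℝ))) p (by fun_prop)).clm_apply
    contDiffAt_const).clm_apply contDiffAt_const

omit [FiniteDimensional ℝ E] in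
theorem velocity_mul_left (a : mapGroup E G bc) (k : ℝ → mapGroup E G bc) (t : ℝ) :
    velocity (fun τ => a * k τ) t = velocity k t := by
  funext x
  have h : (fun τ => ((a : ℝ → G) x * (k t : ℝ → G) x)⁻¹ * ((a : ℝ → G) x * (k τ : ℝ → G) x)) =
      fun τ => ((k t : ℝ → G) x)⁻¹ * (k τ : ℝ → G) x := by
    funext τ; group
  exact congrArg (fun f : ℝ → G => (mfderiv 𝓘(ℝ, ℝ) 𝓘(ℝ, E) f t (1 : ℝ) : E)) h

omit [FiniteDimensional ℝ E] in
theorem velocity_const (a : mapGroup E G bc) (t : ℝ) :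
    velocity (fun _ => a) t = 0 := by
  funext x
  simp only [velocity, leftLogDeriv, mfderiv_const]
  rfl

omit [FiniteDimensional ℝ E] in
theorem SmoothExtFamily.groupForm_fst {Γ : ℝ × ℝ → mapGroup E G bc × ℝ} (hΓ : SmoothExtFamily Γ)
    (z : ℝ × ℝ) : groupForm (fun q => (Γ q).1) z (1, 0) = velocity (fun ε => (Γ (ε, z.2)).1) z.1 :=
  (hΓ.1.velocity_comp ((hasDerivAt_id z.1).prodMk (hasDerivAt_const z.1 z.2))).symm

omit [FiniteDimensional ℝ E] in
theorem SmoothExtFamily.groupForm_snd {Γ : ℝ × ℝ → mapGroup E G bc × ℝ} (hΓ : SmoothExtFamily Γ)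
    (z : ℝ × ℝ) : groupForm (fun q => (Γ q).1) z (0, 1) = velocity (fun τ => (Γ (z.1, τ)).1) z.2 :=
  (hΓ.1.velocity_comp ((hasDerivAt_const z.2 z.1).prodMk (hasDerivAt_id z.2))).symm

/-- Every `f ξ`, with a function `f` of time and `ξ` in the Lie algebra, is the left trivialised
variation of a smooth variation of `γ`; where `f` vanishes the curve is not varied. -/
theorem SmoothExtFamily.exists_variation {γ : ℝ → mapGroup E G bc × ℝ} (hγ : SmoothExtFamily γ)
    {ξ : ℝ → E} (hξ : ξ ∈ mapSpace E bc) {f : ℝ → ℝ} (hf : ContDiff ℝ ∞ f) :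
    ∃ Γ : ℝ × ℝ → mapGroup E G bc × ℝ, SmoothExtFamily Γ ∧ (∀ t, Γ (0, t) = γ t) ∧
      (∀ ε t, f t = 0 → Γ (ε, t) = γ t) ∧
      ∀ t, groupForm (fun q => (Γ q).1) (0, t) (1, 0) = fun x => f t • ξ x := by
  obtain ⟨k, hk, hk0, hkv⟩ := (isSmoothFamily_const (F := ℝ) hξ).exists_smoothGroupFamily G
  have hΓ : SmoothExtFamily (fun z : ℝ × ℝ => ((γ z.2).1 * k (0, z.1 * f z.2), (γ z.2).2)) :=
    ⟨(hγ.1.comp (c := fun z : ℝ × ℝ => z.2) contDiff_snd).mul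
      (hk.comp (c := fun z : ℝ × ℝ => ((0 : ℝ), z.1 * f z.2)) (by fun_prop)),
      hγ.2.comp contDiff_snd⟩
  refine ⟨_, hΓ, fun t => ?_, fun ε t ht => ?_, fun t => ?_⟩
  · simp [hk0]
  · simp [hk0, ht]
  · have hline : HasDerivAt (fun ε : ℝ => ((0 : ℝ), ε * f t)) ((0 : ℝ), f t) 0 := by
      simpa using (hasDerivAt_const (0 : ℝ) (0 : ℝ)).prodMk
        ((hasDerivAt_id (0 : ℝ)).mul_const (f t))
    have hline1 : HasDerivAt (fun τ : ℝ => ((0 : ℝ), τ)) ((0 : ℝ), (1 : ℝ)) 0 :=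
      (hasDerivAt_const _ _).prodMk (hasDerivAt_id _)
    rw [hΓ.groupForm_fst (0, t)]
    show velocity (fun ε => (γ t).1 * k (0, ε * f t)) 0 = _
    rw [velocity_mul_left, hk.velocity_comp hline, zero_mul,
      show ((0 : ℝ), f t) = f t • ((0 : ℝ), (1 : ℝ)) by simp,
      groupForm_smul, ← hk.velocity_comp hline1, hkv]

end LieCocycle

/-! ### The bracket as a continuous bilinear map -/

section BracketL

variable {E : Type*} [NormedAddCommGroup E] [NormedSpace ℝ E] [FiniteDimensional ℝ E]
  [CompleteSpace E]
  {G : Type*} [TopologicalSpace G] [ChartedSpace E G] [Group G] [LieGroup 𝓘(ℝ, E) ∞ G]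

variable (E G) in
/-- The bracket of `𝔤` as a continuous bilinear map on the underlying normed space. -/
def modelBracketL : E →L[ℝ] E →L[ℝ] E :=
  (LinearMap.mk₂ ℝ (modelBracket E G)
    (fun a b c => add_lie (L := GroupLieAlgebra 𝓘(ℝ, E) G) (M := GroupLieAlgebra 𝓘(ℝ, E) G) a b c)
    (fun r a b => smul_lie (R := ℝ) (L := GroupLieAlgebra 𝓘(ℝ, E) G)
      (M := GroupLieAlgebra 𝓘(ℝ, E) G) r a b)
    (fun a b c => lie_add (L := GroupLieAlgebra 𝓘(ℝ, E) G) (M := GroupLieAlgebra 𝓘(ℝ, E) G) a b c)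
    (fun r a b => lie_smul (R := ℝ) (L := GroupLieAlgebra 𝓘(ℝ, E) G)
      (M := GroupLieAlgebra 𝓘(ℝ, E) G) r a b)).toContinuousBilinearMap

theorem modelBracketL_apply (v w : E) : modelBracketL E G v w = modelBracket E G v w := rfl

end BracketL

/-! ### First variation of the Lagrangian -/

section Variation

theorem hasDerivAt_comp_fst {X : Type*} [NormedAddCommGroup X] [NormedSpace ℝ X] {f : ℝ × ℝ → X}
    {z : ℝ × ℝ} (hf : DifferentiableAt ℝ f z) :
    HasDerivAt (fun s => f (s, z.2)) (fderiv ℝ f z (1, 0)) z.1 :=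
  hf.hasFDerivAt.comp_hasDerivAt (f := fun s : ℝ => (s, z.2)) z.1
    ((hasDerivAt_id z.1).prodMk (hasDerivAt_const z.1 z.2))

theorem hasDerivAt_comp_snd {X : Type*} [NormedAddCommGroup X] [NormedSpace ℝ X] {f : ℝ × ℝ → X}
    {z : ℝ × ℝ} (hf : DifferentiableAt ℝ f z) :
    HasDerivAt (fun s => f (z.1, s)) (fderiv ℝ f z (0, 1)) z.2 :=
  hf.hasFDerivAt.comp_hasDerivAt (f := fun s : ℝ => (z.1, s)) z.2
    ((hasDerivAt_const z.2 z.1).prodMk (hasDerivAt_id z.2))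

variable {E : Type*} [NormedAddCommGroup E] [NormedSpace ℝ E] [FiniteDimensional ℝ E]
  [CompleteSpace E]
  {G : Type*} [TopologicalSpace G] [ChartedSpace E G] [Group G] [LieGroup 𝓘(ℝ, E) ∞ G]
  {bc : BoundaryCond}
  {W : Set (mapGroup E G bc)} {B : mapGroup E G bc → mapGroup E G bc → ℝ}
  {l : (ℝ → E) → ℝ} {c : (ℝ → E) → (ℝ → E) → ℝ} {Γ : ℝ × ℝ → mapGroup E G bc × ℝ}

omit [FiniteDimensional ℝ E] [CompleteSpace E] in
theorem SmoothExtFamily.lagrangian_eq (hB : IsCocycleOn W B) (hΓ : SmoothExtFamily Γ) {z : ℝ × ℝ}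
    (hz : (Γ z).1 ∈ W) (hz' : (Γ z).1⁻¹ ∈ W) :
    lagrangian (E := E) l B (fun τ => Γ (z.1, τ)) z.2 =
      l (groupForm (fun q => (Γ q).1) z (0, 1)) + centralForm B Γ z (0, 1) ^ 2 / 2 := by
  have h1 : HasDerivAt (fun τ : ℝ => (z.1, τ)) ((0 : ℝ), (1 : ℝ)) z.2 :=
    (hasDerivAt_const z.2 z.1).prodMk (hasDerivAt_id z.2)
  rw [hΓ.groupForm_snd z, ← hΓ.centralVelocity_comp hB h1 hz hz']
  rfl

omit [FiniteDimensional ℝ E] [CompleteSpace E] in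
theorem SmoothExtFamily.contDiffAt_lagrangian (hB : IsCocycleOn W B)
    (hl : IsSmoothFunctional bc l) (hΓ : SmoothExtFamily Γ) {z : ℝ × ℝ} (hz : (Γ z).1 ∈ W)
    (hz' : (Γ z).1⁻¹ ∈ W) :
    ContDiffAt ℝ ∞ (fun z : ℝ × ℝ => lagrangian (E := E) l B (fun τ => Γ (z.1, τ)) z.2) z := by
  have h1 : ContDiffAt ℝ ∞ (fun z : ℝ × ℝ =>
      l (groupForm (fun q => (Γ q).1) z (0, 1)) + centralForm B Γ z (0, 1) ^ 2 / 2) z :=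
    (hl.contDiff (hΓ.1.isSmoothFamily_groupForm (0, 1))).contDiffAt.add
      ((((hΓ.contDiffAt_centralForm hB hz hz').clm_apply contDiffAt_const).pow 2).div_const 2)
  refine h1.congr_of_eventuallyEq ?_
  filter_upwards [hΓ.eventually_mem hB hz hz'] with y hy
  exact hΓ.lagrangian_eq hB hy.1 hy.2

/-- The first variation of the Lagrangian. With the left trivialised variation `(η, α)` one has
`δM = ∂ₜη + [M, η]` by the Maurer–Cartan equation and `δa = ∂ₜα + c(M, η)` by the structure equation
of the central component. -/
theorem SmoothExtFamily.hasDerivAt_lagrangian (hB : IsCocycleOn W B)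
    (hc : IsLieCocycleOf (E := E) B c) (hl : IsSmoothFunctional bc l) (hΓ : SmoothExtFamily Γ)
    {t : ℝ} (ht : (Γ (0, t)).1 ∈ W) (ht' : (Γ (0, t)).1⁻¹ ∈ W) :
    HasDerivAt (fun ε : ℝ => lagrangian (E := E) l B (fun τ => Γ (ε, τ)) t)
      (dirDeriv l (groupForm (fun q => (Γ q).1) (0, t) (0, 1))
        (fun x => deriv (fun τ : ℝ => groupForm (fun q => (Γ q).1) (0, τ) (1, 0) x) t) +
      dirDeriv l (groupForm (fun q => (Γ q).1) (0, t) (0, 1))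
        (fun x => modelBracket E G (groupForm (fun q => (Γ q).1) (0, t) (0, 1) x)
          (groupForm (fun q => (Γ q).1) (0, t) (1, 0) x)) +
      centralForm B Γ (0, t) (0, 1) * (deriv (fun τ : ℝ => centralForm B Γ (0, τ) (1, 0)) t +
        c (groupForm (fun q => (Γ q).1) (0, t) (0, 1))
          (groupForm (fun q => (Γ q).1) (0, t) (1, 0)))) 0 := by
  have hM := hΓ.1.isSmoothFamily_groupForm (0, 1)
  have hη := hΓ.1.isSmoothFamily_groupForm (1, 0)
  have hMt := hM.mem (0, t)
  have hθ : ∀ v : ℝ × ℝ, DifferentiableAt ℝ (fun q => centralForm B Γ q v) (0, t) := fun v =>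
    ((hΓ.contDiffAt_centralForm hB ht ht').clm_apply contDiffAt_const).differentiableAt (by simp)
  have h1 := hl.hasDerivAt (hM.comp (c := fun ε : ℝ => (ε, t)) (by fun_prop)) 0
  have h2 : (fun x => deriv (fun ε : ℝ => groupForm (fun q => (Γ q).1) (ε, t) (0, 1) x) 0) =
      fun x => deriv (fun τ : ℝ => groupForm (fun q => (Γ q).1) (0, τ) (1, 0) x) t +
        modelBracket E G (groupForm (fun q => (Γ q).1) (0, t) (0, 1) x)
          (groupForm (fun q => (Γ q).1) (0, t) (1, 0) x) := by
    funext x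
    rw [(hasDerivAt_comp_fst ((hM.differentiable x).differentiableAt (x := (0, t)))).deriv,
      (hasDerivAt_comp_snd ((hη.differentiable x).differentiableAt (x := (0, t)))).deriv,
      ← hΓ.1.fderiv_groupForm_sub (0, t) (1, 0) (0, 1) x]
    abel
  have hηd : (fun x => deriv (fun τ : ℝ => groupForm (fun q => (Γ q).1) (0, τ) (1, 0) x) t) ∈
      mapSpace E bc := (hη.comp (c := fun τ : ℝ => ((0 : ℝ), τ)) (by fun_prop)).deriv.mem t
  have hbr : (fun x => modelBracket E G (groupForm (fun q => (Γ q).1) (0, t) (0, 1) x)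
          (groupForm (fun q => (Γ q).1) (0, t) (1, 0) x)) ∈ mapSpace E bc :=
    bilin_mem_mapSpace hMt (hη.mem (0, t)) (modelBracketL E G)
  rw [h2, hl.dirDeriv_add hMt hηd hbr] at h1
  have h5 := ((hasDerivAt_comp_fst (hθ (0, 1))).pow 2).div_const 2
  have h6 := hΓ.fderiv_centralForm_sub hB hc ht ht' (1, 0) (0, 1)
  have h7 := (hasDerivAt_comp_snd (hθ (1, 0))).deriv
  have hev : ∀ᶠ ε : ℝ in 𝓝 0, (Γ (ε, t)).1 ∈ W ∧ (Γ (ε, t)).1⁻¹ ∈ W :=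
    (by fun_prop : ContinuousAt (fun ε : ℝ => (ε, t)) 0).eventually (hΓ.eventually_mem hB ht ht')
  have h8 := (h1.add h5).congr_of_eventuallyEq (f₁ := fun ε : ℝ =>
    lagrangian (E := E) l B (fun τ => Γ (ε, τ)) t)
    (hev.mono fun ε hε => hΓ.lagrangian_eq hB (z := (ε, t)) hε.1 hε.2)
  refine h8.congr_deriv ?_
  simp only at h7
  rw [h7, ← h6]
  simp
  ring

omit [FiniteDimensional ℝ E] [CompleteSpace E] in
/-- The fibre derivative in left trivialisation: `⟨∂L/∂γ̇, δγ⟩ = ⟨δl/δM, η⟩ + a α`. -/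
theorem SmoothExtFamily.fibreDeriv_eq (hB : IsCocycleOn W B)
    (hl : IsSmoothFunctional bc l) (hΓ : SmoothExtFamily Γ)
    {t : ℝ} (ht : (Γ (0, t)).1 ∈ W) (ht' : (Γ (0, t)).1⁻¹ ∈ W) :
    fibreDeriv (E := E) l B Γ t =
      dirDeriv l (groupForm (fun q => (Γ q).1) (0, t) (0, 1))
        (groupForm (fun q => (Γ q).1) (0, t) (1, 0)) +
      centralForm B Γ (0, t) (0, 1) * centralForm B Γ (0, t) (1, 0) := by
  have hM := (hΓ.1.isSmoothFamily_groupForm (0, 1)).mem (0, t)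
  have hη := (hΓ.1.isSmoothFamily_groupForm (1, 0)).mem (0, t)
  -- the curve `τ ↦ (σ (τ - t), τ)` of parameters has the velocity `(σ, 1)` at `τ = t`
  have hdir : ∀ σ : ℝ, ((σ, 1) : ℝ × ℝ) = (0, 1) + σ • (1, 0) := fun σ => by simp
  have h1 : ∀ σ : ℝ, lagrangian (E := E) l B (fun τ => Γ (σ * (τ - t), τ)) t =
      l (fun x => groupForm (fun q => (Γ q).1) (0, t) (0, 1) x +
        σ • groupForm (fun q => (Γ q).1) (0, t) (1, 0) x) +
      (centralForm B Γ (0, t) (0, 1) + σ * centralForm B Γ (0, t) (1, 0)) ^ 2 / 2 := by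
    intro σ
    have hline : HasDerivAt (fun τ : ℝ => (σ * (τ - t), τ)) (σ, (1 : ℝ)) t := by
      simpa using (((hasDerivAt_id t).sub_const t).const_mul σ).prodMk (hasDerivAt_id t)
    have h0 : (σ * (t - t), t) = ((0 : ℝ), t) := by simp
    have hv := hΓ.1.velocity_comp hline
    have ha := hΓ.centralVelocity_comp hB hline (by rwa [h0]) (by rwa [h0])
    rw [h0, hdir, groupForm_add, groupForm_smul] at hv
    rw [h0, hdir, map_add, map_smul, smul_eq_mul] at ha
    rw [← ha, ← hv]
    rfl
  have hlin : ContDiff ℝ ∞ fun σ : ℝ => l (fun x => groupForm (fun q => (Γ q).1) (0, t) (0, 1) x +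
        σ • groupForm (fun q => (Γ q).1) (0, t) (1, 0) x) :=
    hl.contDiff ((isSmoothFamily_const hM).add ((isSmoothFamily_const hη).smul contDiff_id))
  have h2 := (hlin.differentiable (by simp)).differentiableAt (x := 0) |>.hasDerivAt
  have h3 := ((((hasDerivAt_id (0 : ℝ)).mul_const (centralForm B Γ (0, t) (1, 0))).const_add
    (centralForm B Γ (0, t) (0, 1))).pow 2).div_const 2
  show deriv (fun σ : ℝ => lagrangian (E := E) l B (fun τ => Γ (σ * (τ - t), τ)) t) 0 = _
  rw [funext h1]
  refine ((h2.add h3).congr_deriv ?_).deriv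
  rw [dirDeriv]
  simp
  ring

omit [FiniteDimensional ℝ E] in
/-- The time derivative of `⟨∂L/∂γ̇, δγ⟩` where the central velocity is constant. -/
theorem SmoothExtFamily.hasDerivAt_fibreDeriv (hB : IsCocycleOn W B)
    (hl : IsSmoothFunctional bc l) (hΓ : SmoothExtFamily Γ)
    {t : ℝ} (ht : (Γ (0, t)).1 ∈ W) (ht' : (Γ (0, t)).1⁻¹ ∈ W)
    (ha : HasDerivAt (fun τ : ℝ => centralForm B Γ (0, τ) (0, 1)) 0 t) :
    HasDerivAt (fibreDeriv (E := E) l B Γ)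
      (deriv (fun τ : ℝ => dirDeriv l (groupForm (fun q => (Γ q).1) (0, τ) (0, 1))
          (groupForm (fun q => (Γ q).1) (0, t) (1, 0))) t +
        dirDeriv l (groupForm (fun q => (Γ q).1) (0, t) (0, 1))
          (fun x => deriv (fun τ : ℝ => groupForm (fun q => (Γ q).1) (0, τ) (1, 0) x) t) +
        centralForm B Γ (0, t) (0, 1) *
          deriv (fun τ : ℝ => centralForm B Γ (0, τ) (1, 0)) t) t := by
  have hM := (hΓ.1.isSmoothFamily_groupForm (0, 1)).comp (c := fun τ : ℝ => ((0 : ℝ), τ))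
    (by fun_prop)
  have hη := (hΓ.1.isSmoothFamily_groupForm (1, 0)).comp (c := fun τ : ℝ => ((0 : ℝ), τ))
    (by fun_prop)
  have hα : DifferentiableAt ℝ (fun τ : ℝ => centralForm B Γ (0, τ) (1, 0)) t :=
    (hasDerivAt_comp_snd (z := (0, t)) (f := fun q => centralForm B Γ q (1, 0))
      (((hΓ.contDiffAt_centralForm hB ht ht').clm_apply contDiffAt_const).differentiableAt
        (by simp))).differentiableAt
  have h1 := (hl.hasDerivAt_dirDeriv hM hη t).add (ha.mul hα.hasDerivAt)
  have hev : ∀ᶠ τ : ℝ in 𝓝 t, (Γ (0, τ)).1 ∈ W ∧ (Γ (0, τ)).1⁻¹ ∈ W :=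
    (by fun_prop : ContinuousAt (fun τ : ℝ => ((0 : ℝ), τ)) t).eventually
      (hΓ.eventually_mem hB ht ht')
  refine (h1.congr_of_eventuallyEq (hev.mono fun τ hτ => ?_)).congr_deriv ?_
  · exact hΓ.fibreDeriv_eq hB hl hτ.1 hτ.2
  · simp

omit [FiniteDimensional ℝ E] [CompleteSpace E] in
/-- The first variation of the action, under the integral sign. -/
theorem SmoothExtFamily.hasDerivAt_action (hB : IsCocycleOn W B)
    (hl : IsSmoothFunctional bc l) (hΓ : SmoothExtFamily Γ) {t₀ t₁ : ℝ} (h01 : t₀ ≤ t₁)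
    (hW : ∀ t ∈ Icc t₀ t₁, (Γ (0, t)).1 ∈ W ∧ (Γ (0, t)).1⁻¹ ∈ W) :
    HasDerivAt (fun ε : ℝ => ∫ t in t₀..t₁, lagrangian (E := E) l B (fun τ => Γ (ε, τ)) t)
      (∫ t in t₀..t₁, deriv (fun ε : ℝ => lagrangian (E := E) l B (fun τ => Γ (ε, τ)) t) 0) 0 :=
  hasDerivAt_intervalIntegral_of_contDiffAt
    (f := fun z : ℝ × ℝ => lagrangian (E := E) l B (fun τ => Γ (z.1, τ)) z.2) h01 fun t ht =>
      (hΓ.contDiffAt_lagrangian hB hl (hW t ht).1 (hW t ht).2).of_le (by simp)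

omit [FiniteDimensional ℝ E] [CompleteSpace E] in
theorem SmoothExtFamily.continuousOn_deriv_lagrangian (hB : IsCocycleOn W B)
    (hl : IsSmoothFunctional bc l) (hΓ : SmoothExtFamily Γ) {t₀ t₁ : ℝ}
    (hW : ∀ t ∈ Icc t₀ t₁, (Γ (0, t)).1 ∈ W ∧ (Γ (0, t)).1⁻¹ ∈ W) :
    ContinuousOn (fun t => deriv (fun ε : ℝ => lagrangian (E := E) l B (fun τ => Γ (ε, τ)) t) 0)
      (Icc t₀ t₁) := by
  set f : ℝ × ℝ → ℝ := fun z => lagrangian (E := E) l B (fun τ => Γ (z.1, τ)) z.2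
  have hf : ∀ t ∈ Icc t₀ t₁, ContDiffAt ℝ ∞ f (0, t) := fun t ht =>
    hΓ.contDiffAt_lagrangian hB hl (hW t ht).1 (hW t ht).2
  have h1 : EqOn (fun t => deriv (fun ε : ℝ => f (ε, t)) 0)
      (fun t => fderiv ℝ f (0, t) (1, 0)) (Icc t₀ t₁) := fun t ht =>
    (hasDerivAt_comp_fst ((hf t ht).differentiableAt (by simp))).deriv
  refine ContinuousOn.congr (fun t ht => ContinuousAt.continuousWithinAt ?_) h1
  have h2 : ContinuousAt (fderiv ℝ f) (0, t) :=
    ((hf t ht).fderiv_right (m := 0) (by simp)).continuousAt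
  exact (h2.comp (f := fun t : ℝ => ((0 : ℝ), t)) (by fun_prop)).clm_apply continuousAt_const

omit [FiniteDimensional ℝ E] [CompleteSpace E] in
/-- A variation that fixes the curve at time `t` has at this time the trivialised variation zero. -/
theorem SmoothExtFamily.forms_eq_zero (hB : IsCocycleOn W B) (hΓ : SmoothExtFamily Γ)
    {t : ℝ} (ht : (Γ (0, t)).1 ∈ W) (ht' : (Γ (0, t)).1⁻¹ ∈ W) (hfix : ∀ ε, Γ (ε, t) = Γ (0, t)) :
    groupForm (fun q => (Γ q).1) (0, t) (1, 0) = (0 : ℝ → E) ∧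
      centralForm B Γ (0, t) (1, 0) = 0 := by
  have hline : HasDerivAt (fun ε : ℝ => (ε, t)) ((1 : ℝ), (0 : ℝ)) 0 :=
    (hasDerivAt_id _).prodMk (hasDerivAt_const _ _)
  constructor
  · rw [hΓ.groupForm_fst]
    simp only [hfix]
    exact velocity_const _ _
  · rw [← hΓ.centralVelocity_comp hB hline ht ht']
    simp only [hfix, centralVelocity, deriv_const]

end Variation

/-! ### Hamilton's principle, Euler–Lagrange and Euler–Poincaré equations -/

section Equivalence

variable {E : Type*} [NormedAddCommGroup E] [NormedSpace ℝ E] [FiniteDimensional ℝ E]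
  [CompleteSpace E]
  {G : Type*} [TopologicalSpace G] [ChartedSpace E G] [Group G] [LieGroup 𝓘(ℝ, E) ∞ G]
  {bc : BoundaryCond}
  {W : Set (mapGroup E G bc)} {B : mapGroup E G bc → mapGroup E G bc → ℝ}
  {l : (ℝ → E) → ℝ} {c : (ℝ → E) → (ℝ → E) → ℝ} {Γ : ℝ × ℝ → mapGroup E G bc × ℝ}
  {γ : ℝ → mapGroup E G bc × ℝ} {t₀ t₁ : ℝ}

omit [FiniteDimensional ℝ E] [CompleteSpace E] in
theorem SmoothExtFamily.centralForm_snd (hB : IsCocycleOn W B) (hΓ : SmoothExtFamily Γ)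
    {z : ℝ × ℝ} (hz : (Γ z).1 ∈ W) (hz' : (Γ z).1⁻¹ ∈ W) :
    centralForm B Γ z (0, 1) = centralVelocity B (fun τ => Γ (z.1, τ)) z.2 :=
  (hΓ.centralVelocity_comp hB ((hasDerivAt_const z.2 z.1).prodMk (hasDerivAt_id z.2)) hz hz').symm

omit [FiniteDimensional ℝ E] [CompleteSpace E] in
theorem SmoothExtFamily.contDiffAt_centralVelocity (hB : IsCocycleOn W B) (hγ : SmoothExtFamily γ)
    {t : ℝ} (ht : (γ t).1 ∈ W) (ht' : (γ t).1⁻¹ ∈ W) :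
    ContDiffAt ℝ ∞ (centralVelocity B γ) t := by
  have h1 : ContDiffAt ℝ ∞ (fun τ => centralForm B γ τ 1) t :=
    (hγ.contDiffAt_centralForm hB ht ht').clm_apply contDiffAt_const
  refine h1.congr_of_eventuallyEq ?_
  filter_upwards [hγ.eventually_mem hB ht ht'] with τ hτ
  exact hγ.centralVelocity_comp hB (hasDerivAt_id τ) hτ.1 hτ.2

omit [FiniteDimensional ℝ E] [CompleteSpace E] in
/-- A central velocity that is constant on `[t₀, t₁]` has derivative zero there, also at the
endpoints, where the curve goes on beyond the interval. -/
theorem SmoothExtFamily.hasDerivAt_centralForm_of_const (hB : IsCocycleOn W B)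
    (hΓ : SmoothExtFamily Γ) (h01 : t₀ < t₁)
    (hW : ∀ t ∈ Icc t₀ t₁, (Γ (0, t)).1 ∈ W ∧ (Γ (0, t)).1⁻¹ ∈ W) {m : ℝ}
    (ha : ∀ t ∈ Icc t₀ t₁, centralVelocity B (fun τ => Γ (0, τ)) t = m) {t : ℝ}
    (ht : t ∈ Icc t₀ t₁) :
    HasDerivAt (fun τ : ℝ => centralForm B Γ (0, τ) (0, 1)) 0 t := by
  have h1 := hasDerivAt_comp_snd (z := (0, t)) (f := fun q => centralForm B Γ q (0, 1))
    (((hΓ.contDiffAt_centralForm hB (hW t ht).1 (hW t ht).2).clm_apply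
      contDiffAt_const).differentiableAt (by simp))
  have h2 : ∀ τ ∈ Icc t₀ t₁, centralForm B Γ (0, τ) (0, 1) = m := fun τ hτ =>
    (hΓ.centralForm_snd hB (hW τ hτ).1 (hW τ hτ).2).trans (ha τ hτ)
  have h3 : HasDerivWithinAt (fun τ : ℝ => centralForm B Γ (0, τ) (0, 1)) 0 (Icc t₀ t₁) t :=
    (hasDerivWithinAt_const t (Icc t₀ t₁) m).congr h2 (h2 t ht)
  have h4 := (uniqueDiffOn_Icc h01 t ht).eq_deriv _ h1.hasDerivWithinAt h3
  exact h1.congr_deriv h4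

omit [FiniteDimensional ℝ E] [CompleteSpace E] in
theorem SmoothExtFamily.isSmoothFamily_velocity (hγ : SmoothExtFamily γ) :
    IsSmoothFamily (E := E) bc (velocity (fun t => (γ t).1)) := by
  have h1 : velocity (fun t => (γ t).1) = fun t => groupForm (E := E) (fun q => (γ q).1) t 1 :=
    funext fun t => hγ.1.velocity_comp (hasDerivAt_id t)
  rw [h1]
  exact hγ.1.isSmoothFamily_groupForm 1

/-- The Euler–Poincaré equation, applied at each time to the trivialised variation `η`, gives the
Euler–Lagrange equations by the product rule. -/
theorem eulerLagrange_of_eulerPoincare (hB : IsCocycleOn W B)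
    (hc : IsLieCocycleOf (E := E) B c) (hl : IsSmoothFunctional bc l) (h01 : t₀ < t₁)
    (hW : ∀ t ∈ Icc t₀ t₁, (γ t).1 ∈ W ∧ (γ t).1⁻¹ ∈ W) {m : ℝ}
    (ha : ∀ t ∈ Icc t₀ t₁, centralVelocity B γ t = m)
    (H : EulerPoincare (E := E) bc l c (velocity (fun t => (γ t).1)) m t₀ t₁) :
    EulerLagrange (E := E) l B γ t₀ t₁ := by
  intro Γ hΓ hΓ0 t ht
  obtain rfl : γ = fun t => Γ (0, t) := funext fun t => (hΓ0 t).symm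
  have h1 := hΓ.hasDerivAt_fibreDeriv hB hl (hW t ht).1 (hW t ht).2
    (hΓ.hasDerivAt_centralForm_of_const hB h01 hW ha ht)
  refine h1.congr_deriv ?_
  rw [(hΓ.hasDerivAt_lagrangian hB hc hl (hW t ht).1 (hW t ht).2).deriv]
  have h2 : HasDerivAt (fun τ : ℝ => dirDeriv l (groupForm (fun q => (Γ q).1) (0, τ) (0, 1))
      (groupForm (fun q => (Γ q).1) (0, t) (1, 0)))
      (dirDeriv l (groupForm (fun q => (Γ q).1) (0, t) (0, 1))
        (fun x => modelBracket E G (groupForm (fun q => (Γ q).1) (0, t) (0, 1) x)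
          (groupForm (fun q => (Γ q).1) (0, t) (1, 0) x)) +
        m * c (groupForm (fun q => (Γ q).1) (0, t) (0, 1))
          (groupForm (fun q => (Γ q).1) (0, t) (1, 0))) t := by
    simp only [hΓ.groupForm_snd]
    exact H _ ((hΓ.1.isSmoothFamily_groupForm (1, 0)).mem (0, t)) t ht
  rw [h2.deriv, (hΓ.centralForm_snd hB (hW t ht).1 (hW t ht).2).trans (ha t ht)]
  ring

omit [FiniteDimensional ℝ E] [CompleteSpace E] in
/-- By the Euler–Lagrange equations the variation of the action is the boundary term of
`⟨∂L/∂γ̇, δγ⟩`, which vanishes for fixed endpoints. -/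
theorem hamiltonPrinciple_of_eulerLagrange (hB : IsCocycleOn W B)
    (hl : IsSmoothFunctional bc l) (h01 : t₀ < t₁)
    (hW : ∀ t ∈ Icc t₀ t₁, (γ t).1 ∈ W ∧ (γ t).1⁻¹ ∈ W)
    (H : EulerLagrange (E := E) l B γ t₀ t₁) : HamiltonPrinciple (E := E) l B γ t₀ t₁ := by
  intro Γ hΓ hΓ0 hfix
  obtain rfl : γ = fun t => Γ (0, t) := funext fun t => (hΓ0 t).symm
  have h0 : ∀ t ∈ Icc t₀ t₁, (∀ ε, Γ (ε, t) = Γ (0, t)) → fibreDeriv (E := E) l B Γ t = 0 := by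
    intro t ht hf
    obtain ⟨h1, h2⟩ := hΓ.forms_eq_zero hB (hW t ht).1 (hW t ht).2 hf
    rw [hΓ.fibreDeriv_eq hB hl (hW t ht).1 (hW t ht).2, h1, h2, dirDeriv_zero]
    simp
  refine (hΓ.hasDerivAt_action hB hl h01.le hW).congr_deriv ?_
  rw [intervalIntegral.integral_eq_sub_of_hasDerivAt (f := fibreDeriv (E := E) l B Γ)
    (fun t ht => H Γ hΓ (fun _ => rfl) t (by rwa [uIcc_of_le h01.le] at ht))
    (ContinuousOn.intervalIntegrable (by
      rw [uIcc_of_le h01.le]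
      exact hΓ.continuousOn_deriv_lagrangian hB hl hW)),
    h0 t₁ (right_mem_Icc.2 h01.le) fun ε => (hfix ε).2,
    h0 t₀ (left_mem_Icc.2 h01.le) fun ε => (hfix ε).1, sub_zero]

/-- Hamilton's principle implies the Euler–Poincaré equation: the variations with trivialised
variation `f ξ`, where `f` is a test function of time, are enough. The central part of the variation
contributes a total derivative. -/
theorem eulerPoincare_of_hamiltonPrinciple (hB : IsCocycleOn W B)
    (hc : IsLieCocycleOf (E := E) B c) (hl : IsSmoothFunctional bc l) (hγ : SmoothExtFamily γ)
    (h01 : t₀ < t₁) (hW : ∀ t ∈ Icc t₀ t₁, (γ t).1 ∈ W ∧ (γ t).1⁻¹ ∈ W) {m : ℝ}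
    (ha : ∀ t ∈ Icc t₀ t₁, centralVelocity B γ t = m)
    (H : HamiltonPrinciple (E := E) l B γ t₀ t₁) :
    EulerPoincare (E := E) bc l c (velocity (fun t => (γ t).1)) m t₀ t₁ := by
  set V : ℝ → ℝ → E := velocity (fun t => (γ t).1) with hVdef
  suffices key : ∀ ξ : ℝ → E, ξ ∈ mapSpace E bc → ∀ t ∈ Icc t₀ t₁,
      HasDerivAt (fun τ => dirDeriv l (V τ) ξ)
        (dirDeriv l (V t) (fun x => modelBracketL E G (V t x) (ξ x)) + m * c (V t) ξ) t from
    fun ξ hξ t ht => key ξ hξ t ht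
  intro ξ hξ
  have hV : IsSmoothFamily bc V := hγ.isSmoothFamily_velocity
  have hξ' := isSmoothFamily_const (F := ℝ) hξ
  have hp := hl.contDiff_dirDeriv hV hξ'
  have hq : Continuous fun t =>
      dirDeriv l (V t) (fun x => modelBracketL E G (V t x) (ξ x)) + m * c (V t) ξ :=
    (hl.contDiff_dirDeriv hV (hV.bilin hξ' (modelBracketL E G))).continuous.add
      ((hc.contDiff hB hV hξ').continuous.const_mul m)
  refine deriv_eq_of_integral_eq_zero (p := fun t => dirDeriv l (V t) ξ) h01
    (fun t _ => hp.contDiffAt.of_le (by simp)) hq.continuousOn fun f hf hfs => ?_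
  have hfe : ∀ t, t ∉ Ioo t₀ t₁ → f t = 0 := fun t ht =>
    image_eq_zero_of_notMem_tsupport fun h => ht (hfs h)
  obtain ⟨Γ, hΓ, hΓ0, hΓf, hΓξ⟩ := hγ.exists_variation hξ hf
  obtain rfl : γ = fun t => Γ (0, t) := funext fun t => (hΓ0 t).symm
  have hfix₀ : ∀ ε, Γ (ε, t₀) = Γ (0, t₀) := fun ε => hΓf ε t₀ (hfe t₀ (by simp))
  have hfix₁ : ∀ ε, Γ (ε, t₁) = Γ (0, t₁) := fun ε => hΓf ε t₁ (hfe t₁ (by simp))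
  have hI := (hΓ.hasDerivAt_action hB hl h01.le hW).unique
    (H Γ hΓ (fun _ => rfl) fun ε => ⟨hfix₀ ε, hfix₁ ε⟩)
  set α : ℝ → ℝ := fun τ => centralForm B Γ (0, τ) (1, 0) with hα
  have hαd : ∀ t ∈ Icc t₀ t₁, ContDiffAt ℝ ∞ α t := fun t ht =>
    ((hΓ.contDiffAt_centralForm hB (hW t ht).1 (hW t ht).2).comp
      (f := fun τ : ℝ => ((0 : ℝ), τ)) t (by fun_prop)).clm_apply contDiffAt_const
  have hαc : ContinuousOn (deriv α) (Icc t₀ t₁) := fun t ht =>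
    (((hαd t ht).fderiv_right (m := 0) (by simp)).continuousAt.clm_apply
      continuousAt_const).continuousWithinAt
  have hαI : ∫ t in t₀..t₁, m * deriv α t = 0 := by
    rw [intervalIntegral.integral_const_mul, intervalIntegral.integral_deriv_eq_sub
      (fun t ht => (hαd t (by rwa [uIcc_of_le h01.le] at ht)).differentiableAt (by simp))
      (ContinuousOn.intervalIntegrable (by rwa [uIcc_of_le h01.le]))]
    have h1 := (hΓ.forms_eq_zero hB (hW t₁ (right_mem_Icc.2 h01.le)).1
      (hW t₁ (right_mem_Icc.2 h01.le)).2 hfix₁).2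
    have h0 := (hΓ.forms_eq_zero hB (hW t₀ (left_mem_Icc.2 h01.le)).1
      (hW t₀ (left_mem_Icc.2 h01.le)).2 hfix₀).2
    simp [hα, h0, h1]
  have hint : ∀ t ∈ uIcc t₀ t₁,
      deriv f t * dirDeriv l (V t) ξ + f t *
        (dirDeriv l (V t) (fun x => modelBracketL E G (V t x) (ξ x)) + m * c (V t) ξ) =
      deriv (fun ε : ℝ => lagrangian (E := E) l B (fun τ => Γ (ε, τ)) t) 0 - m * deriv α t := by
    intro t ht
    rw [uIcc_of_le h01.le] at ht
    have hVt : V t = groupForm (fun q => (Γ q).1) (0, t) (0, 1) := (hΓ.groupForm_snd (0, t)).symm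
    rw [(hΓ.hasDerivAt_lagrangian hB hc hl (hW t ht).1 (hW t ht).2).deriv,
      (hΓ.centralForm_snd hB (hW t ht).1 (hW t ht).2).trans (ha t ht), ← hVt]
    have hd : (fun x => deriv (fun τ => groupForm (fun q => (Γ q).1) (0, τ) (1, 0) x) t) =
        fun x => deriv f t • ξ x := by
      simp only [hΓξ]
      exact funext fun x => deriv_smul_const
        ((hf.differentiable (by simp)).differentiableAt) (ξ x)
    have hbr : (fun x => modelBracket E G (V t x)
        (groupForm (fun q => (Γ q).1) (0, t) (1, 0) x)) =
        fun x => f t • modelBracketL E G (V t x) (ξ x) := by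
      funext x
      rw [hΓξ, ← modelBracketL_apply]
      exact map_smul _ _ _
    rw [hd, hbr, dirDeriv_smul, dirDeriv_smul, hΓξ,
      hc.smul_right (hV.mem t) hξ]
    ring
  rw [intervalIntegral.integral_congr hint, intervalIntegral.integral_sub, hI, hαI, sub_zero]
  · refine ContinuousOn.intervalIntegrable ?_
    rw [uIcc_of_le h01.le]
    exact hΓ.continuousOn_deriv_lagrangian hB hl hW
  · refine ContinuousOn.intervalIntegrable ?_
    rw [uIcc_of_le h01.le]
    exact hαc.const_mul m |>.congr fun _ _ => rfl

omit [FiniteDimensional ℝ E] [CompleteSpace E] in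
/-- The conservation law of the central velocity, from the variations of the central component. -/
theorem centralVelocity_const_of_hamiltonPrinciple (hB : IsCocycleOn W B)
    (hl : IsSmoothFunctional bc l) (hγ : SmoothExtFamily γ)
    (h01 : t₀ < t₁) (hW : ∀ t ∈ Icc t₀ t₁, (γ t).1 ∈ W ∧ (γ t).1⁻¹ ∈ W)
    (H : HamiltonPrinciple (E := E) l B γ t₀ t₁) :
    ∃ m, ∀ t ∈ Icc t₀ t₁, centralVelocity B γ t = m := by
  have hd : ∀ t ∈ Icc t₀ t₁, HasDerivAt (centralVelocity B γ) 0 t := by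
    refine deriv_eq_of_integral_eq_zero (q := fun _ => 0) h01 (fun t ht =>
      (hγ.contDiffAt_centralVelocity hB (hW t ht).1 (hW t ht).2).of_le (by simp))
      continuousOn_const fun f hf hfs => ?_
    have hfe : ∀ t, t ∉ Ioo t₀ t₁ → f t = 0 := fun t ht =>
      image_eq_zero_of_notMem_tsupport fun h => ht (hfs h)
    obtain ⟨Γ, hΓe⟩ : ∃ Γ : ℝ × ℝ → mapGroup E G bc × ℝ,
        ∀ z, Γ z = ((γ z.2).1, (γ z.2).2 + z.1 * f z.2) := ⟨_, fun _ => rfl⟩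
    have hΓ : SmoothExtFamily Γ := by
      rw [funext hΓe]
      exact ⟨hγ.1.comp (c := fun z : ℝ × ℝ => z.2) contDiff_snd,
        (hγ.2.comp contDiff_snd).add (contDiff_fst.mul (hf.comp contDiff_snd))⟩
    have hΓ0 : ∀ t, Γ (0, t) = γ t := fun t => by simp [hΓe]
    have hfix : ∀ ε, Γ (ε, t₀) = γ t₀ ∧ Γ (ε, t₁) = γ t₁ := fun ε => by simp [hΓe, hfe t₀, hfe t₁]
    have hI := (hΓ.hasDerivAt_action (l := l) hB hl h01.le
      (fun t ht => by rw [hΓ0]; exact hW t ht)).unique (H Γ hΓ hΓ0 hfix)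
    refine Eq.trans (intervalIntegral.integral_congr fun t ht => ?_) hI
    rw [uIcc_of_le h01.le] at ht
    have hac : ∀ ε : ℝ, centralVelocity B (fun τ => Γ (ε, τ)) t =
        centralVelocity B γ t + ε * deriv f t := by
      intro ε
      have h1 : DifferentiableAt ℝ (fun τ => (extMul B (extInv B (γ t)) (γ τ)).2) t :=
        (((hγ.contDiffAt_extMul_extInv hB (hW t ht).1 (hW t ht).2).comp
          (f := fun q : ℝ => (t, q)) t (by fun_prop)).differentiableAt (by simp))
      have h2 := (h1.hasDerivAt.add
        (((hf.differentiable (by simp)).differentiableAt (x := t)).hasDerivAt.const_mul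
          ε)).sub_const (ε * f t)
      refine (h2.congr_of_eventuallyEq (Eventually.of_forall fun τ => ?_)).deriv
      simp only [hΓe, extMul, extInv, Pi.add_apply]
      ring
    have h3 : (fun ε : ℝ => lagrangian (E := E) l B (fun τ => Γ (ε, τ)) t) = fun ε =>
        l (velocity (fun τ => (γ τ).1) t) +
          (centralVelocity B γ t + ε * deriv f t) ^ 2 / 2 := by
      funext ε
      rw [← hac ε, show (fun τ => (γ τ).1) = fun τ => (Γ (ε, τ)).1 from
        funext fun τ => by rw [hΓe]]
      rfl
    have h4 := ((((hasDerivAt_id (0 : ℝ)).mul_const (deriv f t)).const_add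
      (centralVelocity B γ t)).pow 2).div_const 2 |>.const_add (l (velocity (fun τ => (γ τ).1) t))
    simp only [h3]
    refine Eq.trans ?_ h4.deriv.symm
    simp
    ring
  refine ⟨centralVelocity B γ t₀, fun t ht => ?_⟩
  exact constant_of_has_deriv_right_zero
    (fun s hs => (hd s hs).continuousAt.continuousWithinAt)
    (fun s hs => (hd s (Ico_subset_Icc_self hs)).hasDerivWithinAt) t ht

end Equivalence

section Equivalence

variable {E : Type*} [NormedAddCommGroup E] [NormedSpace ℝ E] [FiniteDimensional ℝ E]
  [CompleteSpace E]
  {G : Type*} [TopologicalSpace G] [ChartedSpace E G] [Group G] [LieGroup 𝓘(ℝ, E) ∞ G]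
  {bc : BoundaryCond}
  {W : Set (mapGroup E G bc)} {B : mapGroup E G bc → mapGroup E G bc → ℝ}
  {l : (ℝ → E) → ℝ} {c : (ℝ → E) → (ℝ → E) → ℝ}
  {γ : ℝ → mapGroup E G bc × ℝ} {t₀ t₁ : ℝ}

/-- The statement of `reducedPrinciple_iff_eulerPoincare_of_homogeneous` for the bracket of `𝔤`. -/
theorem reducedPrinciple_iff_eulerPoincare (hl : IsSmoothFunctional bc l) {M : ℝ → ℝ → E}
    (hM : IsSmoothFamily bc M) (m : ℝ) (ht : t₀ < t₁)
    (hcs : ∀ t, ∀ ξ ∈ mapSpace E bc, ∀ r : ℝ, c (M t) (fun x => r • ξ x) = r * c (M t) ξ)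
    (hcc : ∀ η : ℝ → ℝ → E, IsSmoothFamily bc η → ContDiff ℝ 1 (fun t => c (M t) (η t))) :
    ReducedPrinciple (E := E) (G := G) bc l c M m t₀ t₁ ↔
      EulerPoincare (E := E) (G := G) bc l c M m t₀ t₁ :=
  reducedPrinciple_iff_eulerPoincare_of_homogeneous hl (modelBracketL E G) c hM m ht hcs hcc

theorem tfae_hamiltonPrinciple (hB : IsCocycleOn W B)
    (hc : IsLieCocycleOf (E := E) B c) (hl : IsSmoothFunctional bc l) (hγ : SmoothExtFamily γ)
    (h01 : t₀ < t₁) (hW : ∀ t ∈ Icc t₀ t₁, (γ t).1 ∈ W ∧ (γ t).1⁻¹ ∈ W) {m : ℝ}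
    (ha : ∀ t ∈ Icc t₀ t₁, centralVelocity B γ t = m) :
    List.TFAE [HamiltonPrinciple (E := E) l B γ t₀ t₁, EulerLagrange (E := E) l B γ t₀ t₁,
      ReducedPrinciple (E := E) bc l c (velocity (fun t => (γ t).1)) m t₀ t₁,
      EulerPoincare (E := E) bc l c (velocity (fun t => (γ t).1)) m t₀ t₁] := by
  tfae_have 1 → 4 := eulerPoincare_of_hamiltonPrinciple hB hc hl hγ h01 hW ha
  tfae_have 4 → 2 := eulerLagrange_of_eulerPoincare hB hc hl h01 hW ha
  tfae_have 2 → 1 := hamiltonPrinciple_of_eulerLagrange hB hl h01 hW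
  tfae_have 3 ↔ 4 := by
    have hV := hγ.isSmoothFamily_velocity (E := E)
    exact reducedPrinciple_iff_eulerPoincare hl hV m h01
      (fun t ξ hξ r => hc.smul_right (hV.mem t) hξ r)
      fun η hη => (hc.contDiff hB hV hη).of_le (by simp)
  tfae_finish

end Equivalence

/-! ### Integration over space -/

section Integral

variable {bc : BoundaryCond}

theorem hasCompactSupport_of_holds_vanishing {φ : ℝ → ℝ}
    (hφ : BoundaryCond.vanishing.Holds 0 φ) : HasCompactSupport φ := by
  obtain ⟨R, hR⟩ := hφ
  refine HasCompactSupport.intro (isCompact_Icc (a := -R) (b := R)) fun x hx => hR x ?_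
  by_contra h
  exact hx (abs_le.1 (not_le.1 h).le)

theorem integral_add_smul {φ ψ : ℝ → ℝ} (hφ : φ ∈ mapSpace ℝ bc) (hψ : ψ ∈ mapSpace ℝ bc)
    (r : ℝ) : bc.integral (fun x => φ x + r • ψ x) = bc.integral φ + r * bc.integral ψ := by
  cases bc with
  | periodic P hP =>
    simp only [BoundaryCond.integral, smul_eq_mul]
    rw [intervalIntegral.integral_add (hφ.1.continuous.intervalIntegrable _ _)
      ((hψ.1.continuous.const_mul r).intervalIntegrable _ _), intervalIntegral.integral_const_mul]
  | vanishing =>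
    simp only [BoundaryCond.integral, smul_eq_mul]
    rw [integral_add (hφ.1.continuous.integrable_of_hasCompactSupport
        (hasCompactSupport_of_holds_vanishing hφ.2))
      ((hψ.1.continuous.integrable_of_hasCompactSupport
        (hasCompactSupport_of_holds_vanishing hψ.2)).const_mul r), integral_const_mul]

theorem integral_const_mul_space (φ : ℝ → ℝ) (r : ℝ) :
    bc.integral (fun x => r * φ x) = r * bc.integral φ := by
  cases bc with
  | periodic P hP => exact intervalIntegral.integral_const_mul _ _
  | vanishing => exact integral_const_mul _ _

theorem IsSmoothFamily.deriv_space {E F : Type*} [NormedAddCommGroup E] [NormedSpace ℝ E]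
    [NormedAddCommGroup F] [NormedSpace ℝ F] {ξ : F → ℝ → E} (hξ : IsSmoothFamily bc ξ) :
    IsSmoothFamily bc (fun p x => _root_.deriv (ξ p) x) := by
  constructor
  · have h : (fun z : F × ℝ => _root_.deriv (ξ z.1) z.2) = fun z =>
        _root_.fderiv ℝ (fun z : F × ℝ => ξ z.1 z.2) z (0, 1) := by
      funext z
      exact ((hξ.1.differentiable (by simp)).differentiableAt.hasFDerivAt.comp_hasDerivAt
        (f := fun x : ℝ => (z.1, x)) z.2
        ((hasDerivAt_const z.2 z.1).prodMk (hasDerivAt_id z.2))).deriv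
    rw [h]
    exact (hξ.1.fderiv_right (by simp)).clm_apply contDiff_const
  · have h2 := hξ.2
    cases bc with
    | periodic P hP =>
      intro p x
      have h3 := deriv_comp_add_const (ξ p) P x
      exact h3.symm.trans (congrArg (fun f => _root_.deriv f x) (funext (h2 p)))
    | vanishing =>
      intro p
      obtain ⟨R, hR⟩ := h2 p
      refine ⟨R + 1, hR.mono fun q hq x hx => ?_⟩
      have h4 : ξ q =ᶠ[𝓝 x] fun _ => 0 := by
        have : ∀ᶠ y in 𝓝 x, R < |y| :=
          continuous_abs.continuousAt.eventually_const_lt (by linarith)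
        exact this.mono fun y hy => hq y hy.le
      exact h4.deriv_eq.trans (deriv_const _ _)

theorem integral_deriv_eq_zero {φ : ℝ → ℝ} (hφ : φ ∈ mapSpace ℝ bc) :
    bc.integral (fun x => deriv φ x) = 0 := by
  have hd : Differentiable ℝ φ := hφ.1.differentiable (by simp)
  have hφ' := ((isSmoothFamily_const (F := ℝ) hφ).deriv_space).mem 0
  cases bc with
  | periodic P hP =>
    refine (intervalIntegral.integral_deriv_eq_sub (fun x _ => hd x)
      (hφ'.1.continuous.intervalIntegrable _ _)).trans ?_
    have := hφ.2 0
    rw [zero_add] at this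
    rw [this, sub_self]
  | vanishing =>
    exact integral_eq_zero_of_hasDerivAt_of_integrable (fun x => (hd x).hasDerivAt)
      (hφ'.1.continuous.integrable_of_hasCompactSupport
        (hasCompactSupport_of_holds_vanishing hφ'.2))
      (hφ.1.continuous.integrable_of_hasCompactSupport
        (hasCompactSupport_of_holds_vanishing hφ.2))

/-- The space integral is a smooth functional, so that the calculus of functionals applies to it. -/
theorem isSmoothFunctional_integral : IsSmoothFunctional bc bc.integral := by
  intro n φ hφ
  cases bc with
  | periodic P hP => exact contDiff_intervalIntegral hP.le hφ.1
  | vanishing =>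
    refine contDiff_iff_contDiffAt.2 fun σ₀ => ?_
    obtain ⟨R, hR⟩ := hφ.2 σ₀
    have h1 : ContDiff ℝ ∞ fun σ => ∫ x in (-(|R| + 1))..(|R| + 1), φ σ x :=
      contDiff_intervalIntegral (by linarith [abs_nonneg R]) hφ.1
    refine h1.contDiffAt.congr_of_eventuallyEq (hR.mono fun σ hσ => ?_)
    refine (intervalIntegral.integral_eq_integral_of_support_subset fun x hx => ?_).symm
    have h2 : |x| < |R| + 1 := by
      by_contra h
      exact hx (hσ x (by linarith [le_abs_self R]))
    exact ⟨(abs_lt.1 h2).1, (abs_lt.1 h2).2.le⟩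

/-- Differentiation under the space integral. -/
theorem hasDerivAt_integral {φ : ℝ → ℝ → ℝ} (hφ : IsSmoothFamily bc φ) (t : ℝ) :
    HasDerivAt (fun τ => bc.integral (φ τ))
      (bc.integral (fun x => deriv (fun τ => φ τ x) t)) t := by
  refine (isSmoothFunctional_integral.hasDerivAt hφ t).congr_deriv ?_
  rw [dirDeriv, funext fun r => integral_add_smul (hφ.mem t) (hφ.deriv.mem t) r]
  exact (((hasDerivAt_id (0 : ℝ)).mul_const _).const_add _).deriv.trans (one_mul _)

/-- The fundamental lemma of the calculus of variations for the pairing of coefficient functions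
with maps satisfying the boundary condition. -/
theorem eq_zero_of_integral_mul_eq_zero {h : ℝ → ℝ} (hh : ContDiff ℝ ∞ h) (hd : bc.HoldsDual h)
    (H : ∀ φ ∈ mapSpace ℝ bc, bc.integral (fun x => φ x * h x) = 0) (x : ℝ) : h x = 0 := by
  cases bc with
  | periodic P hP =>
    obtain ⟨y, hy, hxy⟩ := Function.Periodic.exists_mem_Ico₀ (f := h) hd hP x
    rw [hxy]
    by_contra hne
    refine (intervalIntegral.integral_pos (f := fun x => h x * h x) hP
      (hh.continuous.mul hh.continuous).continuousOn (fun x _ => mul_self_nonneg _)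
      ⟨y, Ico_subset_Icc_self hy, mul_self_pos.2 hne⟩).ne' (H h ⟨hh, hd⟩)
  | vanishing =>
    refine eqOn_Icc_zero_of_integral_mul_eq_zero (a := x - 1) (b := x + 1) (by linarith)
      hh.continuous.continuousOn (fun f hf hfs => ?_) x ⟨by linarith, by linarith⟩
    have hf0 : ∀ y, y ∉ Ioo (x - 1) (x + 1) → f y = 0 := fun y hy =>
      image_eq_zero_of_notMem_tsupport fun h => hy (hfs h)
    rw [intervalIntegral.integral_eq_integral_of_support_subset fun y hy => Ioo_subset_Ioc_self
      (by_contra fun h => hy (by simp [hf0 y h]))]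
    refine H f ⟨hf, |x| + 1, fun y hy => hf0 y fun hy' => ?_⟩
    have : |y| < |x| + 1 := by
      have h1 := abs_add_le x (y - x)
      have h2 : |y - x| < 1 := abs_lt.2 ⟨by linarith [hy'.1], by linarith [hy'.2]⟩
      rw [add_sub_cancel] at h1
      linarith
    linarith

end Integral

/-! ### The derivative cocycle -/

section InvariantForm

variable {E : Type*} [NormedAddCommGroup E] [NormedSpace ℝ E] [CompleteSpace E]
  {bc : BoundaryCond}

omit [CompleteSpace E] in
theorem isSmoothFamily_pairing {μ : ℝ → ℝ → E} (hμ : ContDiff ℝ ∞ fun p : ℝ × ℝ => μ p.1 p.2)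
    (hd : ∀ t, bc.HoldsDual (μ t)) {ξ : ℝ → E} (hξ : ξ ∈ mapSpace E bc) (κ : E →L[ℝ] E →L[ℝ] ℝ) :
    IsSmoothFamily bc (fun t x => κ (μ t x) (ξ x)) := by
  refine ⟨(κ.contDiff.comp hμ).clm_apply (hξ.1.comp contDiff_snd), ?_⟩
  cases bc with
  | periodic P hP =>
    intro t x
    show κ (μ t (x + P)) (ξ (x + P)) = κ (μ t x) (ξ x)
    rw [hd t x, hξ.2 x]
  | vanishing =>
    obtain ⟨R, hR⟩ := hξ.2
    exact fun _ => ⟨R, Eventually.of_forall fun t x hx => by simp [hR x hx]⟩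

omit [CompleteSpace E] in
/-- Integration by parts in the space variable. -/
theorem integral_pairing_deriv {M ξ : ℝ → E} (hM : M ∈ mapSpace E bc) (hξ : ξ ∈ mapSpace E bc)
    (κ : E →L[ℝ] E →L[ℝ] ℝ) :
    bc.integral (fun x => κ (M x) (deriv ξ x)) = -bc.integral (fun x => κ (deriv M x) (ξ x)) := by
  have hM' := ((isSmoothFamily_const (F := ℝ) hM).deriv_space).mem 0
  have hξ' := ((isSmoothFamily_const (F := ℝ) hξ).deriv_space).mem 0
  have h1 := integral_add_smul (bilin_mem_mapSpace hM hξ' κ) (bilin_mem_mapSpace hM' hξ κ) 1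
  have h2 : (fun x => κ (M x) (deriv ξ x) + (1 : ℝ) • κ (deriv M x) (ξ x)) =
      deriv fun x => κ (M x) (ξ x) := by
    funext x
    have h3 := (κ.hasFDerivAt.comp_hasDerivAt x
      ((hM.1.differentiable (by simp)).differentiableAt (x := x)).hasDerivAt).clm_apply
      ((hξ.1.differentiable (by simp)).differentiableAt (x := x)).hasDerivAt
    rw [one_smul, add_comm]
    exact h3.deriv.symm
  rw [h2, integral_deriv_eq_zero (bilin_mem_mapSpace hM hξ κ)] at h1
  linarith

omit [CompleteSpace E] in
/-- The Euler–Poincaré equation with the cocycle `∫ κ(ξ, ∂ₓη) dx` of an invariant nondegenerate form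
`κ`, written out for a density `μ` of the variational derivative. Both sides of
`⟨δl/δM, ξ⟩ = ∫ κ(μ, ξ) dx` are smooth in time, so the equality on `[t₀, t₁]` gives the equality of
the two-sided time derivatives there. -/
theorem eulerPoincare_iff_of_invariant {l : (ℝ → E) → ℝ} (hl : IsSmoothFunctional bc l)
    (br : E →L[ℝ] E →L[ℝ] E) (κ : E →L[ℝ] E →L[ℝ] ℝ)
    (hskew : ∀ v w, br v w = -br w v) (hinv : ∀ u v w, κ (br u v) w = κ u (br v w))
    (hnd : ∀ v, (∀ w, κ v w = 0) → v = 0) {M μ : ℝ → ℝ → E}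
    (hM : IsSmoothFamily bc M) (hμ : ContDiff ℝ ∞ fun p : ℝ × ℝ => μ p.1 p.2)
    (hd : ∀ t, bc.HoldsDual (μ t)) (m : ℝ) {t₀ t₁ : ℝ} (ht : t₀ < t₁)
    (hrep : ∀ t ∈ Icc t₀ t₁, ∀ ξ ∈ mapSpace E bc,
      dirDeriv l (M t) ξ = bc.integral (fun x => κ (μ t x) (ξ x))) :
    (∀ ξ ∈ mapSpace E bc, ∀ t ∈ Icc t₀ t₁,
      HasDerivAt (fun τ => dirDeriv l (M τ) ξ)
        (dirDeriv l (M t) (fun x => br (M t x) (ξ x)) +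
          m * bc.integral (fun x => κ (M t x) (deriv ξ x))) t) ↔
    ∀ t ∈ Icc t₀ t₁, ∀ x,
      HasDerivAt (fun τ => μ τ x) (-br (M t x) (μ t x) - m • deriv (M t) x) t := by
  have hμd : ∀ x, Differentiable ℝ fun τ => μ τ x := fun x =>
    (hμ.comp (by fun_prop : ContDiff ℝ ∞ fun τ : ℝ => (τ, x))).differentiable (by simp)
  have hμ' : ContDiff ℝ ∞ fun p : ℝ × ℝ => deriv (fun τ => μ τ p.2) p.1 := by
    have h : (fun p : ℝ × ℝ => deriv (fun τ => μ τ p.2) p.1) = fun p =>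
        fderiv ℝ (fun z : ℝ × ℝ => μ z.1 z.2) p (1, 0) := by
      funext p
      exact (hasDerivAt_comp_fst ((hμ.differentiable (by simp)).differentiableAt (x := p))).deriv
    rw [h]
    exact (hμ.fderiv_right (by simp)).clm_apply contDiff_const
  have hd' : ∀ t, bc.HoldsDual fun x => deriv (fun τ => μ τ x) t := by
    intro t
    cases bc with
    | periodic P hP =>
      intro x
      exact congrArg (fun f : ℝ → E => deriv f t) (funext fun τ => hd τ x)
    | vanishing => trivial
  have hMx := hM.deriv_space
  -- the defect of the partial differential equation
  set Z : ℝ → ℝ → E := fun t x =>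
    deriv (fun τ => μ τ x) t + br (M t x) (μ t x) + m • deriv (M t) x with hZ
  have hZc : ContDiff ℝ ∞ fun p : ℝ × ℝ => Z p.1 p.2 :=
    (hμ'.add ((br.contDiff.comp hM.1).clm_apply hμ)).add (hMx.1.const_smul m)
  have hZd : ∀ t, bc.HoldsDual (Z t) := by
    intro t
    have h1 := hd t
    have h2 := hd' t
    have h3 := hM.2.holds t
    have h4 := hMx.2.holds t
    cases bc with
    | periodic P hP =>
      intro x
      have h2' : deriv (fun τ => μ τ (x + P)) t = deriv (fun τ => μ τ x) t := h2 x
      have h4' : deriv (M t) (x + P) = deriv (M t) x := h4 x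
      simp only [hZ]
      rw [h2', h1 x, h3 x, h4']
    | vanishing => trivial
  have hpair : ∀ ξ ∈ mapSpace E bc, ∀ t ∈ Icc t₀ t₁,
      deriv (fun τ => dirDeriv l (M τ) ξ) t - (dirDeriv l (M t) (fun x => br (M t x) (ξ x)) +
          m * bc.integral (fun x => κ (M t x) (deriv ξ x))) =
        bc.integral (fun x => κ (Z t x) (ξ x)) := by
    intro ξ hξ t htI
    have hp : DifferentiableAt ℝ (fun τ => dirDeriv l (M τ) ξ) t :=
      ((hl.contDiff_dirDeriv hM (isSmoothFamily_const hξ)).differentiable (by simp)) t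
    have hr := hasDerivAt_integral (isSmoothFamily_pairing hμ hd hξ κ) t
    have hu : deriv (fun τ => dirDeriv l (M τ) ξ) t = _ :=
      (uniqueDiffOn_Icc ht t htI).eq_deriv _ (hp.hasDerivAt.hasDerivWithinAt)
        (hr.hasDerivWithinAt.congr (fun τ hτ => hrep τ hτ ξ hξ) (hrep t htI ξ hξ))
    have hbr := bilin_mem_mapSpace (hM.mem t) hξ br
    rw [hu, hrep t htI _ hbr, integral_pairing_deriv (hM.mem t) hξ κ]
    have e1 : (fun x => deriv (fun τ => κ (μ τ x) (ξ x)) t) =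
        fun x => κ (deriv (fun τ => μ τ x) t) (ξ x) := funext fun x =>
      ((κ.flip (ξ x)).hasFDerivAt.comp_hasDerivAt t (hμd x t).hasDerivAt).deriv
    have e2 : (fun x => κ (μ t x) (br (M t x) (ξ x))) =
        fun x => -κ (br (M t x) (μ t x)) (ξ x) := funext fun x => by
      rw [← hinv, hskew, map_neg, neg_apply]
    have i1 := ((isSmoothFamily_pairing hμ' hd' hξ κ).mem t)
    have i2 : (fun x => κ (br (M t x) (μ t x)) (ξ x)) ∈ mapSpace ℝ bc := by
      have h1 := (isSmoothFamily_pairing hμ hd hbr κ).mem t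
      rw [e2] at h1
      simpa using smul_mem_mapSpace (-1) h1
    have i3 := bilin_mem_mapSpace (hMx.mem t) hξ κ
    have e3 : (fun x => κ (Z t x) (ξ x)) = fun x => (κ (deriv (fun τ => μ τ x) t) (ξ x) +
        (1 : ℝ) • κ (br (M t x) (μ t x)) (ξ x)) + m • κ (deriv (M t) x) (ξ x) := by
      funext x
      simp [hZ]
    have e4 : (fun x => -κ (br (M t x) (μ t x)) (ξ x)) =
        fun x => (-1 : ℝ) * κ (br (M t x) (μ t x)) (ξ x) := by simp
    have i12 : (fun x => κ (deriv (fun τ => μ τ x) t) (ξ x) +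
        (1 : ℝ) • κ (br (M t x) (μ t x)) (ξ x)) ∈ mapSpace ℝ bc :=
      add_mem_mapSpace i1 (smul_mem_mapSpace 1 i2)
    rw [e3, integral_add_smul i12 i3, integral_add_smul i1 i2, e1, e2, e4, integral_const_mul_space]
    ring
  have hPDE : ∀ t x, HasDerivAt (fun τ => μ τ x) (-br (M t x) (μ t x) - m • deriv (M t) x) t ↔
      Z t x = 0 := by
    intro t x
    constructor
    · intro h
      simp only [hZ]
      rw [h.deriv]
      abel
    · intro h
      refine (hμd x t).hasDerivAt.congr_deriv ?_
      rw [← sub_eq_zero, ← h]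
      simp only [hZ]
      abel
  constructor
  · intro H t htI x
    refine (hPDE t x).2 (hnd _ fun w => ?_)
    refine eq_zero_of_integral_mul_eq_zero (bc := bc) (h := fun x => κ (Z t x) w) ?_ ?_ ?_ x
    · exact (κ.flip w).contDiff.comp (hZc.comp (by fun_prop : ContDiff ℝ ∞ fun x : ℝ => (t, x)))
    · have h1 := hZd t
      cases bc with
      | periodic P hP => exact fun x => congrArg (fun v => κ v w) (h1 x)
      | vanishing => trivial
    · intro φ hφ
      have hξ : (fun x => φ x • w) ∈ mapSpace E bc := by
        refine ⟨hφ.1.smul contDiff_const, ?_⟩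
        have h1 := hφ.2
        cases bc with
        | periodic P hP => exact fun x => congrArg (fun r : ℝ => r • w) (h1 x)
        | vanishing =>
          obtain ⟨R, hR⟩ := h1
          exact ⟨R, fun x hx => by simp [hR x hx]⟩
      have h2 := hpair _ hξ t htI
      rw [(H _ hξ t htI).deriv, sub_self] at h2
      simpa using h2.symm
  · intro H ξ hξ t htI
    have hp : DifferentiableAt ℝ (fun τ => dirDeriv l (M τ) ξ) t :=
      ((hl.contDiff_dirDeriv hM (isSmoothFamily_const hξ)).differentiable (by simp)) t
    refine hp.hasDerivAt.congr_deriv (sub_eq_zero.1 ?_)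
    rw [hpair ξ hξ t htI]
    have h1 : (fun x => κ (Z t x) (ξ x)) = fun x => (0 : ℝ) * 0 := by
      funext x
      rw [(hPDE t x).1 (H t htI x)]
      simp
    rw [h1, integral_const_mul_space, zero_mul]

end InvariantForm

/-! ### The Killing form -/

section Killing

variable {E : Type*} [NormedAddCommGroup E] [NormedSpace ℝ E] [FiniteDimensional ℝ E]
  [CompleteSpace E]
  {G : Type*} [TopologicalSpace G] [ChartedSpace E G] [Group G] [LieGroup 𝓘(ℝ, E) ∞ G]
  {bc : BoundaryCond}

variable (E G) in
/-- The Killing form of `𝔤` as a continuous bilinear map on the underlying normed space. -/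
def killingFormL : E →L[ℝ] E →L[ℝ] ℝ :=
  (LinearMap.mk₂ ℝ (fun v w : E => killingForm ℝ (GroupLieAlgebra 𝓘(ℝ, E) G) v w)
    (fun a b c => LinearMap.map_add₂ (killingForm ℝ (GroupLieAlgebra 𝓘(ℝ, E) G)) a b c)
    (fun r a b => LinearMap.map_smul₂ (killingForm ℝ (GroupLieAlgebra 𝓘(ℝ, E) G)) r a b)
    (fun a b c => map_add (killingForm ℝ (GroupLieAlgebra 𝓘(ℝ, E) G) a) b c)
    (fun r a b =>
      map_smul (killingForm ℝ (GroupLieAlgebra 𝓘(ℝ, E) G) a) r b)).toContinuousBilinearMap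

theorem modelBracketL_skew (v w : E) : modelBracketL E G v w = -modelBracketL E G w v :=
  (lie_skew (L := GroupLieAlgebra 𝓘(ℝ, E) G) v w).symm

theorem killingFormL_modelBracketL (u v w : E) :
    killingFormL E G (modelBracketL E G u v) w = killingFormL E G u (modelBracketL E G v w) :=
  LieModule.traceForm_apply_lie_apply ℝ (GroupLieAlgebra 𝓘(ℝ, E) G) (GroupLieAlgebra 𝓘(ℝ, E) G)
    u v w

/-- Cartan's criterion: the Killing form of a semisimple Lie algebra is nondegenerate. -/
theorem eq_zero_of_killingFormL_eq_zero
    (hss : LieAlgebra.IsSemisimple ℝ (GroupLieAlgebra 𝓘(ℝ, E) G)) (v : E)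
    (hv : ∀ w, killingFormL E G v w = 0) : v = 0 := by
  have : FiniteDimensional ℝ (GroupLieAlgebra 𝓘(ℝ, E) G) := ‹FiniteDimensional ℝ E›
  have h := (LieAlgebra.IsKilling.killingForm_nondegenerate ℝ (GroupLieAlgebra 𝓘(ℝ, E) G)).1
  exact h v hv

variable {l : (ℝ → E) → ℝ} {M μ : ℝ → ℝ → E} {t₀ t₁ : ℝ}

variable (G) in
theorem reducedPrinciple_iff_eulerPoincare_derivativeCocycle (hl : IsSmoothFunctional bc l)
    (hM : IsSmoothFamily bc M) (m : ℝ) (ht : t₀ < t₁) :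
    ReducedPrinciple (E := E) (G := G) bc l (derivativeCocycle bc) M m t₀ t₁ ↔
      EulerPoincare (E := E) (G := G) bc l (derivativeCocycle bc) M m t₀ t₁ := by
  refine reducedPrinciple_iff_eulerPoincare hl hM m ht (fun t ξ hξ r => ?_) fun η hη => ?_
  · show bc.integral (fun x => killingFormL E G (M t x) (deriv (fun x => r • ξ x) x)) =
      r * bc.integral (fun x => killingFormL E G (M t x) (deriv ξ x))
    rw [← integral_const_mul_space]
    congr 1
    funext x
    rw [deriv_fun_const_smul _ ((hξ.1.differentiable (by simp)) x), map_smul, smul_eq_mul]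
  · exact (isSmoothFunctional_integral.contDiff
      (hM.bilin hη.deriv_space (killingFormL E G))).of_le (by simp)

variable (G) in
theorem eulerPoincare_derivativeCocycle_iff_satisfiesPDE (hl : IsSmoothFunctional bc l)
    (hM : IsSmoothFamily bc M) (m : ℝ) (ht : t₀ < t₁)
    (hss : LieAlgebra.IsSemisimple ℝ (GroupLieAlgebra 𝓘(ℝ, E) G))
    (hμ : RepresentsVarDeriv (E := E) (G := G) bc l M μ t₀ t₁) :
    EulerPoincare (E := E) (G := G) bc l (derivativeCocycle bc) M m t₀ t₁ ↔
      SatisfiesPDE (E := E) (G := G) M μ m t₀ t₁ :=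
  eulerPoincare_iff_of_invariant hl (modelBracketL E G) (killingFormL E G) modelBracketL_skew
    killingFormL_modelBracketL (eq_zero_of_killingFormL_eq_zero hss) hM hμ.1 hμ.2.1 m ht hμ.2.2

end Killing

end CentralExtEP

end

theorem mainTheorem1
    {E : Type*} [NormedAddCommGroup E] [NormedSpace ℝ E] [FiniteDimensional ℝ E] [CompleteSpace E]
    {G : Type*} [TopologicalSpace G] [ChartedSpace E G] [Group G] [LieGroup 𝓘(ℝ, E) ∞ G]
    (bc : CentralExtEP.BoundaryCond)
    (l : (ℝ → GroupLieAlgebra 𝓘(ℝ, E) G) → ℝ) (hl : CentralExtEP.SmoothFunctional bc l)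
    (t₀ t₁ : ℝ) (ht : t₀ < t₁) :
    (∀ (W : Set (CentralExtEP.mapGroup E G bc))
        (B : CentralExtEP.mapGroup E G bc → CentralExtEP.mapGroup E G bc → ℝ)
        (c : (ℝ → GroupLieAlgebra 𝓘(ℝ, E) G) → (ℝ → GroupLieAlgebra 𝓘(ℝ, E) G) → ℝ)
        (γ : ℝ → CentralExtEP.mapGroup E G bc × ℝ),
      CentralExtEP.IsCocycleOn W B → CentralExtEP.IsLieCocycleOf B c →
      CentralExtEP.SmoothExtFamily γ → (∀ t ∈ Icc t₀ t₁, (γ t).1 ∈ W ∧ (γ t).1⁻¹ ∈ W) →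
      (CentralExtEP.HamiltonPrinciple l B γ t₀ t₁ →
        ∃ m, ∀ t ∈ Icc t₀ t₁, CentralExtEP.centralVelocity B γ t = m) ∧
      ∀ m : ℝ, (∀ t ∈ Icc t₀ t₁, CentralExtEP.centralVelocity B γ t = m) →
        List.TFAE [
          CentralExtEP.HamiltonPrinciple l B γ t₀ t₁,
          CentralExtEP.EulerLagrange l B γ t₀ t₁,
          CentralExtEP.ReducedPrinciple bc l c
            (CentralExtEP.velocity (fun t => (γ t).1)) m t₀ t₁,
          CentralExtEP.EulerPoincare bc l c
            (CentralExtEP.velocity (fun t => (γ t).1)) m t₀ t₁]) ∧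
    (∀ (M : ℝ → ℝ → GroupLieAlgebra 𝓘(ℝ, E) G) (m : ℝ), CentralExtEP.SmoothAlgebraFamily bc M →
      (CentralExtEP.ReducedPrinciple bc l (CentralExtEP.derivativeCocycle bc) M m t₀ t₁ ↔
        CentralExtEP.EulerPoincare bc l (CentralExtEP.derivativeCocycle bc) M m t₀ t₁) ∧
      (LieAlgebra.IsSemisimple ℝ (GroupLieAlgebra 𝓘(ℝ, E) G) →
        ∀ μ : ℝ → ℝ → GroupLieAlgebra 𝓘(ℝ, E) G,
          CentralExtEP.RepresentsVarDeriv bc l M μ t₀ t₁ →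
          (CentralExtEP.EulerPoincare bc l (CentralExtEP.derivativeCocycle bc) M m t₀ t₁ ↔
            CentralExtEP.SatisfiesPDE M μ m t₀ t₁))) := by
  have hl' : CentralExtEP.IsSmoothFunctional (E := E) bc l := hl
  refine ⟨fun W B c γ hB hc hγ hW => ⟨fun H => ?_, fun m ha => ?_⟩,
    fun M m hM => ⟨?_, fun hss μ hμ => ?_⟩⟩
  · exact CentralExtEP.centralVelocity_const_of_hamiltonPrinciple hB hl' hγ ht hW H
  · exact CentralExtEP.tfae_hamiltonPrinciple hB hc hl' hγ ht hW ha
  · exact CentralExtEP.reducedPrinciple_iff_eulerPoincare_derivativeCocycle G hl' hM m ht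
  · exact CentralExtEP.eulerPoincare_derivativeCocycle_iff_satisfiesPDE G hl' hM m ht hss hμ
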